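/- **Notation.** Partitions are $\lambda=(\lambda_1\ge\lambda_2\ge\cdots)$, with conjugate $\lambda^\vee$, size $|\lambda|$ and length $\ell(\lambda)$. Let $K$ be a field of characteristic $0$ and let $q^{1/2}\in K^\times$ not be a root of unity (for example a complex number, or an indeterminate). The Schur function $s_\lambda$ is regarded as a polynomial in the power sums $p_n$, and $s_\lambda(x_1,\dots,x_N)$ is its value at $p_n=\sum_i x_i^n$. For a partition $\eta$, $s_\lambda(q^{\eta}t^{\rho})$ is its value at $$p_n(q^\eta t^\rho)=\sum_{i=1}^{\ell(\eta)}(q^{n\eta_i}-1)t^{n(1/2-i)}+\frac1{t^{n/2}-t^{-n/2}}.$$ Define the formal power series in $Q$ $$Z_{\lambda,\mu}(Q;q,t)=\sum_\eta s_\lambda(q^\eta t^\rho)s_\mu(q^\eta t^\rho)\prod_{(i,j)\in\eta}\frac{Q}{(1-q^{\eta_i-j+1}t^{\eta_j^\vee-i})(1-q^{-\eta_i+j}t^{-\eta_j^\vee+i-1})},$$ and put $g_\lambda=\prod_{(i,j)\in\lambda}(-1)\,q^{\lambda_i-\lambda_j^\vee+i-j}$. **Proposition 4.4.** Let $\lambda,\mu$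 be partitions. The quotient $Z_{\lambda,\mu}(Q;q,q)/Z_{\bullet,\bullet}(Q;q,q)$ of power series is a polynomial in $Q$, so it can be evaluated at $Q=q^N$, and for every integer $N\ge 0$: 1. $$(-1)^{|\lambda|+|\mu|}\frac{Z_{\lambda,\mu}(q^N;q,q)}{Z_{\bullet,\bullet}(q^N;q,q)}=(-1)^{|\lambda|+|\mu|}g_\lambda\, g_\mu\; s_\mu\big(\{q^{\lambda_i+N-i+\frac12}\}_{1\le i\le N}\big)\,s_\lambda\big(\{q^{i-\frac12}\}_{1\le i\le N}\big).$$ 2. This equals $q^{(|\lambda|+|\mu|)/2}P_N(q)$, where $P_N$ is a polynomial with non-negative integer coefficients that depends only on $\lambda,\mu,N$ (not on $K$ or $q^{1/2}$). 3. It vanishes if $0\le N<\max\{\ell(\lambda),\ell(\mu)\}$. 4. It coincides, up to an overall factor, with the quantum $\mathfrak{gl}(N)$ invariant $W^{(N)}_{\lambda,\mu}$ of the Hopf link with components colored by the irreducible representations of highest weights $\lambda$ and $\mu$: $$\frac{Z_{\lambda,\mu}(q^N;q,q)}{Z_{\bullet,\bullet}(q^N;q,q)}=g_\lambda\, g_\mu\;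 q^{N(|\lambda|+|\mu|)/2}\,W^{(N)}_{\lambda,\mu}.$$ Here $W^{(N)}_{\lambda,\mu}$ is the (unnormalized, blackboard framed) invariant of the closure of the 2-braid $\sigma_1^2$ given by the R-matrix of the vector representation $V=K^N$ with eigenvalues $q^{1/2}$ and $-q^{-1/2}$: the two strands are replaced by $|\lambda|$ and $|\mu|$ parallel strands, the primitive Hecke algebra idempotents of shapes $\lambda$ and $\mu$ (for the row-reading standard tableaux) are inserted, and the quantum trace on $V^{\otimes(|\lambda|+|\mu|)}$ is taken, which weights the $a$-th basis vector of $V$ by $q^{(N+1)/2-a}$. The invariant of a color of length greater than $N$ is $0$. -/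

import Mathlib

open scoped Polynomial PowerSeries

noncomputable section

namespace HopfGIKV

/-! ### Schur functions as functions of the power sums

Partitions are Young diagrams; `l.rowLen i` is the part with (0-based) index `i`, `l.colLen j` the
part of the conjugate partition with index `j`, `l.colLen 0` the length and `l.card` the size. -/

/-- The complete homogeneous symmetric function `h_n` as a function of the power sums
`p 1, p 2, …`, through the recursion `n * h_n = p_1 h_{n-1} + p_2 h_{n-2} + ⋯ + p_n h_0`. -/
def complete {K : Type*} [Field K] (p : ℕ → K) : ℕ → K
  | 0 => 1
  | n + 1 => (∑ k : Fin (n + 1), p (k + 1) * complete p (n - k)) / ((n : K) + 1)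

/-- The Schur function `s_l` as a function of the power sums `p 1, p 2, …`:
the Jacobi-Trudi determinant of the `h_{l_i - i + j}`, where `h_m = 0` for `m < 0`. -/
def schur {K : Type*} [Field K] (l : YoungDiagram) (p : ℕ → K) : K :=
  (Matrix.of fun i j : Fin (l.colLen 0) =>
    if (i : ℕ) ≤ l.rowLen i + j then complete p (l.rowLen i + j - i) else 0).det

/-- The Schur polynomial `s_l (x_1, …, x_N)` in `N` variables. -/
def schurPoly {K : Type*} [Field K] (l : YoungDiagram) {N : ℕ} (x : Fin N → K) : K :=
  schur l fun n => ∑ i, x i ^ n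

/-! ### The refined partition sum -/

/-- There are finitely many partitions of `n`. -/
theorem finite_card_eq (n : ℕ) : {l : YoungDiagram | l.card = n}.Finite := by
  refine Set.Finite.of_finite_image (f := YoungDiagram.cells) ?_ ?_
  · refine (Finset.finite_toSet ((Finset.range n ×ˢ Finset.range n).powerset)).subset ?_
    rintro _ ⟨l, rfl, rfl⟩
    simp only [Finset.coe_powerset, Set.mem_preimage, Set.mem_powerset_iff, Finset.coe_subset]
    rintro ⟨i, j⟩ h
    have h' : (i, j) ∈ l := h
    have hi : i < l.colLen 0 :=
      (YoungDiagram.mem_iff_lt_colLen.1 h').trans_le (l.colLen_anti 0 j (Nat.zero_le _))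
    have hj : j < l.rowLen 0 :=
      (YoungDiagram.mem_iff_lt_rowLen.1 h').trans_le (l.rowLen_anti 0 i (Nat.zero_le _))
    rw [YoungDiagram.colLen_eq_card] at hi
    rw [YoungDiagram.rowLen_eq_card] at hj
    have h1 : (l.col 0).card ≤ l.cells.card := Finset.card_le_card (Finset.filter_subset _ _)
    have h2 : (l.row 0).card ≤ l.cells.card := Finset.card_le_card (Finset.filter_subset _ _)
    simp only [Finset.mem_product, Finset.mem_range]
    exact ⟨hi.trans_le h1, hj.trans_le h2⟩
  · intro a _ b _ h
    exact YoungDiagram.ext h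

/-- The finite set of all partitions of `n`. -/
def partitionsOf (n : ℕ) : Finset YoungDiagram := (finite_card_eq n).toFinset

/-- The power sum `p_n (q^η t^ρ) = ∑_{i=1}^{ℓ(η)} (q^{n η_i} - 1) t^{n (1/2 - i)}
+ 1 / (t^{n/2} - t^{-n/2})`, where `r = t^{1/2}`. -/
def powerSumRho {K : Type*} [Field K] (q r : K) (η : YoungDiagram) (n : ℕ) : K :=
  ∑ i ∈ Finset.range (η.colLen 0), (q ^ (n * η.rowLen i) - 1) * r ^ (-((n : ℤ) * (2 * i + 1)))
    + (r ^ n - (r ^ n)⁻¹)⁻¹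

/-- The formal power series in `Q`
`Z_{l,m}(Q;q,t) = ∑_η s_l(q^η t^ρ) s_m(q^η t^ρ) ∏_{(i,j) ∈ η}
Q / ((1 - q^{η_i-j+1} t^{η^∨_j-i}) (1 - q^{-η_i+j} t^{-η^∨_j+i-1}))`, where `t = r ^ 2`.
The indices `i, j` of a cell are 0-based in the code. -/
def Z {K : Type*} [Field K] (q r : K) (l m : YoungDiagram) : K⟦X⟧ :=
  PowerSeries.mk fun n => ∑ η ∈ partitionsOf n,
    schur l (powerSumRho q r η) * schur m (powerSumRho q r η) *
      ∏ c ∈ η.cells,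
        ((1 - q ^ ((η.rowLen c.1 : ℤ) - c.2) * (r ^ 2) ^ ((η.colLen c.2 : ℤ) - c.1 - 1)) *
          (1 - q ^ (-(η.rowLen c.1 : ℤ) + c.2 + 1) * (r ^ 2) ^ (-(η.colLen c.2 : ℤ) + c.1)))⁻¹

/-- The quotient `Z_{l,m}(Q;q,t) / Z_{•,•}(Q;q,t)` of formal power series in `Q`, `t = r ^ 2`.
The constant term of the denominator is `1`. -/
def Zinst {K : Type*} [Field K] (q r : K) (l m : YoungDiagram) : K⟦X⟧ :=
  Z q r l m * (Z q r ⊥ ⊥)⁻¹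

/-- The signed monomial `g_l = ∏_{(i,j) ∈ l} (-1) q^{l_i - l^∨_j + i - j}`. -/
def framing {K : Type*} [Field K] (q : K) (l : YoungDiagram) : K :=
  ∏ c ∈ l.cells, -(q ^ ((l.rowLen c.1 : ℤ) - l.colLen c.2 + c.1 - c.2))

/-! ### The colored Hopf link invariant

The quantum `gl(N)` (equivalently, up to a monomial, `sl(N)`) invariant is built from the
R-matrix of the vector representation `V = K^N` of quantum `gl(N)`. Endomorphisms of the `n`-fold
tensor power of `V` are matrices indexed by `Fin n → Fin N`. Throughout `u = q^{1/2}`. -/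

/-- Endomorphisms of the `n`-fold tensor power of `K^N`. -/
abbrev TensorEnd (K : Type*) (N n : ℕ) : Type _ := Matrix (Fin n → Fin N) (Fin n → Fin N) K

/-- The braid generator crossing the strands `i` and `i + 1` (0-based) acts by the R-matrix
`e_a ⊗ e_a ↦ u e_a ⊗ e_a`, `e_a ⊗ e_b ↦ e_b ⊗ e_a` for `a < b`, and
`e_a ⊗ e_b ↦ e_b ⊗ e_a + (u - u⁻¹) e_a ⊗ e_b` for `a > b`, in the two tensor factors
`i`, `i + 1`. (It is the identity if there are no such strands.) -/
def braidGen {K : Type*} [Field K] (u : K) (N n i : ℕ) : TensorEnd K N n :=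
  if h : i + 1 < n then
    let a : Fin n := ⟨i, by omega⟩
    let b : Fin n := ⟨i + 1, h⟩
    Matrix.of fun f g =>
      if f = g ∘ Equiv.swap a b then (if g a = g b then u else 1)
      else if f = g ∧ g b < g a then u - u⁻¹
      else 0
  else 1

/-- The operator of a positive braid, given as a word in the generators. -/
def braidOp {K : Type*} [Field K] (u : K) (N n : ℕ) (w : List ℕ) : TensorEnd K N n :=
  (w.map (braidGen u N n)).prod

/-- The positive braid in which a cable of `n` parallel strands crosses a cable of `m` parallel
strands, so that the two cables change places. -/
def crossWord (n m : ℕ) : List ℕ :=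
  (List.range m).flatMap fun j => (List.range n).map fun i => j + (n - 1 - i)

/-- The positive pure braid (Jucys-Murphy braid) in which the strand `a + k` makes one turn around
the strands `a, …, a + k - 1`. -/
def murphyWord (a k : ℕ) : List ℕ :=
  (List.range k).reverse.map (a + ·) ++ (List.range k).map (a + ·)

/-- The contents `j - i` of the cells `(i, j)` of `l`, listed row after row. -/
def contents (l : YoungDiagram) : List ℤ :=
  (List.range (l.colLen 0)).flatMap fun i => (List.range (l.rowLen i)).map fun j => (j : ℤ) - i

/-- The primitive idempotent of the Hecke algebra that belongs to the row-reading standard tableau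
of shape `l`, acting on the strands `a, …, a + |l| - 1` of an `n`-strand cable: the projection to
the common eigenspace where, for all `k`, the Jucys-Murphy element of the strand `a + k` has the
eigenvalue `q ^ c`, `c` being the content of the `k`-th cell of the tableau. Since the eigenvalues
of this element are among the `q ^ d`, `-k ≤ d ≤ k`, the projection is a product of Lagrange
basis polynomials in the Jucys-Murphy elements. For `a = 0`, `n = |l|`, and for `u` not a root of
unity, its image in the `n`-fold tensor power of `V` is the irreducible module with
highest weight `l` (and zero if `ℓ(l) > N`). -/
def youngIdempotent {K : Type*} [Field K] (u : K) (N n a : ℕ) (l : YoungDiagram) :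
    TensorEnd K N n :=
  ((contents l).zipIdx.map fun ck =>
    Polynomial.aeval (braidOp u N n (murphyWord a ck.2))
      (Lagrange.basis (Finset.Icc (-(ck.2 : ℤ)) ck.2) (fun d : ℤ => (u ^ 2) ^ d) ck.1)).prod

/-- The `n`-fold tensor power of the diagonal matrix with entries `u ^ (N + 1 - 2 a)`,
`1 ≤ a ≤ N`, which turns the trace into the quantum trace. -/
def pivotal {K : Type*} [Field K] (u : K) (N n : ℕ) : TensorEnd K N n :=
  Matrix.diagonal fun f => ∏ i, u ^ ((N : ℤ) - 1 - 2 * (f i : ℕ))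

/-- The quantum `gl(N)` invariant of the Hopf link (the closure of the square of the generator of
the braid group on two strands, blackboard framing) whose components are colored by the irreducible
representations with highest weights `l` and `m`: the two components are replaced by cables of
`|l|` and `|m|` parallel strands with the idempotents of `l` and `m` inserted, and the quantum
trace of the resulting operator is taken. -/
def hopfInvariant {K : Type*} [Field K] (u : K) (N : ℕ) (l m : YoungDiagram) : K :=
  let n := l.card + m.card
  Matrix.trace
    (youngIdempotent u N n 0 l * youngIdempotent u N n l.card m *
      braidOp u N n (crossWord l.card m.card ++ crossWord m.card l.card) * pivotal u N n)

end HopfGIKV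

end

open scoped Polynomial PowerSeries
noncomputable section
namespace HopfGIKV

/-! ### The generating series of the complete symmetric functions -/

section Complete

variable {K : Type*} [Field K]

/-! Write q = u². The proof combines a summation of the partition series, a twist formula for Schur
polynomials, a positivity argument, and an evaluation of the Hopf link by characters.

Partition series. For t = q the weight of η is a product over hook lengths, and the hook formula
identifies it with s_η(q^ρ) s_η(q^{-ρ}) (`prod_hook_weight_eq`). Expand s_λ s_μ = ∑ c_ν s_ν and use
the symmetry s_ν(q^{η+ρ}) s_η(q^ρ) = s_ν(q^ρ) s_η(q^{ν+ρ}) (`schur_powerSumRho_symm`). The sum over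
η is then a Cauchy sum. Replacing q^ρ by q^{ν+ρ} in it multiplies the result by ∏ (1 - q^c Q), with
c running over the contents of ν (`completeSeries_powerSumRho`). Hence the quotient is the
polynomial F(Q) = ∑ c_ν s_ν(q^ρ) ∏ (1 - q^c Q). Since s_ν(q^ρ) = g_ν s_ν(q^{-ρ}), the principal
specialization gives F(q^N) = ∑ c_ν g_ν s_ν(q^{1/2}, …, q^{N-1/2}) (`exists_Zinst_eq`). Identities
for the infinite alphabet q^ρ are proved for N variables, where they are polynomial in q^{-N}, and
then q^{-N} is set to 0.

Twist formula. Up to normalization, g_ν is a Gaussian weight q^{∑ binom(e_i, 2)} of the exponents of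
the alternant a_{ν+δ}. The functional that weights monomials in this way and evaluates at q^b has an
exchange symmetry in the two exponent vectors involved (`gaussFunctional_altPoly_mul`). It turns the
sum over ν into the product in part 1 (`sum_framing_mul_schurPoly`). Vanishing for small N is the
vanishing of Schur polynomials in too few variables.

Positivity. The branching rule removes one variable at a time and shows that s_l(q^{b_1}, …,
q^{b_N}) has coefficients in ℕ and is divisible by q^{n(l)}, n(l) = ∑ (i-1) l_i. That power cancels
the negative exponents of the framing.

Hopf link. To an operator on V^{⊗n} attach its weight character times the Weyl denominator a_δ. A
closed loop around all strands acts on this alternating polynomial as x^e ↦ u^{1-N} (∑ q^{e_i}) x^e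
(`altCharacter_mul_encircle`). For the proof, the braid in which one strand passes n others is cut
into blocks. The braid relation gives an exchange relation between blocks, cyclicity of the trace
turns it into a triangular linear system for weighted traces, and the solution of the system is a
sum of Macdonald type.

An additional strand multiplies a character by p_1, and under ⟨x^e, Q⟩ = Q(q^e) multiplication by
p_1 is adjoint to that diagonal operator. Topologically, an additional strand in one cable is a loop
around the other. Jucys-Murphy braids are differences of loops, so the Hopf trace of all insertions
built from them is the pairing of their characters (`IsPaired`). The idempotent of l has character
s_l a_δ (`altCharacter_contents`), and pairing two alternants gives s_μ(q^{λ+δ}) s_λ(q^δ) up to the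
normalization. -/

theorem complete_zero (p : ℕ → K) : complete p 0 = 1 := by rw [complete]

theorem complete_succ [CharZero K] (p : ℕ → K) (n : ℕ) :
    ((n : K) + 1) * complete p (n + 1) =
      ∑ ij ∈ Finset.HasAntidiagonal.antidiagonal n, p (ij.1 + 1) * complete p ij.2 := by
  have h : (n : K) + 1 ≠ 0 := by exact_mod_cast Nat.succ_ne_zero n
  rw [complete, mul_div_cancel₀ _ h, Finset.Nat.sum_antidiagonal_eq_sum_range_succ_mk,
    Finset.sum_range]

/-- The generating series of the `complete p n`. -/
def completeSeries (p : ℕ → K) : K⟦X⟧ := PowerSeries.mk (complete p)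

theorem coeff_completeSeries (p : ℕ → K) (n : ℕ) :
    PowerSeries.coeff n (completeSeries p) = complete p n := PowerSeries.coeff_mk _ _

theorem derivative_completeSeries [CharZero K] (p : ℕ → K) :
    PowerSeries.derivative K (completeSeries p) =
      PowerSeries.mk (fun n => p (n + 1)) * completeSeries p := by
  ext n
  rw [PowerSeries.coeff_derivative, PowerSeries.coeff_mul, coeff_completeSeries, mul_comm,
    complete_succ]
  simp [coeff_completeSeries]

/-- In characteristic 0 the equation F' = (∑ p_{n+1} X^n) F with F(0) = 1 determines every
coefficient. This characterization replaces exp(∑ p_n X^n / n), and additivity in p becomes the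
Leibniz rule. -/
theorem eq_completeSeries [CharZero K] (p : ℕ → K) (F : K⟦X⟧)
    (h0 : PowerSeries.coeff 0 F = 1)
    (h : PowerSeries.derivative K F = PowerSeries.mk (fun n => p (n + 1)) * F) :
    F = completeSeries p := by
  have key : ∀ n, PowerSeries.coeff n F = complete p n := by
    intro n
    induction n using Nat.strong_induction_on with
    | _ n ih =>
      cases n with
      | zero => rw [h0, complete_zero]
      | succ n =>
        have hn : (n : K) + 1 ≠ 0 := by exact_mod_cast Nat.succ_ne_zero n
        have := congrArg (PowerSeries.coeff n) h
        rw [PowerSeries.coeff_derivative, PowerSeries.coeff_mul] at this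
        apply mul_left_cancel₀ hn
        rw [mul_comm, this, complete_succ]
        refine Finset.sum_congr rfl fun ij hij => ?_
        rw [PowerSeries.coeff_mk, ih]
        have := Finset.HasAntidiagonal.mem_antidiagonal.1 hij
        omega
  ext n
  rw [key, coeff_completeSeries]

theorem completeSeries_add [CharZero K] (p p' : ℕ → K) :
    completeSeries (p + p') = completeSeries p * completeSeries p' := by
  symm
  apply eq_completeSeries
  · simp [PowerSeries.coeff_mul, coeff_completeSeries, complete_zero]
  · rw [Derivation.leibniz, derivative_completeSeries, derivative_completeSeries]
    have : PowerSeries.mk (fun n => (p + p') (n + 1)) =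
        PowerSeries.mk (fun n => p (n + 1)) + PowerSeries.mk (fun n => p' (n + 1)) := by
      ext n; simp
    rw [this, smul_eq_mul, smul_eq_mul]
    ring

theorem completeSeries_zero [CharZero K] : completeSeries (0 : ℕ → K) = 1 := by
  symm
  apply eq_completeSeries
  · simp
  · have : (PowerSeries.mk fun n => (0 : ℕ → K) (n + 1)) = 0 := by ext n; simp
    rw [this]
    simp

theorem completeSeries_neg_mul [CharZero K] (p : ℕ → K) :
    completeSeries (-p) * completeSeries p = 1 := by
  rw [← completeSeries_add, neg_add_cancel, completeSeries_zero]

theorem completeSeries_sum [CharZero K] {ι : Type*} (s : Finset ι) (p : ι → ℕ → K) :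
    completeSeries (∑ i ∈ s, p i) = ∏ i ∈ s, completeSeries (p i) := by
  classical
  induction s using Finset.induction_on with
  | empty => simp [completeSeries_zero]
  | insert i s hi ih => rw [Finset.sum_insert hi, Finset.prod_insert hi, completeSeries_add, ih]

theorem complete_rescale (p : ℕ → K) (y : K) (n : ℕ) :
    complete (fun k => y ^ k * p k) n = y ^ n * complete p n := by
  induction n using Nat.strong_induction_on with
  | _ n ih =>
    cases n with
    | zero => simp [complete_zero]
    | succ n =>
      rw [complete, complete, ← mul_div_assoc, Finset.mul_sum]
      congr 1
      refine Finset.sum_congr rfl fun k _ => ?_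
      rw [ih _ (by omega)]
      have : y ^ (n + 1) = y ^ ((k : ℕ) + 1) * y ^ (n - (k : ℕ)) := by
        rw [← pow_add]; congr 1; omega
      rw [this]; ring

theorem complete_one [CharZero K] (n : ℕ) : complete (fun _ => (1 : K)) n = 1 := by
  induction n using Nat.strong_induction_on with
  | _ n ih =>
    cases n with
    | zero => exact complete_zero _
    | succ n =>
      have h : (n : K) + 1 ≠ 0 := by exact_mod_cast Nat.succ_ne_zero n
      apply mul_left_cancel₀ h
      rw [complete_succ, Finset.sum_congr rfl (g := fun _ => (1 : K))]
      · simp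
      · intro ij hij
        have := Finset.HasAntidiagonal.mem_antidiagonal.1 hij
        rw [ih _ (by omega), one_mul]

theorem complete_pow [CharZero K] (y : K) (n : ℕ) : complete (fun k => y ^ k) n = y ^ n := by
  have := complete_rescale (fun _ => (1 : K)) y n
  simpa [complete_one] using this

theorem completeSeries_pow_mul [CharZero K] (y : K) :
    completeSeries (fun k => y ^ k) * (1 - PowerSeries.C y * PowerSeries.X) = 1 := by
  ext n
  rw [mul_sub, mul_one, map_sub, mul_comm (PowerSeries.C y), ← mul_assoc]
  cases n with
  | zero => simp [coeff_completeSeries, complete_zero]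
  | succ n =>
    rw [PowerSeries.coeff_mul_C, PowerSeries.coeff_succ_mul_X, coeff_completeSeries,
      coeff_completeSeries, complete_pow, complete_pow, PowerSeries.coeff_one, if_neg (by omega)]
    ring

/-- The power sums of finitely many variables. -/
def psum {N : ℕ} (x : Fin N → K) (n : ℕ) : K := ∑ i, x i ^ n

theorem schurPoly_eq (l : YoungDiagram) {N : ℕ} (x : Fin N → K) :
    schurPoly l x = schur l (psum x) := rfl

theorem completeSeries_psum_mul [CharZero K] {N : ℕ} (x : Fin N → K) :
    completeSeries (psum x) * ∏ i, (1 - PowerSeries.C (x i) * PowerSeries.X) = 1 := by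
  have : psum x = ∑ i, fun k => x i ^ k := by ext n; simp [psum]
  rw [this, completeSeries_sum, ← Finset.prod_mul_distrib]
  exact Finset.prod_eq_one fun i _ => completeSeries_pow_mul _

/-- `complete p` extended by zero to negative indices. -/
def completeInt (p : ℕ → K) (m : ℤ) : K := if 0 ≤ m then complete p m.toNat else 0

theorem completeInt_neg (p : ℕ → K) {m : ℤ} (h : m < 0) : completeInt p m = 0 :=
  if_neg (by omega)

theorem completeInt_natCast (p : ℕ → K) (m : ℕ) : completeInt p m = complete p m := by
  simp [completeInt]

/-- A determinant of Jacobi-Trudi type, with the strictly decreasing exponents `a i` in place of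
the parts `a i + i + 1 - n` of a partition. -/
def jacobiTrudi (n : ℕ) (p : ℕ → K) (a : Fin n → ℕ) : K :=
  (Matrix.of fun i j : Fin n => completeInt p ((a i : ℤ) + j + 1 - n)).det

end Complete

/-- The exponents `l_i + n - 1 - i`, `i < n`. -/
def shifted (n : ℕ) (l : YoungDiagram) (i : Fin n) : ℕ := l.rowLen i + (n - 1 - i)

theorem rowLen_eq_zero {l : YoungDiagram} {i : ℕ} (h : l.colLen 0 ≤ i) : l.rowLen i = 0 := by
  by_contra h0
  have : (i, 0) ∈ l := YoungDiagram.mem_iff_lt_rowLen.2 (Nat.pos_of_ne_zero h0)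
  have := YoungDiagram.mem_iff_lt_colLen.1 this
  omega

theorem colLen_bot (j : ℕ) : (⊥ : YoungDiagram).colLen j = 0 := by
  by_contra h
  have : (0, j) ∈ (⊥ : YoungDiagram) := YoungDiagram.mem_iff_lt_colLen.2 (Nat.pos_of_ne_zero h)
  exact YoungDiagram.notMem_bot _ this

theorem rowLen_bot (j : ℕ) : (⊥ : YoungDiagram).rowLen j = 0 :=
  rowLen_eq_zero (by rw [colLen_bot]; exact Nat.zero_le _)

/-! ### Jacobi-Trudi determinants of arbitrary size. -/

section JacobiTrudi

variable {K : Type*} [Field K]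

theorem schur_eq_jacobiTrudi_self (l : YoungDiagram) (p : ℕ → K) :
    schur l p = jacobiTrudi (l.colLen 0) p (shifted (l.colLen 0) l) := by
  unfold schur jacobiTrudi
  congr 1
  ext i j
  simp only [Matrix.of_apply, completeInt, shifted]
  have hi := i.2
  have e : (((l.rowLen i + (l.colLen 0 - 1 - i) : ℕ) : ℤ) + j + 1 - (l.colLen 0 : ℕ)) =
      (l.rowLen i : ℤ) + j - i := by
    push_cast [Nat.cast_sub (show (i : ℕ) ≤ l.colLen 0 - 1 by omega),
      Nat.cast_sub (show 1 ≤ l.colLen 0 by omega)]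
    ring
  simp only [e]
  by_cases h : (i : ℕ) ≤ l.rowLen i + j
  · rw [if_pos h, if_pos (by omega)]
    congr 1
    omega
  · rw [if_neg h, if_neg (by omega)]

/-- The part with index n is 0, so the last row of the larger matrix is (0, …, 0, 1). Diagrams with
different numbers of rows can thus be treated with one common size. -/
theorem jacobiTrudi_succ (l : YoungDiagram) (p : ℕ → K) {n : ℕ} (h : l.colLen 0 ≤ n) :
    jacobiTrudi (n + 1) p (shifted (n + 1) l) = jacobiTrudi n p (shifted n l) := by
  unfold jacobiTrudi
  rw [Matrix.det_succ_row _ (Fin.last n), Finset.sum_eq_single (Fin.last n)]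
  · have h1 : ((-1 : K) ^ (((Fin.last n : Fin (n + 1)) : ℕ) + ((Fin.last n : Fin (n + 1)) : ℕ))) = 1 := by
      rw [← two_mul, pow_mul]; simp
    rw [h1, one_mul]
    have h2 : completeInt p ((shifted (n + 1) l (Fin.last n) : ℤ) + (Fin.last n : Fin (n + 1)) + 1
        - ((n + 1 : ℕ) : ℤ)) = 1 := by
      have : ((shifted (n + 1) l (Fin.last n) : ℤ) + ((Fin.last n : Fin (n + 1)) : ℕ) + 1
        - ((n + 1 : ℕ) : ℤ)) = ((0 : ℕ) : ℤ) := by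
        simp [shifted, rowLen_eq_zero h]
      rw [this, completeInt_natCast, complete_zero]
    rw [Matrix.of_apply, h2, one_mul]
    congr 1
    ext i j
    simp only [Matrix.submatrix_apply, Matrix.of_apply, Fin.succAbove_last]
    congr 1
    have := i.2
    simp only [shifted, Fin.val_castSucc]
    omega
  · intro j _ hj
    have : (j : ℕ) < n := by
      have := j.2
      have : (j : ℕ) ≠ n := fun h => hj (Fin.ext h)
      omega
    rw [Matrix.of_apply, completeInt_neg]
    · simp
    · simp [shifted, rowLen_eq_zero h]
      omega
  · simp

theorem schur_eq_jacobiTrudi (l : YoungDiagram) (p : ℕ → K) {n : ℕ} (h : l.colLen 0 ≤ n) :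
    schur l p = jacobiTrudi n p (shifted n l) := by
  induction n, h using Nat.le_induction with
  | base => exact schur_eq_jacobiTrudi_self l p
  | succ n h ih => rw [jacobiTrudi_succ l p h, ih]

theorem schur_bot (p : ℕ → K) : schur ⊥ p = 1 := by
  rw [schur_eq_jacobiTrudi ⊥ p (n := 0) (by rw [colLen_bot])]
  simp [jacobiTrudi]

theorem jacobiTrudi_bot (p : ℕ → K) (n : ℕ) : jacobiTrudi n p (shifted n ⊥) = 1 := by
  rw [← schur_eq_jacobiTrudi _ _ (by rw [colLen_bot]; omega), schur_bot]

end JacobiTrudi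

/-! ### The bialternant formula -/

/-- The alternant `det (x_i ^ a_j)`. -/
def alternant {R : Type*} [CommRing R] {N : ℕ} (x : Fin N → R) (a : Fin N → ℕ) : R :=
  (Matrix.of fun i j => x i ^ a j).det

section Bialternant

variable {K : Type*} [Field K] {N : ℕ}

theorem coeff_prod_one_sub_eq_zero {ι : Type*} (s : Finset ι) (x : ι → K) {m : ℕ}
    (hm : s.card < m) :
    PowerSeries.coeff m (∏ i ∈ s, (1 - PowerSeries.C (x i) * PowerSeries.X) : K⟦X⟧) = 0 := by
  have h : (∏ i ∈ s, (1 - PowerSeries.C (x i) * PowerSeries.X) : K⟦X⟧) =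
      ((∏ i ∈ s, (1 - Polynomial.C (x i) * Polynomial.X) : K[X]) : K⟦X⟧) := by
    rw [← Polynomial.coeToPowerSeries.ringHom_apply, map_prod]
    simp
  rw [h, Polynomial.coeff_coe]
  apply Polynomial.coeff_eq_zero_of_natDegree_lt
  calc _ ≤ ∑ i ∈ s, (1 - Polynomial.C (x i) * Polynomial.X : K[X]).natDegree :=
        Polynomial.natDegree_prod_le _ _
    _ ≤ ∑ i ∈ s, 1 := by
        refine Finset.sum_le_sum fun i _ => ?_
        refine (Polynomial.natDegree_sub_le _ _).trans ?_
        refine max_le (by simp) ?_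
        exact (Polynomial.natDegree_C_mul_le _ _).trans Polynomial.natDegree_X_le
    _ < m := by simpa using hm

/-- A Jacobi-Trudi row times the reversed coefficients of a polynomial of degree less than n is one
coefficient of a product of series; `he` cuts the convolution down to n terms. -/
theorem sum_completeInt_mul (p e : ℕ → K) (n b : ℕ) (he : ∀ m, n ≤ m → e m = 0) :
    ∑ j : Fin n, completeInt p ((b : ℤ) + j + 1 - n) * e (n - 1 - j) =
      ∑ ij ∈ Finset.HasAntidiagonal.antidiagonal b, e ij.1 * complete p ij.2 := by
  rw [Finset.Nat.sum_antidiagonal_eq_sum_range_succ_mk,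
    ← Equiv.sum_comp Fin.revPerm, Finset.sum_fin_eq_sum_range]
  have e3 : ∀ j ∈ Finset.range n, (if h : j < n then
      completeInt p ((b : ℤ) + ((Fin.revPerm (⟨j, h⟩ : Fin n) : Fin n) : ℕ) + 1 - n) *
        e (n - 1 - ((Fin.revPerm (⟨j, h⟩ : Fin n) : Fin n) : ℕ)) else 0) =
      if j ≤ b then e j * complete p (b - j) else 0 := by
    intro j hj
    have hj' := Finset.mem_range.1 hj
    rw [dif_pos hj']
    simp only [Fin.revPerm_apply, Fin.val_rev]
    have e1 : n - 1 - (n - (j + 1)) = j := by omega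
    rw [e1]
    split_ifs with h
    · have : ((b : ℤ) + ((n - (j + 1) : ℕ) : ℤ) + 1 - n) = ((b - j : ℕ) : ℤ) := by omega
      rw [this, completeInt_natCast, mul_comm]
    · rw [completeInt_neg _ (by omega), zero_mul]
  rw [Finset.sum_congr rfl e3, ← Finset.sum_filter]
  apply Finset.sum_subset_zero_on_sdiff
  · intro j hj
    simp at hj ⊢
    omega
  · intro j hj
    simp only [Finset.mem_sdiff, Finset.mem_range, Finset.mem_filter, not_and, not_le] at hj
    change e j * _ = 0
    rw [he j (by by_contra h; have := hj.2 (by omega); omega), zero_mul]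
  · intros; rfl

variable [CharZero K]

/-- Compare coefficients in H(X) ∏_{i ≠ k} (1 - x_i X) = 1 / (1 - x_k X). -/
theorem pow_eq_sum_completeInt (x : Fin N → K) (k : Fin N) (a : ℕ) :
    x k ^ a = ∑ j : Fin N, completeInt (psum x) ((a : ℤ) + j + 1 - N) *
      PowerSeries.coeff (N - 1 - j) (∏ i ∈ Finset.univ.erase k,
        (1 - PowerSeries.C (x i) * PowerSeries.X) : K⟦X⟧) := by
  set Q : K⟦X⟧ := ∏ i ∈ Finset.univ.erase k, (1 - PowerSeries.C (x i) * PowerSeries.X) with hQ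
  have hN : 0 < N := k.pos
  have h1 : completeSeries (psum x) * Q = completeSeries (fun n => x k ^ n) := by
    have h := completeSeries_psum_mul x
    rw [← Finset.mul_prod_erase _ _ (Finset.mem_univ k), ← hQ] at h
    have h2 := completeSeries_pow_mul (x k)
    calc completeSeries (psum x) * Q
        = completeSeries (psum x) * Q * (completeSeries (fun n => x k ^ n) *
            (1 - PowerSeries.C (x k) * PowerSeries.X)) := by rw [h2, mul_one]
      _ = (completeSeries (psum x) * ((1 - PowerSeries.C (x k) * PowerSeries.X) * Q)) *
            completeSeries (fun n => x k ^ n) := by ring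
      _ = _ := by rw [h, one_mul]
  have h2 := congrArg (PowerSeries.coeff a) h1
  rw [coeff_completeSeries, complete_pow, mul_comm, PowerSeries.coeff_mul] at h2
  rw [← h2, sum_completeInt_mul (psum x) (fun m => PowerSeries.coeff m Q)]
  · simp only [coeff_completeSeries]
  · intro m hm
    apply coeff_prod_one_sub_eq_zero
    simp
    omega

/-- The matrix of powers factors as the Jacobi-Trudi matrix times a matrix that does not depend on
the exponents. The staircase exponents, with Jacobi-Trudi determinant 1, identify the determinant of
the second factor. -/
theorem alternant_eq_jacobiTrudi_mul (x : Fin N → K) (a : Fin N → ℕ) :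
    alternant x a = jacobiTrudi N (psum x) a * alternant x (shifted N ⊥) := by
  let c : Fin N → ℕ → K := fun k m => PowerSeries.coeff m
      (∏ i ∈ Finset.univ.erase k, (1 - PowerSeries.C (x i) * PowerSeries.X) : K⟦X⟧)
  let M : Matrix (Fin N) (Fin N) K := Matrix.of fun j k => c k (N - 1 - j)
  have key : ∀ a : Fin N → ℕ, alternant x a = jacobiTrudi N (psum x) a * M.det := by
    intro a
    unfold alternant jacobiTrudi
    rw [← Matrix.det_mul, ← Matrix.det_transpose]
    congr 1
    ext i k
    rw [Matrix.mul_apply]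
    exact pow_eq_sum_completeInt x k (a i)
  rw [key a, key (shifted N ⊥), jacobiTrudi_bot, one_mul]

theorem schurPoly_mul_alternant (l : YoungDiagram) (h : l.colLen 0 ≤ N) (x : Fin N → K) :
    schurPoly l x * alternant x (shifted N ⊥) = alternant x (shifted N l) := by
  rw [alternant_eq_jacobiTrudi_mul x (shifted N l), schurPoly_eq, schur_eq_jacobiTrudi l _ h]

theorem schurPoly_eq_zero (l : YoungDiagram) (h : N < l.colLen 0) (x : Fin N → K) :
    schurPoly l x = 0 := by
  rw [schurPoly_eq, schur_eq_jacobiTrudi_self]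
  unfold jacobiTrudi
  set n := l.colLen 0 with hn
  let E : K⟦X⟧ := ∏ i, (1 - PowerSeries.C (x i) * PowerSeries.X)
  have hE : completeSeries (psum x) * E = 1 := completeSeries_psum_mul x
  apply Matrix.exists_mulVec_eq_zero_iff.1
  -- The reversed coefficients of `E`, of degree at most N < n, form a kernel vector: row i computes
  -- a coefficient of positive degree of H · E = 1. The last entry is E(0) = 1, so the vector is
  -- non-zero.
  refine ⟨fun j => PowerSeries.coeff (n - 1 - j) E, ?_, ?_⟩
  · intro h0
    have := congrFun h0 ⟨n - 1, by omega⟩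
    simp [E, PowerSeries.coeff_zero_eq_constantCoeff, map_prod] at this
  · ext i
    simp only [Matrix.mulVec, dotProduct, Matrix.of_apply, Pi.zero_apply]
    have hi := i.2
    have hrow : 0 < l.rowLen i := by
      rw [← YoungDiagram.mem_iff_lt_rowLen, YoungDiagram.mem_iff_lt_colLen]
      exact hi
    have h2 := congrArg (PowerSeries.coeff (shifted n l i)) hE
    rw [PowerSeries.coeff_one, if_neg (by rw [shifted]; omega), mul_comm,
      PowerSeries.coeff_mul] at h2
    rw [← h2, sum_completeInt_mul (psum x) (fun m => PowerSeries.coeff m E)]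
    · simp only [coeff_completeSeries]
    · intro m hm
      apply coeff_prod_one_sub_eq_zero
      simp
      omega

end Bialternant

/-! ### Polynomiality and homogeneity -/

section Polynomiality

variable {K : Type*} [Field K] {A : Type*} [CommRing A] [Algebra K A]

/-- One universal element of A specializes correctly under all algebra maps to K. With A = K[X] this
expresses the dependence on q^{-N} as a polynomial; with A = `MvPolynomial` it lifts Schur
polynomials from functions to polynomials. -/
theorem exists_complete_eq (P : ℕ → A) (n : ℕ) :
    ∃ a : A, ∀ f : A →ₐ[K] K, f a = complete (fun k => f (P k)) n := by
  induction n using Nat.strong_induction_on with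
  | _ n ih =>
    cases n with
    | zero => exact ⟨1, fun f => by rw [complete_zero, map_one]⟩
    | succ n =>
      choose! a ha using ih
      refine ⟨((n : K) + 1)⁻¹ • ∑ k : Fin (n + 1), P (k + 1) * a (n - k), fun f => ?_⟩
      rw [complete, map_smul, map_sum, smul_eq_mul, div_eq_inv_mul]
      congr 1
      refine Finset.sum_congr rfl fun k _ => ?_
      rw [map_mul, ha _ (by omega)]

theorem exists_schur_eq (P : ℕ → A) (l : YoungDiagram) :
    ∃ a : A, ∀ f : A →ₐ[K] K, f a = schur l (fun k => f (P k)) := by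
  choose a ha using fun n => exists_complete_eq (K := K) P n
  refine ⟨(Matrix.of fun i j : Fin (l.colLen 0) =>
    if (i : ℕ) ≤ l.rowLen i + j then a (l.rowLen i + j - i) else 0).det, fun f => ?_⟩
  rw [schur, AlgHom.map_det]
  congr 1
  ext i j
  simp only [AlgHom.mapMatrix_apply, Matrix.map_apply, Matrix.of_apply]
  split_ifs
  · exact ha _ f
  · exact map_zero f

theorem completeInt_rescale (p : ℕ → K) (y : K) (m : ℤ) :
    completeInt (fun k => y ^ k * p k) m = y ^ m * completeInt p m := by
  unfold completeInt
  split_ifs with h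
  · rw [complete_rescale, ← zpow_natCast, Int.toNat_of_nonneg h]
  · simp

end Polynomiality

/-! ### Sums and products over the cells of a diagram -/

section Cells

variable {M : Type*} [CommMonoid M]

theorem prod_cells (l : YoungDiagram) {n : ℕ} (h : l.colLen 0 ≤ n) (f : ℕ × ℕ → M) :
    ∏ c ∈ l.cells, f c = ∏ i ∈ Finset.range n, ∏ j ∈ Finset.range (l.rowLen i), f (i, j) := by
  apply Finset.prod_finset_product
  intro c
  rw [YoungDiagram.mem_cells, show c = (c.1, c.2) from rfl, YoungDiagram.mem_iff_lt_rowLen,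
    Finset.mem_range, Finset.mem_range]
  refine ⟨fun hc => ⟨?_, hc⟩, fun hc => hc.2⟩
  by_contra h2
  have := rowLen_eq_zero (l := l) (i := c.1) (by omega)
  omega

theorem prod_cells_fin (l : YoungDiagram) {n : ℕ} (h : l.colLen 0 ≤ n) (f : ℕ × ℕ → M) :
    ∏ c ∈ l.cells, f c = ∏ i : Fin n, ∏ j ∈ Finset.range (l.rowLen i), f (i, j) := by
  rw [prod_cells l h, Finset.prod_range]

theorem sum_cells {M : Type*} [AddCommMonoid M] (l : YoungDiagram) {n : ℕ} (h : l.colLen 0 ≤ n)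
    (f : ℕ × ℕ → M) :
    ∑ c ∈ l.cells, f c = ∑ i ∈ Finset.range n, ∑ j ∈ Finset.range (l.rowLen i), f (i, j) :=
  prod_cells (M := Multiplicative M) l h f

theorem card_eq_sum_rowLen (l : YoungDiagram) {n : ℕ} (h : l.colLen 0 ≤ n) :
    l.card = ∑ i ∈ Finset.range n, l.rowLen i := by
  rw [YoungDiagram.card, Finset.card_eq_sum_ones, sum_cells l h]
  simp

theorem card_eq_sum_rowLen_fin (l : YoungDiagram) {n : ℕ} (h : l.colLen 0 ≤ n) :
    l.card = ∑ i : Fin n, l.rowLen i := by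
  rw [card_eq_sum_rowLen l h, Finset.sum_range]

end Cells

/-! ### Homogeneity of Schur functions. -/

section Homogeneity

variable {K : Type*} [Field K]

theorem schur_rescale (l : YoungDiagram) (p : ℕ → K) {y : K} (hy : y ≠ 0) :
    schur l (fun k => y ^ k * p k) = y ^ l.card * schur l p := by
  rw [schur_eq_jacobiTrudi_self, schur_eq_jacobiTrudi_self, jacobiTrudi, jacobiTrudi]
  set n := l.colLen 0 with hn
  -- The exponent of y in entry (i, j) splits into a part for the row and a part for the column.
  -- Summed over the rows and columns these exponents give |l|.
  have h1 : (Matrix.of fun i j : Fin n => completeInt (fun k => y ^ k * p k)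
      ((shifted n l i : ℤ) + j + 1 - n)) = Matrix.of fun i j : Fin n =>
        (fun i : Fin n => y ^ ((shifted n l i : ℤ) + 1 - n)) i *
          (Matrix.of fun i j : Fin n => (fun j : Fin n => y ^ (j : ℤ)) j *
          (Matrix.of fun i j : Fin n => completeInt p ((shifted n l i : ℤ) + j + 1 - n)) i j) i j := by
    ext i j
    simp only [Matrix.of_apply]
    rw [completeInt_rescale p y, ← mul_assoc, ← zpow_add₀ hy]
    congr 2
    ring
  rw [h1, Matrix.det_mul_column, Matrix.det_mul_row, ← mul_assoc]
  congr 1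
  rw [← Finset.prod_mul_distrib, card_eq_sum_rowLen_fin l le_rfl, ← hn,
    ← Finset.prod_pow_eq_pow_sum]
  refine Finset.prod_congr rfl fun i _ => ?_
  have := i.2
  rw [← zpow_add₀ hy, ← zpow_natCast]
  congr 1
  simp only [shifted]
  omega

theorem schurPoly_smul (l : YoungDiagram) {N : ℕ} (x : Fin N → K) {y : K} (hy : y ≠ 0) :
    schurPoly l (fun i => y * x i) = y ^ l.card * schurPoly l x := by
  rw [schurPoly_eq, schurPoly_eq, ← schur_rescale l _ hy]
  congr 1
  ext k
  simp [psum, mul_pow, Finset.mul_sum]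

end Homogeneity

/-! ### Diagrams and strictly decreasing exponents -/

/-- The diagram with rows `f 0 ≥ f 1 ≥ ⋯ ≥ f (N - 1)`. -/
def ofAntitone {N : ℕ} (f : Fin N → ℕ) (hf : Antitone f) : YoungDiagram where
  cells := (Finset.univ : Finset (Fin N)).biUnion fun i => (Finset.range (f i)).image fun j => ((i : ℕ), j)
  isLowerSet := by
    intro a b hab ha
    simp only [Finset.coe_biUnion, Finset.coe_univ, Set.mem_univ, Set.iUnion_true, Set.mem_iUnion,
      Finset.coe_image, Finset.coe_range, Set.mem_image, Set.mem_Iio] at ha ⊢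
    obtain ⟨i, j, hj, rfl⟩ := ha
    have h1 : b.1 ≤ i := hab.1
    have h2 : b.2 ≤ j := hab.2
    refine ⟨⟨b.1, by omega⟩, b.2, ?_, rfl⟩
    have : f i ≤ f ⟨b.1, by omega⟩ := hf h1
    omega

theorem mem_ofAntitone {N : ℕ} (f : Fin N → ℕ) (hf : Antitone f) (i j : ℕ) :
    (i, j) ∈ ofAntitone f hf ↔ ∃ h : i < N, j < f ⟨i, h⟩ := by
  change (i, j) ∈ (ofAntitone f hf).cells ↔ _
  simp only [ofAntitone, Finset.mem_biUnion, Finset.mem_univ, true_and, Finset.mem_image,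
    Finset.mem_range, Prod.mk.injEq]
  constructor
  · rintro ⟨k, m, hm, rfl, rfl⟩
    exact ⟨k.2, hm⟩
  · rintro ⟨h, hj⟩
    exact ⟨⟨i, h⟩, j, hj, rfl, rfl⟩

theorem rowLen_ofAntitone {N : ℕ} (f : Fin N → ℕ) (hf : Antitone f) (i : Fin N) :
    (ofAntitone f hf).rowLen i = f i := by
  have h : ∀ j, j < (ofAntitone f hf).rowLen i ↔ j < f i := fun j => by
    rw [← YoungDiagram.mem_iff_lt_rowLen, mem_ofAntitone]
    simp
  have h1 := h (f i)
  have h2 := h ((ofAntitone f hf).rowLen i)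
  omega

theorem colLen_ofAntitone_le {N : ℕ} (f : Fin N → ℕ) (hf : Antitone f) :
    (ofAntitone f hf).colLen 0 ≤ N := by
  by_contra h
  have : (N, 0) ∈ ofAntitone f hf := YoungDiagram.mem_iff_lt_colLen.2 (by omega)
  rw [mem_ofAntitone] at this
  exact absurd this.1 (lt_irrefl _)

theorem ext_rowLen {l m : YoungDiagram} (h : ∀ i, l.rowLen i = m.rowLen i) : l = m := by
  ext ⟨i, j⟩
  rw [YoungDiagram.mem_cells, YoungDiagram.mem_cells, YoungDiagram.mem_iff_lt_rowLen,
    YoungDiagram.mem_iff_lt_rowLen, h]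

theorem ext_rowLen_fin {l m : YoungDiagram} {N : ℕ} (hl : l.colLen 0 ≤ N) (hm : m.colLen 0 ≤ N)
    (h : ∀ i : Fin N, l.rowLen i = m.rowLen i) : l = m := by
  apply ext_rowLen
  intro i
  by_cases hi : i < N
  · exact h ⟨i, hi⟩
  · rw [rowLen_eq_zero (by omega), rowLen_eq_zero (by omega)]

theorem shifted_strictAnti (N : ℕ) (l : YoungDiagram) : StrictAnti (shifted N l) := by
  intro i j hij
  have := l.rowLen_anti i j (le_of_lt hij)
  have h1 : (i : ℕ) < j := hij
  have := j.2
  simp only [shifted]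
  omega

/-- Strictly decreasing natural numbers satisfy a_i ≥ N - 1 - i, so subtracting the staircase leaves
a partition. -/
theorem exists_shifted_eq {N : ℕ} {a : Fin N → ℕ} (ha : StrictAnti a) :
    ∃ l : YoungDiagram, l.colLen 0 ≤ N ∧ shifted N l = a := by
  have hge : ∀ k : ℕ, ∀ i : Fin N, (i : ℕ) + k + 1 = N → k ≤ a i := by
    intro k
    induction k with
    | zero => intros; omega
    | succ k ih =>
      intro i hi
      have h1 := ih ⟨i + 1, by omega⟩ (by simp; omega)
      have h2 : a ⟨i + 1, by omega⟩ < a i := ha (by rw [Fin.lt_def]; simp)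
      omega
  have hge' : ∀ i : Fin N, N - 1 - i ≤ a i := fun i => hge _ i (by have := i.2; omega)
  have hf : Antitone fun i : Fin N => a i - (N - 1 - i) := by
    have hstep : ∀ d : ℕ, ∀ i j : Fin N, (i : ℕ) + d = j → a j + d ≤ a i := by
      intro d
      induction d with
      | zero => intro i j h; have : i = j := Fin.ext (by omega); subst this; omega
      | succ d ih =>
        intro i j h
        have h1 := ih ⟨i + 1, by have := j.2; omega⟩ j (by simp; omega)
        have h2 : a ⟨i + 1, by have := j.2; omega⟩ < a i := ha (by rw [Fin.lt_def]; simp)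
        omega
    intro i j hij
    have h1 : (i : ℕ) ≤ j := hij
    have := hstep (j - i) i j (by omega)
    have := hge' i
    have := hge' j
    have := j.2
    simp only
    omega
  refine ⟨ofAntitone _ hf, colLen_ofAntitone_le _ hf, ?_⟩
  ext i
  rw [shifted, rowLen_ofAntitone]
  have := hge' i
  omega

theorem sum_shifted {N : ℕ} {l : YoungDiagram} (h : l.colLen 0 ≤ N) :
    ∑ i, shifted N l i = l.card + ∑ i, shifted N ⊥ i := by
  rw [card_eq_sum_rowLen_fin l h, ← Finset.sum_add_distrib]
  simp [shifted, rowLen_bot]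

theorem mem_partitionsOf {n : ℕ} {l : YoungDiagram} : l ∈ partitionsOf n ↔ l.card = n := by
  simp [partitionsOf]

/-! ### The Cauchy identity -/

theorem complete_congr {K : Type*} [Field K] {p p' : ℕ → K} (h : ∀ n, p (n + 1) = p' (n + 1)) :
    complete p = complete p' := by
  funext n
  induction n using Nat.strong_induction_on with
  | _ n ih =>
    cases n with
    | zero => rw [complete_zero, complete_zero]
    | succ n =>
      rw [complete, complete]
      congr 1
      exact Finset.sum_congr rfl fun k _ => by rw [h, ih _ (by omega)]

theorem schur_congr {K : Type*} [Field K] {p p' : ℕ → K} (h : ∀ n, p (n + 1) = p' (n + 1))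
    (l : YoungDiagram) : schur l p = schur l p' := by
  unfold schur
  rw [complete_congr h]

theorem shifted_bot {N : ℕ} (i : Fin N) : shifted N ⊥ i = N - 1 - i := by
  simp [shifted, rowLen_bot]

theorem eq_of_strictAnti_comp_perm {N : ℕ} {a b : Fin N → ℕ} (ha : StrictAnti a) (hb : StrictAnti b)
    (s : Equiv.Perm (Fin N)) (h : a = b ∘ s) : a = b ∧ s = 1 := by
  have hr : Set.range a = Set.range b := by
    rw [h, Set.range_comp, Equiv.range_eq_univ, Set.image_univ]
  have h1 : a ∘ Fin.rev = b ∘ Fin.rev := by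
    rw [← StrictMono.range_inj (ha.comp Fin.rev_strictAnti) (hb.comp Fin.rev_strictAnti)]
    · rw [Set.range_comp, Set.range_comp, Fin.rev_surjective.range_eq, Set.image_univ,
        Set.image_univ, hr]
  have h2 : a = b := by
    funext i
    have := congrFun h1 (Fin.rev i)
    simpa using this
  refine ⟨h2, ?_⟩
  ext i
  have := congrFun h i
  rw [h2] at this
  have := hb.injective this
  simp [← this]

theorem exists_perm_strictAnti {N : ℕ} {a : Fin N → ℕ} (ha : Function.Injective a) :
    ∃ s : Equiv.Perm (Fin N), StrictAnti (a ∘ s) := by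
  refine ⟨Fin.revPerm.trans (Tuple.sort a), ?_⟩
  have h1 : StrictMono (a ∘ Tuple.sort a) :=
    (Tuple.monotone_sort a).strictMono_of_injective (ha.comp (Equiv.injective _))
  exact h1.comp_strictAnti Fin.rev_strictAnti

/-- The sum of a function of injective exponent vectors is a sum over partitions and
permutations. -/
theorem sum_injective_eq {M : Type*} [AddCommMonoid M] {N n : ℕ} (G : (Fin N → ℕ) → M)
    (hG : ∀ a, ¬ Function.Injective a → G a = 0) :
    ∑ a ∈ Finset.piAntidiag Finset.univ (n + ∑ i, shifted N ⊥ i), G a =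
      ∑ l ∈ partitionsOf n with l.colLen 0 ≤ N, ∑ s : Equiv.Perm (Fin N), G (shifted N l ∘ s) := by
  classical
  rw [← Finset.sum_product']
  symm
  apply Finset.sum_of_injOn (fun ls : YoungDiagram × Equiv.Perm (Fin N) => shifted N ls.1 ∘ ls.2)
  · rintro ⟨l, s⟩ h ⟨l', s'⟩ h' e
    simp only [Finset.coe_product, Set.mem_prod, Finset.mem_coe, Finset.mem_filter] at h h'
    simp only at e
    have e2 : shifted N l = shifted N l' ∘ (s' * s⁻¹ : Equiv.Perm (Fin N)) := by
      funext i
      have := congrFun e (s⁻¹ i)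
      simpa using this
    obtain ⟨h1, h2⟩ := eq_of_strictAnti_comp_perm (shifted_strictAnti N l) (shifted_strictAnti N l') _ e2
    have h3 : l = l' := by
      apply ext_rowLen_fin h.1.2 h'.1.2
      intro i
      have := congrFun h1 i
      simpa [shifted] using this
    have h4 : s = s' := by rw [mul_inv_eq_one] at h2; exact h2.symm
    rw [h3, h4]
  · rintro ⟨l, s⟩ h
    simp only [Finset.coe_product, Set.mem_prod, Finset.mem_coe, Finset.mem_filter,
      mem_partitionsOf] at h
    simp only [Finset.mem_coe, Finset.mem_piAntidiag, Finset.mem_univ, implies_true, and_true,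
      Function.comp_apply]
    rw [Equiv.sum_comp s (shifted N l), sum_shifted h.1.2, h.1.1]
  · intro a ha hna
    apply hG
    intro hinj
    apply hna
    obtain ⟨s, hs⟩ := exists_perm_strictAnti hinj
    obtain ⟨l, hl, he⟩ := exists_shifted_eq hs
    refine ⟨(l, s⁻¹), ?_, ?_⟩
    · simp only [Finset.coe_product, Set.mem_prod, Finset.mem_coe, Finset.mem_filter,
        mem_partitionsOf, Finset.mem_univ, and_true]
      refine ⟨?_, hl⟩
      have h1 := sum_shifted hl
      rw [he] at h1
      simp only [Function.comp_apply] at h1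
      rw [Equiv.sum_comp s a, (Finset.mem_piAntidiag.1 ha).1] at h1
      omega
    · funext i
      simp [he]
  · intros; rfl

section Cauchy

variable {K : Type*} [Field K] {N : ℕ}

theorem jacobiTrudi_comp_perm (p : ℕ → K) (a : Fin N → ℕ) (s : Equiv.Perm (Fin N)) :
    jacobiTrudi N p (a ∘ s) = (Equiv.Perm.sign s : ℤ) * jacobiTrudi N p a := by
  unfold jacobiTrudi
  rw [← Matrix.det_permute]
  rfl

theorem jacobiTrudi_eq_zero (p : ℕ → K) (a : Fin N → ℕ) (h : ¬ Function.Injective a) :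
    jacobiTrudi N p a = 0 := by
  simp only [Function.Injective, not_forall] at h
  obtain ⟨i, j, hij, hne⟩ := h
  apply Matrix.det_zero_of_row_eq hne
  ext k
  simp [hij]

theorem alternant_eq_sum {R : Type*} [CommRing R] (x : Fin N → R) (a : Fin N → ℕ) :
    alternant x a = ∑ s : Equiv.Perm (Fin N), (Equiv.Perm.sign s : ℤ) * ∏ i, x i ^ a (s i) := by
  rw [alternant, ← Matrix.det_transpose, Matrix.det_apply']
  rfl

theorem jacobiTrudi_eq_sum (p : ℕ → K) (a : Fin N → ℕ) :
    jacobiTrudi N p a = ∑ s : Equiv.Perm (Fin N), (Equiv.Perm.sign s : ℤ) *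
      ∏ i, completeInt p ((a i : ℤ) - shifted N ⊥ (s i)) := by
  rw [jacobiTrudi, ← Matrix.det_transpose, Matrix.det_apply']
  refine Finset.sum_congr rfl fun s _ => ?_
  congr 1
  refine Finset.prod_congr rfl fun i _ => ?_
  have := (s i).2
  rw [Matrix.transpose_apply, Matrix.of_apply, shifted_bot]
  congr 1
  omega

variable [CharZero K]

theorem completeSeries_mul_psum (p : ℕ → K) (y : Fin N → K) :
    completeSeries (fun k => p k * psum y k) =
      ∏ i, PowerSeries.mk fun n => y i ^ n * complete p n := by
  have : (fun k => p k * psum y k) = ∑ i, fun k => y i ^ k * p k := by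
    ext k
    simp [psum, Finset.mul_sum, mul_comm]
  rw [this, completeSeries_sum]
  refine Finset.prod_congr rfl fun i _ => ?_
  ext n
  rw [coeff_completeSeries, complete_rescale, PowerSeries.coeff_mk]

/-- The contribution of one permutation in the Cauchy identity: both sides are a coefficient of ∏
y_i^{d_i} X^{d_i} ∑_m y_i^m h_m X^m, whose last factors multiply to the series with power sums p_k
p_k(y). -/
theorem sum_piAntidiag_completeInt (p : ℕ → K) (y : Fin N → K) (d : Fin N → ℕ) (n : ℕ) :
    ∑ a ∈ Finset.piAntidiag Finset.univ (n + ∑ i, d i),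
      ∏ i, (completeInt p ((a i : ℤ) - d i) * y i ^ a i) =
    complete (fun k => p k * psum y k) n * ∏ i, y i ^ d i := by
  have h1 : ∀ i, (PowerSeries.mk fun a : ℕ => completeInt p ((a : ℤ) - d i) * y i ^ a) =
      PowerSeries.C (y i ^ d i) * PowerSeries.X ^ d i *
        PowerSeries.mk fun n => y i ^ n * complete p n := by
    intro i
    ext a
    rw [PowerSeries.coeff_mk, mul_assoc, PowerSeries.coeff_C_mul, PowerSeries.coeff_X_pow_mul']
    split_ifs with h
    · rw [PowerSeries.coeff_mk]
      have : (a : ℤ) - d i = ((a - d i : ℕ) : ℤ) := by omega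
      rw [this, completeInt_natCast, ← mul_assoc, ← pow_add, mul_comm]
      congr 2
      omega
    · rw [completeInt_neg _ (by omega)]
      simp
  have h2 := congrArg (PowerSeries.coeff (n + ∑ i, d i)) (Finset.prod_congr rfl fun i (_ : i ∈ Finset.univ) => h1 i)
  rw [Finset.prod_mul_distrib, Finset.prod_mul_distrib, ← completeSeries_mul_psum,
    Finset.prod_pow_eq_pow_sum, ← map_prod, mul_assoc, PowerSeries.coeff_C_mul,
    PowerSeries.coeff_X_pow_mul', if_pos (by omega), Nat.add_sub_cancel, coeff_completeSeries,
    PowerSeries.coeff_prod] at h2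
  rw [mul_comm, ← h2]
  symm
  apply Finset.sum_bij' (fun (a : Fin N →₀ ℕ) _ => (a : Fin N → ℕ))
    (fun a _ => Finsupp.equivFunOnFinite.symm a)
  · intro a ha
    rw [Finset.mem_finsuppAntidiag] at ha
    simp [Finset.mem_piAntidiag, ← ha.1]
  · intro a ha
    rw [Finset.mem_piAntidiag] at ha
    simp [Finset.mem_finsuppAntidiag, ← ha.1]
  · intro a _
    ext
    simp
  · intro a _
    rfl
  · intro a _
    simp only [PowerSeries.coeff_mk]

/-- After multiplication by the Vandermonde determinant of y, the left side becomes the sum of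
jacobiTrudi(a) y^a over all exponent vectors a of the given total, as vectors with repetitions
contribute 0. Expanding the determinant and summing over a first gives the right side. The power
sums p stay arbitrary. -/
theorem cauchy_identity (p : ℕ → K) (y : Fin N → K) (hy : alternant y (shifted N ⊥) ≠ 0) (n : ℕ) :
    ∑ l ∈ partitionsOf n, schur l p * schurPoly l y = complete (fun k => p k * psum y k) n := by
  apply mul_right_cancel₀ hy
  have h1 : ∑ l ∈ partitionsOf n, schur l p * schurPoly l y =
      ∑ l ∈ partitionsOf n with l.colLen 0 ≤ N, schur l p * schurPoly l y := by
    symm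
    apply Finset.sum_filter_of_ne
    intro l _ h
    by_contra h2
    exact h (by rw [schurPoly_eq_zero l (by omega), mul_zero])
  rw [h1, Finset.sum_mul]
  trans ∑ a ∈ Finset.piAntidiag Finset.univ (n + ∑ i, shifted N ⊥ i),
      jacobiTrudi N p a * ∏ i, y i ^ a i
  · rw [sum_injective_eq]
    · refine Finset.sum_congr rfl fun l hl => ?_
      rw [mul_assoc, schurPoly_mul_alternant l (Finset.mem_filter.1 hl).2,
        schur_eq_jacobiTrudi l p (Finset.mem_filter.1 hl).2, alternant_eq_sum, Finset.mul_sum]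
      refine Finset.sum_congr rfl fun s _ => ?_
      rw [jacobiTrudi_comp_perm]
      simp only [Function.comp_apply]
      ring
    · intro a ha
      rw [jacobiTrudi_eq_zero p a ha, zero_mul]
  · rw [alternant_eq_sum, Finset.mul_sum]
    simp_rw [jacobiTrudi_eq_sum, Finset.sum_mul]
    rw [Finset.sum_comm]
    refine Finset.sum_congr rfl fun s _ => ?_
    have := sum_piAntidiag_completeInt p y (shifted N ⊥ ∘ s) n
    simp only [Function.comp_apply, Finset.prod_mul_distrib] at this
    rw [Equiv.sum_comp s (shifted N ⊥)] at this
    rw [mul_left_comm, ← this, Finset.mul_sum]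
    exact Finset.sum_congr rfl fun a _ => mul_assoc _ _ _

end Cauchy

/-! ### Limits in the number of variables -/

section Limit

variable {K : Type*} [Field K]

theorem pow_injective_of_ne_one {q : K} (h0 : q ≠ 0) (hq : ∀ n : ℕ, 0 < n → q ^ n ≠ 1) :
    Function.Injective fun n : ℕ => q ^ n := by
  have key : ∀ m n : ℕ, m < n → q ^ m ≠ q ^ n := by
    intro m n hmn h
    apply hq (n - m) (by omega)
    apply mul_left_cancel₀ (pow_ne_zero m h0)
    rw [← pow_add, mul_one, h]
    congr 1
    omega
  intro m n h
  rcases lt_trichotomy m n with h1 | h1 | h1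
  · exact absurd h (key m n h1)
  · exact h1
  · exact absurd h.symm (key n m h1)

/-- Takes the place of a limit N → ∞: identities known at q^{-N} for large N hold as polynomial
identities and can be evaluated at 0. -/
theorem polynomial_eq_of_eval_pow {q : K} (h0 : q ≠ 0) (hq : ∀ n : ℕ, 0 < n → q ^ n ≠ 1)
    {F G : K[X]} (M : ℕ) (h : ∀ n, M ≤ n → F.eval (q ^ n) = G.eval (q ^ n)) : F = G := by
  apply Polynomial.eq_of_infinite_eval_eq
  apply Set.Infinite.mono (s := (fun n : ℕ => q ^ n) '' Set.Ici M)
  · rintro _ ⟨n, hn, rfl⟩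
    exact h n hn
  · exact (Set.Ici_infinite M).image (pow_injective_of_ne_one h0 hq).injOn

end Limit

/-! ### Products of Schur functions are linear combinations of Schur functions -/

section Span

variable (K : Type*) [Field K]

/-- The span of the Schur functions, as functions of the power sums. -/
def schurSpan : Submodule K ((ℕ → K) → K) :=
  Submodule.span K (Set.range fun l : YoungDiagram => fun p : ℕ → K => schur l p)

variable {K}

theorem schur_eq_sum (l : YoungDiagram) (p : ℕ → K) {n : ℕ} (h : l.colLen 0 ≤ n) :
    schur l p = ∑ s : Equiv.Perm (Fin n), (Equiv.Perm.sign s : ℤ) *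
      ∏ i : Fin n, completeInt p ((l.rowLen i : ℤ) - (i : ℕ) + (s i : ℕ)) := by
  rw [schur_eq_jacobiTrudi l p h, jacobiTrudi_eq_sum]
  refine Finset.sum_congr rfl fun s _ => ?_
  congr 1
  refine Finset.prod_congr rfl fun i _ => ?_
  congr 1
  rw [shifted_bot, shifted]
  have := i.2
  have := (s i).2
  omega

theorem sum_sq_le {n : ℕ} (a : Fin n → ℕ) : ∑ i, a i ^ 2 ≤ (∑ i, a i) ^ 2 := by
  rw [sq, Finset.sum_mul]
  refine Finset.sum_le_sum fun i hi => ?_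
  rw [sq]
  exact Nat.mul_le_mul_left _ (Finset.single_le_sum (fun _ _ => Nat.zero_le _) hi)

/-- Triangularity of the Jacobi-Trudi expansion. Expand the squares: the cross term is non-negative
by the rearrangement inequality, and ∑ (s(i) - i)² is positive for s ≠ 1. -/
theorem sum_sq_lt_of_antitone {n : ℕ} {a b : Fin n → ℕ} (ha : Antitone a) {s : Equiv.Perm (Fin n)}
    (hs : s ≠ 1) (hb : ∀ i, (b i : ℤ) = a i - (i : ℕ) + (s i : ℕ)) :
    ∑ i, a i ^ 2 < ∑ i, b i ^ 2 := by
  zify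
  simp only [hb]
  have h1 : ∑ i, (a i : ℤ) * ((i : ℕ) : ℤ) ≤ ∑ i, (a i : ℤ) * ((s i : ℕ) : ℤ) := by
    have : Antivary (fun i => (a i : ℤ)) (fun i : Fin n => ((i : ℕ) : ℤ)) := by
      intro i j hij
      have hij' : i < j := by
        simp only [Nat.cast_lt] at hij
        exact hij
      simp only [Nat.cast_le]
      exact ha hij'.le
    exact this.sum_mul_le_sum_mul_comp_perm
  have h2 : 0 < ∑ i, (((s i : ℕ) : ℤ) - ((i : ℕ) : ℤ)) ^ 2 := by
    apply Finset.sum_pos'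
    · intro i _
      positivity
    · have : ∃ i, s i ≠ i := by
        by_contra h
        push Not at h
        exact hs (Equiv.ext h)
      obtain ⟨i, hi⟩ := this
      refine ⟨i, Finset.mem_univ _, ?_⟩
      have : ((s i : ℕ) : ℤ) - ((i : ℕ) : ℤ) ≠ 0 := by
        intro h
        apply hi
        apply Fin.ext
        omega
      positivity
  have h3 : ∑ i, ((a i : ℤ) - ((i : ℕ) : ℤ) + ((s i : ℕ) : ℤ)) ^ 2 = ∑ i, (a i : ℤ) ^ 2 +
      2 * (∑ i, (a i : ℤ) * ((s i : ℕ) : ℤ) - ∑ i, (a i : ℤ) * ((i : ℕ) : ℤ)) +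
        ∑ i, (((s i : ℕ) : ℤ) - ((i : ℕ) : ℤ)) ^ 2 := by
    rw [← Finset.sum_sub_distrib, Finset.mul_sum, ← Finset.sum_add_distrib, ← Finset.sum_add_distrib]
    refine Finset.sum_congr rfl fun i _ => ?_
    ring
  rw [h3]
  linarith

/-- After sorting, the product of the h_{a_i} is the diagonal term of a Jacobi-Trudi expansion.
Every other non-zero term has the same total degree and a larger sum of squares, so the induction
runs on (∑ a_i)² - ∑ a_i², a natural subtraction that `sum_sq_le` keeps exact. -/
theorem prod_complete_mem_schurSpan {n : ℕ} (a : Fin n → ℕ) :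
    (fun p : ℕ → K => ∏ i, complete p (a i)) ∈ schurSpan K := by
  induction h : (∑ i, a i) ^ 2 - ∑ i, a i ^ 2 using Nat.strong_induction_on generalizing a with
  | _ k ih =>
    obtain ⟨t, ht⟩ : ∃ t : Equiv.Perm (Fin n), Antitone (a ∘ t) :=
      ⟨Fin.revPerm.trans (Tuple.sort a), (Tuple.monotone_sort a).comp_antitone Fin.rev_anti⟩
    set c := a ∘ t with hc
    have e1 : (fun p : ℕ → K => ∏ i, complete p (a i)) = fun p => ∏ i, complete p (c i) := by
      funext p
      exact (Equiv.prod_comp t fun i => complete p (a i)).symm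
    have e2 : ∑ i, a i = ∑ i, c i := (Equiv.sum_comp t a).symm
    have e3 : ∑ i, a i ^ 2 = ∑ i, c i ^ 2 := (Equiv.sum_comp t fun i => a i ^ 2).symm
    rw [e1]
    rw [e2, e3] at h
    have e4 : (fun p : ℕ → K => ∏ i, complete p (c i)) = (fun p => schur (ofAntitone c ht) p) -
        ∑ s ∈ Finset.univ.erase (1 : Equiv.Perm (Fin n)), ((Equiv.Perm.sign s : ℤ) : K) •
          fun p : ℕ → K => ∏ i : Fin n, completeInt p ((c i : ℤ) - (i : ℕ) + (s i : ℕ)) := by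
      funext p
      have := schur_eq_sum (ofAntitone c ht) p (colLen_ofAntitone_le c ht)
      rw [← Finset.add_sum_erase _ _ (Finset.mem_univ 1)] at this
      simp only [rowLen_ofAntitone] at this
      rw [Pi.sub_apply, this, Finset.sum_apply]
      simp [completeInt_natCast]
    rw [e4]
    apply Submodule.sub_mem
    · exact Submodule.subset_span ⟨_, rfl⟩
    · apply Submodule.sum_mem
      intro s hs
      apply Submodule.smul_mem
      by_cases hneg : ∃ i : Fin n, (c i : ℤ) - (i : ℕ) + (s i : ℕ) < 0
      · obtain ⟨i, hi⟩ := hneg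
        convert Submodule.zero_mem _ with p
        exact Finset.prod_eq_zero (Finset.mem_univ i) (completeInt_neg p hi)
      · push Not at hneg
        set b : Fin n → ℕ := fun i => ((c i : ℤ) - (i : ℕ) + (s i : ℕ)).toNat with hb
        have hb' : ∀ i, (b i : ℤ) = (c i : ℤ) - (i : ℕ) + (s i : ℕ) :=
          fun i => Int.toNat_of_nonneg (hneg i)
        have e5 : (fun p : ℕ → K => ∏ i : Fin n,
            completeInt p ((c i : ℤ) - (i : ℕ) + (s i : ℕ))) = fun p => ∏ i, complete p (b i) := by
          funext p
          refine Finset.prod_congr rfl fun i _ => ?_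
          rw [← hb', completeInt_natCast]
        rw [e5]
        have h1 := sum_sq_lt_of_antitone ht (Finset.ne_of_mem_erase hs) hb'
        have h2 : ∑ i, b i = ∑ i, c i := by
          zify
          simp only [hb']
          rw [Finset.sum_add_distrib, Finset.sum_sub_distrib,
            Equiv.sum_comp s fun i : Fin n => ((i : ℕ) : ℤ)]
          ring
        have h3 := sum_sq_le b
        refine ih _ ?_ b rfl
        rw [← h, h2]
        rw [h2] at h3
        omega

theorem prod_completeInt_mem_schurSpan {n : ℕ} (a : Fin n → ℤ) :
    (fun p : ℕ → K => ∏ i, completeInt p (a i)) ∈ schurSpan K := by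
  by_cases hneg : ∃ i : Fin n, a i < 0
  · obtain ⟨i, hi⟩ := hneg
    convert Submodule.zero_mem _ with p
    exact Finset.prod_eq_zero (Finset.mem_univ i) (completeInt_neg p hi)
  · push Not at hneg
    convert prod_complete_mem_schurSpan (K := K) (fun i => (a i).toNat) using 2 with p
    refine Finset.prod_congr rfl fun i _ => ?_
    rw [← completeInt_natCast, Int.toNat_of_nonneg (hneg i)]

/-- The product of two Schur functions is a linear combination of Schur functions. -/
theorem exists_schur_mul_schur (l m : YoungDiagram) :
    ∃ c : YoungDiagram →₀ K, ∀ p : ℕ → K, schur l p * schur m p = c.sum fun n a => a * schur n p := by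
  have h : (fun p : ℕ → K => schur l p * schur m p) ∈ schurSpan K := by
    have e : (fun p : ℕ → K => schur l p * schur m p) =
        ∑ s : Equiv.Perm (Fin (l.colLen 0)), ∑ t : Equiv.Perm (Fin (m.colLen 0)),
          (((Equiv.Perm.sign s : ℤ) * (Equiv.Perm.sign t : ℤ) : K)) • fun p : ℕ → K =>
            ∏ i : Fin (l.colLen 0 + m.colLen 0), completeInt p (Fin.append
              (fun i : Fin (l.colLen 0) => (l.rowLen i : ℤ) - (i : ℕ) + (s i : ℕ))
              (fun i : Fin (m.colLen 0) => (m.rowLen i : ℤ) - (i : ℕ) + (t i : ℕ)) i) := by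
      funext p
      rw [schur_eq_sum l p le_rfl, schur_eq_sum m p le_rfl, Finset.sum_mul_sum]
      simp only [Finset.sum_apply, Pi.smul_apply, smul_eq_mul, Fin.prod_univ_add, Fin.append_left,
        Fin.append_right]
      refine Finset.sum_congr rfl fun s _ => Finset.sum_congr rfl fun t _ => ?_
      ring
    rw [e]
    exact Submodule.sum_mem _ fun s _ => Submodule.sum_mem _ fun t _ =>
      Submodule.smul_mem _ _ (prod_completeInt_mem_schurSpan _)
  obtain ⟨c, hc⟩ := (Finsupp.mem_span_range_iff_exists_finsupp).1 h
  refine ⟨c, fun p => ?_⟩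
  have := congrFun hc p
  rw [← this, Finsupp.sum, Finsupp.sum, Finset.sum_apply]
  rfl

end Span

/-! ### The branching rule and positivity -/

section Branching

variable {K : Type*} [Field K] [CharZero K]

theorem completeInt_sub_mul {N : ℕ} (x : Fin (N + 1) → K) (m : ℤ) :
    completeInt (psum x) m - x (Fin.last N) * completeInt (psum x) (m - 1) =
      completeInt (psum (x ∘ Fin.castSucc)) m := by
  have h1 : completeSeries (psum x) * (1 - PowerSeries.C (x (Fin.last N)) * PowerSeries.X) =
      completeSeries (psum (x ∘ Fin.castSucc)) := by
    have e : psum x = psum (x ∘ Fin.castSucc) + fun n => x (Fin.last N) ^ n := by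
      ext n
      simp [psum, Fin.sum_univ_castSucc]
    rw [e, completeSeries_add, mul_assoc, completeSeries_pow_mul, mul_one]
  rcases lt_or_ge m 0 with h | h
  · rw [completeInt_neg _ h, completeInt_neg _ h, completeInt_neg _ (by omega)]
    simp
  · lift m to ℕ using h
    have h2 := congrArg (PowerSeries.coeff m) h1
    rw [coeff_completeSeries, mul_sub, mul_one, map_sub, mul_comm (PowerSeries.C _), ← mul_assoc,
      PowerSeries.coeff_mul_C, coeff_completeSeries] at h2
    rw [completeInt_natCast, completeInt_natCast, ← h2]
    cases m with
    | zero => simp [completeInt_neg]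
    | succ m =>
      rw [PowerSeries.coeff_succ_mul_X, coeff_completeSeries,
        show ((m + 1 : ℕ) : ℤ) - 1 = (m : ℕ) by push_cast; ring, completeInt_natCast]
      ring

/-- The relation h_m(x) - y h_{m-1}(x) = h_m(x without y), telescoped r times. -/
theorem completeInt_sub_pow_mul {N : ℕ} (x : Fin (N + 1) → K) (m : ℤ) (r : ℕ) :
    completeInt (psum x) m - x (Fin.last N) ^ r * completeInt (psum x) (m - r) =
      ∑ t ∈ Finset.range r, x (Fin.last N) ^ t *
        completeInt (psum (x ∘ Fin.castSucc)) (m - t) := by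
  induction r with
  | zero => simp
  | succ r ih =>
    rw [Finset.sum_range_succ, ← ih, ← completeInt_sub_mul x (m - r)]
    push_cast
    rw [show m - (r : ℤ) - 1 = m - (r + 1) by ring]
    ring

/-- The lengths of the intervals of the interlacing condition. -/
def gap {n : ℕ} (a : Fin n → ℕ) (i : Fin n) : ℕ :=
  if h : (i : ℕ) + 1 < n then a i - a ⟨i + 1, h⟩ else a i + 1

theorem strictAnti_sub {n : ℕ} {a : Fin n → ℕ} (ha : StrictAnti a) {t : Fin n → ℕ}
    (ht : ∀ i, t i < gap a i) : StrictAnti fun i => a i - t i := by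
  cases n with
  | zero => exact fun i => i.elim0
  | succ n =>
    apply Fin.strictAnti_iff_succ_lt.2
    intro i
    have h1 := ht i.castSucc
    have h2 : a i.succ < a i.castSucc := ha (Fin.castSucc_lt_succ)
    have h3 : gap a i.castSucc = a i.castSucc - a i.succ := by
      rw [gap, dif_pos (by simp)]
      rfl
    omega

theorem gap_le {n : ℕ} (a : Fin n → ℕ) (i : Fin n) : gap a i ≤ a i + 1 := by
  unfold gap
  split_ifs <;> omega

/-- Subtract y^{gap} times the next row from each row, a unipotent operation. The entries become
sums over t < gap in one variable less, and multilinearity in the rows gives one determinant for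
each choice of t, that is, for each interlacing exponent vector. The size N + 1 of the determinants
is kept. -/
theorem jacobiTrudi_branching {N : ℕ} (x : Fin (N + 1) → K) {a : Fin (N + 1) → ℕ}
    (ha : StrictAnti a) :
    jacobiTrudi (N + 1) (psum x) a =
      ∑ t ∈ Fintype.piFinset fun i => Finset.range (gap a i), x (Fin.last N) ^ (∑ i, t i) *
        jacobiTrudi (N + 1) (psum (x ∘ Fin.castSucc)) (fun i => a i - t i) := by
  set y := x (Fin.last N) with hy
  let A : Matrix (Fin (N + 1)) (Fin (N + 1)) K := Matrix.of fun i j =>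
    completeInt (psum x) ((a i : ℤ) + j + 1 - (N + 1 : ℕ))
  let U : Matrix (Fin (N + 1)) (Fin (N + 1)) K := Matrix.of fun i j =>
    if i = j then 1 else if (j : ℕ) = i + 1 then - y ^ gap a i else 0
  have hU : U.det = 1 := by
    rw [Matrix.det_of_isUpperTriangular]
    · simp [U]
    · intro i j hij
      have hij' : (j : ℕ) < i := hij
      simp only [U, Matrix.of_apply]
      rw [if_neg (by rintro rfl; omega), if_neg (by omega)]
  have hUA : U * A = Matrix.of fun i j : Fin (N + 1) => ∑ t ∈ Finset.range (gap a i), y ^ t *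
      completeInt (psum (x ∘ Fin.castSucc)) ((a i : ℤ) + j + 1 - (N + 1 : ℕ) - t) := by
    ext i j
    rw [Matrix.of_apply, ← completeInt_sub_pow_mul, Matrix.mul_apply]
    by_cases hi : (i : ℕ) + 1 < N + 1
    · have hne : i ≠ ⟨i + 1, hi⟩ := by
        intro h
        have := congrArg Fin.val h
        simp at this
      rw [Finset.sum_eq_add i ⟨i + 1, hi⟩ hne]
      · have h3 : gap a i = a i - a ⟨i + 1, hi⟩ := dif_pos hi
        have h4 : a ⟨i + 1, hi⟩ < a i := ha (by rw [Fin.lt_def]; simp)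
        simp only [U, A, Matrix.of_apply, if_true, one_mul, if_neg hne]
        have h5 : ((a ⟨i + 1, hi⟩ : ℕ) : ℤ) + j + 1 - (N + 1 : ℕ) =
            (a i : ℤ) + j + 1 - (N + 1 : ℕ) - (gap a i : ℕ) := by omega
        rw [h5]
        simp only [hy]
        ring
      · intro k _ hk
        simp only [U, Matrix.of_apply]
        rw [if_neg (fun h => hk.1 h.symm), if_neg, zero_mul]
        intro h
        exact hk.2 (Fin.ext h)
      · simp
      · simp
    · rw [Finset.sum_eq_single i]
      · have h3 : gap a i = a i + 1 := dif_neg hi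
        simp only [U, A, Matrix.of_apply, if_true, one_mul]
        -- In the last row the gap a_i + 1 makes the index of the term to be subtracted negative, so
        -- no further row is needed.
        rw [completeInt_neg _ (m := (a i : ℤ) + j + 1 - (N + 1 : ℕ) - (gap a i : ℕ))]
        · simp
        · have := j.2
          omega
      · intro k _ hk
        simp only [U, Matrix.of_apply]
        rw [if_neg (fun h => hk h.symm), if_neg, zero_mul]
        have := k.2
        omega
      · simp
  have h1 : jacobiTrudi (N + 1) (psum x) a = (U * A).det := by
    rw [Matrix.det_mul, hU, one_mul]
    rfl
  rw [h1, hUA]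
  have h2 := (Matrix.detRowAlternating (R := K) (n := Fin (N + 1))).toMultilinearMap.map_sum_finset
    (fun (i : Fin (N + 1)) (t : ℕ) => fun j : Fin (N + 1) => y ^ t *
      completeInt (psum (x ∘ Fin.castSucc)) ((a i : ℤ) + j + 1 - (N + 1 : ℕ) - t))
    (fun i => Finset.range (gap a i))
  have h3 : (Matrix.of fun i j : Fin (N + 1) => ∑ t ∈ Finset.range (gap a i), y ^ t *
      completeInt (psum (x ∘ Fin.castSucc)) ((a i : ℤ) + j + 1 - (N + 1 : ℕ) - t)).det =
      (Matrix.detRowAlternating (R := K) (n := Fin (N + 1))).toMultilinearMap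
        fun i => ∑ t ∈ Finset.range (gap a i), fun j : Fin (N + 1) => y ^ t *
          completeInt (psum (x ∘ Fin.castSucc)) ((a i : ℤ) + j + 1 - (N + 1 : ℕ) - t) := by
    change Matrix.det _ = Matrix.det _
    congr 1
    ext i j
    simp
  rw [h3, h2]
  refine Finset.sum_congr rfl fun t ht => ?_
  change Matrix.det (Matrix.of fun i j : Fin (N + 1) => (fun i => y ^ t i) i *
    (Matrix.of fun i j : Fin (N + 1) => completeInt (psum (x ∘ Fin.castSucc))
      ((a i : ℤ) + j + 1 - (N + 1 : ℕ) - t i)) i j) = _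
  rw [Matrix.det_mul_column, Finset.prod_pow_eq_pow_sum, jacobiTrudi]
  congr 2
  ext i j
  simp only [Matrix.of_apply]
  congr 1
  have h5 := Finset.mem_range.1 (Fintype.mem_piFinset.1 ht i)
  have := gap_le a i
  omega

end Branching

theorem sum_fst_cells (l : YoungDiagram) {n : ℕ} (h : l.colLen 0 ≤ n) :
    ∑ c ∈ l.cells, c.1 = ∑ i : Fin n, i * l.rowLen i := by
  rw [sum_cells l h, Finset.sum_range]
  simp [mul_comm]

/-- Principal specializations of Schur polynomials have non-negative integer coefficients. -/
theorem exists_schurPoly_pow_eq (N : ℕ) : ∀ (b : Fin N → ℕ), (∀ i : Fin N, (i : ℕ) ≤ b i) →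
    ∀ l : YoungDiagram, ∃ P : ℕ[X], ∀ (K : Type*) [Field K] [CharZero K] (q : K),
      schurPoly l (fun i => q ^ b i) = q ^ (∑ c ∈ l.cells, c.1) * Polynomial.aeval q P := by
  induction N with
  | zero =>
    intro b _ l
    rcases Nat.eq_zero_or_pos (l.colLen 0) with h | h
    · refine ⟨1, fun K _ _ q => ?_⟩
      have : l = ⊥ := ext_rowLen_fin (N := 0) (by omega) (by rw [colLen_bot]) (fun i => i.elim0)
      rw [this, schurPoly_eq, schur_bot]
      simp
    · refine ⟨0, fun K _ _ q => ?_⟩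
      rw [schurPoly_eq_zero l h]
      simp
  | succ N ih =>
    intro b hb l
    rcases Nat.lt_or_ge (N + 1) (l.colLen 0) with h | h
    · refine ⟨0, fun K _ _ q => ?_⟩
      rw [schurPoly_eq_zero l h]
      simp
    · set a := shifted (N + 1) l with ha
      have ha' : StrictAnti a := shifted_strictAnti _ _
      set T := Fintype.piFinset fun i => Finset.range (gap a i) with hT
      have h1 : ∀ t ∈ T, ∃ k : YoungDiagram, k.colLen 0 ≤ N + 1 ∧
          shifted (N + 1) k = fun i => a i - t i := fun t ht =>
        exists_shifted_eq (strictAnti_sub ha' fun i =>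
          Finset.mem_range.1 (Fintype.mem_piFinset.1 ht i))
      choose! k hk1 hk2 using h1
      choose P hP using ih (b ∘ Fin.castSucc) (fun i => hb i.castSucc)
      refine ⟨∑ t ∈ T, Polynomial.X ^ (∑ c ∈ (k t).cells, c.1 + b (Fin.last N) * ∑ i, t i -
        ∑ c ∈ l.cells, c.1) * P (k t), fun K _ _ q => ?_⟩
      rw [schurPoly_eq, schur_eq_jacobiTrudi l _ h, jacobiTrudi_branching _ ha', map_sum,
        Finset.mul_sum]
      refine Finset.sum_congr rfl fun t ht => ?_
      -- `k t` may still have N + 1 rows. Its Schur polynomial in N variables is then 0, and the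
      -- induction hypothesis covers this case as well.
      have h2 := hP (k t) K q
      rw [schurPoly_eq, schur_eq_jacobiTrudi _ _ (hk1 t ht), hk2 t ht] at h2
      change _ * jacobiTrudi (N + 1) (psum fun i => q ^ (b ∘ Fin.castSucc) i) _ = _
      rw [h2, map_mul, map_pow, Polynomial.aeval_X, ← pow_mul, ← mul_assoc, ← mul_assoc, ← pow_add,
        ← pow_add]
      congr 2
      -- Makes the natural subtraction in the witness exact: a cell removed from row i lowers the
      -- sum by i ≤ N ≤ b(N), and it contributes q^{b(N)}.
      have h3 : ∑ c ∈ l.cells, c.1 ≤ ∑ c ∈ (k t).cells, c.1 + b (Fin.last N) * ∑ i, t i := by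
        rw [sum_fst_cells l h, sum_fst_cells (k t) (hk1 t ht), Finset.mul_sum,
          ← Finset.sum_add_distrib]
        refine Finset.sum_le_sum fun i _ => ?_
        have h4 := congrFun (hk2 t ht) i
        have h5 := Finset.mem_range.1 (Fintype.mem_piFinset.1 ht i)
        have h6 := gap_le a i
        have h7 := hb (Fin.last N)
        have h8 := i.2
        have h9 : l.rowLen i = (k t).rowLen i + t i := by
          have h10 : a i = l.rowLen i + (N + 1 - 1 - i) := rfl
          have h11 : shifted (N + 1) (k t) i = (k t).rowLen i + (N + 1 - 1 - i) := rfl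
          have h12 : t i ≤ a i := by omega
          omega
        rw [h9, Nat.mul_add]
        simp only [Fin.val_last] at h7
        have : (i : ℕ) * t i ≤ b (Fin.last N) * t i := Nat.mul_le_mul_right _ (by omega)
        omega
      omega

/-! ### Hook lengths and the principal specialization -/

/-- The hook length of a cell. -/
def hook (l : YoungDiagram) (c : ℕ × ℕ) : ℕ :=
  (l.rowLen c.1 - c.2 - 1) + (l.colLen c.2 - c.1 - 1) + 1

/-- The hook lengths in row i and the differences of the i-th exponent with the later ones together
are exactly 1, …, `shifted N l i`, each once. This is how the Vandermonde quotient becomes a hook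
product. -/
theorem prod_row_hook {M : Type*} [CommMonoid M] (l : YoungDiagram) {N : ℕ} (h : l.colLen 0 ≤ N)
    (i : Fin N) (f : ℕ → M) :
    (∏ j ∈ Finset.range (l.rowLen i), f (hook l (i, j))) *
      ∏ k ∈ Finset.Ioi i, f (shifted N l i - shifted N l k) =
    ∏ m ∈ Finset.range (shifted N l i), f (m + 1) := by
  classical
  have hcol : ∀ j, l.colLen j ≤ N := fun j => (l.colLen_anti 0 j (Nat.zero_le _)).trans h
  have hmem : ∀ j, j < l.rowLen i → (i : ℕ) < l.colLen j := fun j hj =>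
    YoungDiagram.mem_iff_lt_colLen.1 (YoungDiagram.mem_iff_lt_rowLen.2 hj)
  have hi := i.2
  have hanti := shifted_strictAnti N l
  have inj1 : Set.InjOn (fun j => hook l (i, j)) (Finset.range (l.rowLen i)) := by
    have key : ∀ j j', j < j' → j' < l.rowLen i → hook l (i, j') < hook l (i, j) := by
      intro j j' hjj hj'
      have h1 := l.colLen_anti j j' hjj.le
      have h2 := hmem j' hj'
      simp only [hook]
      omega
    intro j hj j' hj' e
    simp only [Finset.coe_range, Set.mem_Iio] at hj hj'
    simp only at e
    rcases lt_trichotomy j j' with h1 | h1 | h1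
    · have := key j j' h1 hj'; omega
    · exact h1
    · have := key j' j h1 hj; omega
  have inj2 : Set.InjOn (fun k => shifted N l i - shifted N l k) (Finset.Ioi i) := by
    intro k hk k' hk' e
    simp only [Finset.coe_Ioi, Set.mem_Ioi] at hk hk'
    have h1 := hanti hk
    have h2 := hanti hk'
    simp only at e
    exact hanti.injective (by omega)
  have hdisj : Disjoint ((Finset.range (l.rowLen i)).image fun j => hook l (i, j))
      ((Finset.Ioi i).image fun k => shifted N l i - shifted N l k) := by
    rw [Finset.disjoint_left]
    rintro _ h1 h2
    obtain ⟨j, hj, rfl⟩ := Finset.mem_image.1 h1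
    obtain ⟨k, hk, e⟩ := Finset.mem_image.1 h2
    have hj' := Finset.mem_range.1 hj
    have hk' : (i : ℕ) < k := Fin.lt_def.1 (Finset.mem_Ioi.1 hk)
    have h3 := hanti (Finset.mem_Ioi.1 hk)
    have h4 := hmem j hj'
    have h5 := k.2
    have h6 : l.rowLen k ≤ l.rowLen i := l.rowLen_anti i k hk'.le
    -- A coincidence would mean colLen j - k = j + 1 - rowLen k. According to whether (k, j) lies in
    -- the diagram, one side is positive and the other is not.
    have h7 : j < l.rowLen k ↔ (k : ℕ) < l.colLen j := by
      rw [← YoungDiagram.mem_iff_lt_rowLen, YoungDiagram.mem_iff_lt_colLen]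
    simp only [hook, shifted] at e
    omega
  have hunion : ((Finset.range (l.rowLen i)).image fun j => hook l (i, j)) ∪
      ((Finset.Ioi i).image fun k => shifted N l i - shifted N l k) =
      (Finset.range (shifted N l i)).image (· + 1) := by
    apply Finset.eq_of_subset_of_card_le
    · intro m hm
      rw [Finset.mem_image]
      suffices h : 1 ≤ m ∧ m ≤ shifted N l i from
        ⟨m - 1, Finset.mem_range.2 (by omega), by omega⟩
      rcases Finset.mem_union.1 hm with h1 | h1
      · obtain ⟨j, hj, rfl⟩ := Finset.mem_image.1 h1
        have hj' := Finset.mem_range.1 hj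
        have := hcol j
        simp only [hook, shifted]
        omega
      · obtain ⟨k, hk, rfl⟩ := Finset.mem_image.1 h1
        have h3 := hanti (Finset.mem_Ioi.1 hk)
        omega
    · rw [Finset.card_union_of_disjoint hdisj, Finset.card_image_of_injOn inj1,
        Finset.card_image_of_injOn inj2, Finset.card_image_of_injective _ (add_left_injective 1)]
      simp [shifted]
  rw [← Finset.prod_image inj1 (f := f), ← Finset.prod_image inj2 (f := f),
    ← Finset.prod_union hdisj, hunion, Finset.prod_image (add_left_injective 1).injOn]

/-! ### Vandermonde determinants at powers of q and the principal specialization. -/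

section Principal

variable {K : Type*} [Field K]

theorem alternant_pow_eq {N : ℕ} (q : K) {a : Fin N → ℕ} (ha : StrictAnti a) :
    alternant (fun i : Fin N => q ^ (i : ℕ)) a = (∏ i, ∏ j ∈ Finset.Ioi i, q ^ a j) *
      ∏ i, ∏ j ∈ Finset.Ioi i, (1 - q ^ (a i - a j)) := by
  have h1 : alternant (fun i : Fin N => q ^ (i : ℕ)) a = (Matrix.vandermonde fun j => q ^ a j).det := by
    rw [alternant, ← Matrix.det_transpose]
    congr 1
    ext i j
    rw [Matrix.transpose_apply, Matrix.of_apply, Matrix.vandermonde_apply, ← pow_mul, ← pow_mul,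
      mul_comm]
  rw [h1, Matrix.det_vandermonde, ← Finset.prod_mul_distrib]
  refine Finset.prod_congr rfl fun i _ => ?_
  rw [← Finset.prod_mul_distrib]
  refine Finset.prod_congr rfl fun j hj => ?_
  have := ha (Finset.mem_Ioi.1 hj)
  rw [mul_sub, mul_one, ← pow_add]
  congr 2
  omega

theorem alternant_bot_ne_zero {N : ℕ} {x : Fin N → K} (hx : Function.Injective x) :
    alternant x (shifted N ⊥) ≠ 0 := by
  have h1 : alternant x (shifted N ⊥) =
      (Matrix.submatrix (Matrix.vandermonde x) id (Fin.revPerm : Equiv.Perm (Fin N))).det := by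
    rw [alternant]
    congr 1
    ext i j
    simp only [Matrix.of_apply, Matrix.submatrix_apply, Matrix.vandermonde_apply, id,
      Fin.revPerm_apply, Fin.val_rev, shifted_bot]
    congr 1
    omega
  rw [h1, Matrix.det_permute']
  refine mul_ne_zero ?_ (Matrix.det_vandermonde_ne_zero_iff.2 hx)
  rcases Int.units_eq_one_or (Equiv.Perm.sign (Fin.revPerm : Equiv.Perm (Fin N))) with h | h <;>
    simp [h]

variable [CharZero K]

/-- At a geometric progression both alternants are Vandermonde determinants. Applying
`prod_row_hook` to l and to the empty diagram cancels the differences and leaves hook and content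
products. -/
theorem schurPoly_geometric (l : YoungDiagram) {N : ℕ} (h : l.colLen 0 ≤ N) {q : K} (h0 : q ≠ 0)
    (hq : ∀ n : ℕ, 0 < n → q ^ n ≠ 1) :
    schurPoly l (fun i : Fin N => q ^ (i : ℕ)) * ∏ c ∈ l.cells, (1 - q ^ hook l c) =
      q ^ (∑ c ∈ l.cells, c.1) * ∏ c ∈ l.cells, (1 - q ^ (N - c.1 + c.2)) := by
  have hne : alternant (fun i : Fin N => q ^ (i : ℕ)) (shifted N ⊥) ≠ 0 :=
    alternant_bot_ne_zero fun i j hij => Fin.ext (pow_injective_of_ne_one h0 hq hij)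
  apply mul_right_cancel₀ hne
  rw [mul_right_comm, schurPoly_mul_alternant l h, alternant_pow_eq q (shifted_strictAnti N l),
    alternant_pow_eq q (shifted_strictAnti N ⊥), prod_cells_fin l h, prod_cells_fin l h]
  have h1 : (∏ i, ∏ j ∈ Finset.Ioi i, (1 - q ^ (shifted N l i - shifted N l j))) *
      ∏ i : Fin N, ∏ j ∈ Finset.range (l.rowLen i), (1 - q ^ hook l (i, j)) =
      (∏ i : Fin N, ∏ j ∈ Finset.range (l.rowLen i), (1 - q ^ (N - i + j))) *
      ∏ i, ∏ j ∈ Finset.Ioi i, (1 - q ^ (shifted N ⊥ i - shifted N ⊥ j)) := by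
    rw [← Finset.prod_mul_distrib, ← Finset.prod_mul_distrib]
    refine Finset.prod_congr rfl fun i _ => ?_
    have h2 := prod_row_hook l h i (fun m => 1 - q ^ m)
    have h3 := prod_row_hook ⊥ (N := N) (by rw [colLen_bot]; omega) i (fun m => 1 - q ^ m)
    rw [rowLen_bot, Finset.range_zero, Finset.prod_empty, one_mul] at h3
    rw [mul_comm, h2, h3, shifted, add_comm (l.rowLen i), Finset.prod_range_add, mul_comm, shifted_bot]
    congr 1
    refine Finset.prod_congr rfl fun j _ => ?_
    have := i.2
    congr 2
    omega
  have h4 : (∏ i, ∏ j ∈ Finset.Ioi i, q ^ shifted N l j) =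
      q ^ (∑ c ∈ l.cells, c.1) * ∏ i, ∏ j ∈ Finset.Ioi i, q ^ shifted N ⊥ j := by
    have h5 : ∀ a : Fin N → ℕ, (∏ i, ∏ j ∈ Finset.Ioi i, q ^ a j) = q ^ ∑ j : Fin N, j * a j := by
      intro a
      simp only [Finset.prod_pow_eq_pow_sum]
      congr 1
      rw [Finset.sum_comm' (t' := Finset.univ) (s' := fun j => Finset.Iio j) (by simp)]
      simp
    rw [h5, h5, sum_fst_cells l h, ← pow_add, ← Finset.sum_add_distrib]
    congr 1
    refine Finset.sum_congr rfl fun i _ => ?_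
    rw [shifted_bot, shifted, mul_add]
  rw [mul_assoc, h1, h4]
  ring

end Principal

/-! ### The specialization at `q ^ η t ^ ρ` for `q = t` -/

section Rho

variable {K : Type*} [Field K]

/-- The first `N` variables of the alphabet `q ^ η q ^ ρ`, where `q = u ^ 2`. -/
def rhoVars (u : K) (N : ℕ) (e : YoungDiagram) (i : Fin N) : K :=
  u ^ (2 * (e.rowLen i : ℤ) - 2 * (i : ℕ) - 1)

theorem rhoVars_eq {u : K} (hu : u ≠ 0) (N : ℕ) (e : YoungDiagram) (i : Fin N) :
    rhoVars u N e i = u ^ (1 - 2 * (N : ℤ)) * (u ^ 2) ^ shifted N e i := by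
  have := i.2
  rw [← pow_mul, ← zpow_natCast u (2 * shifted N e i), ← zpow_add₀ hu, rhoVars, shifted]
  congr 1
  omega

theorem rhoVars_bot {u : K} (N : ℕ) (i : Fin N) :
    rhoVars u N ⊥ i = u⁻¹ * ((u ^ 2)⁻¹) ^ (i : ℕ) := by
  rw [← inv_pow, ← pow_mul, ← pow_succ', inv_pow, ← zpow_natCast, ← zpow_neg, rhoVars, rowLen_bot]
  congr 1
  push_cast
  ring

theorem inv_sq_ne_zero {u : K} (hu : u ≠ 0) : (u ^ 2)⁻¹ ≠ 0 := inv_ne_zero (pow_ne_zero 2 hu)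

theorem sq_pow_ne_one {u : K} (hq : ∀ n : ℕ, 0 < n → u ^ n ≠ 1) (n : ℕ) (hn : 0 < n) :
    (u ^ 2) ^ n ≠ 1 := by
  rw [← pow_mul]
  exact hq _ (by omega)

theorem inv_pow_ne_one {u : K} (hq : ∀ n : ℕ, 0 < n → u ^ n ≠ 1) (n : ℕ) (hn : 0 < n) :
    u⁻¹ ^ n ≠ 1 := by
  rw [inv_pow, ne_eq, inv_eq_one]
  exact hq n hn

theorem rhoVars_injective {u : K} (hu : u ≠ 0) (hq : ∀ n : ℕ, 0 < n → u ^ n ≠ 1) (N : ℕ)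
    (e : YoungDiagram) : Function.Injective (rhoVars u N e) := by
  intro i j hij
  rw [rhoVars_eq hu, rhoVars_eq hu] at hij
  have h1 := mul_left_cancel₀ (zpow_ne_zero _ hu) hij
  exact (shifted_strictAnti N e).injective
    (pow_injective_of_ne_one (pow_ne_zero 2 hu) (sq_pow_ne_one hq) h1)

theorem sub_inv_ne_zero {u : K} (hu : u ≠ 0) (hq : ∀ n : ℕ, 0 < n → u ^ n ≠ 1) (n : ℕ) :
    u ^ (n + 1) - (u ^ (n + 1))⁻¹ ≠ 0 := by
  intro h
  rw [sub_eq_zero] at h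
  apply hq (2 * (n + 1)) (by omega)
  rw [two_mul, pow_add]
  nth_rw 2 [h]
  exact mul_inv_cancel₀ (pow_ne_zero _ hu)

/-- The variables after the first N form a geometric tail because e has no rows there; summing it
gives the correction term. So the truncated power sum depends on N only through a monomial in
q^{-N}. -/
theorem psum_rhoVars {u : K} (hu : u ≠ 0) (hq : ∀ n : ℕ, 0 < n → u ^ n ≠ 1) {N : ℕ}
    {e : YoungDiagram} (h : e.colLen 0 ≤ N) (k : ℕ) :
    psum (rhoVars u N e) (k + 1) = powerSumRho (u ^ 2) u e (k + 1) -
      (((u ^ 2)⁻¹) ^ N) ^ (k + 1) * (u ^ (k + 1) - (u ^ (k + 1))⁻¹)⁻¹ := by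
  have hne := sub_inv_ne_zero hu hq k
  have h1 : ∀ N : ℕ, ∑ i ∈ Finset.range N, u ^ (-(((k + 1 : ℕ) : ℤ) * (2 * (i : ℕ) + 1))) =
      (u ^ (k + 1) - (u ^ (k + 1))⁻¹)⁻¹ -
        (((u ^ 2)⁻¹) ^ N) ^ (k + 1) * (u ^ (k + 1) - (u ^ (k + 1))⁻¹)⁻¹ := by
    intro N
    rw [← one_sub_mul, eq_mul_inv_iff_mul_eq₀ hne]
    induction N with
    | zero => simp
    | succ N ih =>
      rw [Finset.sum_range_succ, add_mul, ih]
      have e1 : u ^ (-(((k + 1 : ℕ) : ℤ) * (2 * (N : ℕ) + 1))) =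
          (((u ^ 2)⁻¹) ^ N) ^ (k + 1) * (u ^ (k + 1))⁻¹ := by
        rw [← inv_pow, ← pow_mul, ← pow_mul, inv_pow, ← mul_inv, ← pow_add, ← zpow_natCast,
          ← zpow_neg]
        congr 1
        push_cast
        ring
      have e2 : (((u ^ 2)⁻¹) ^ (N + 1)) ^ (k + 1) =
          (((u ^ 2)⁻¹) ^ N) ^ (k + 1) * ((u ^ (k + 1))⁻¹ * (u ^ (k + 1))⁻¹) := by
        rw [pow_succ _ N, mul_pow, ← mul_inv, ← pow_add, ← two_mul, pow_mul, inv_pow (u ^ 2) (k + 1)]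
      rw [e1, e2]
      have : u ^ (k + 1) ≠ 0 := pow_ne_zero _ hu
      field_simp
      ring
  have h2 : psum (rhoVars u N e) (k + 1) = ∑ i ∈ Finset.range N,
      (((u ^ 2) ^ ((k + 1) * e.rowLen i) - 1) * u ^ (-(((k + 1 : ℕ) : ℤ) * (2 * (i : ℕ) + 1))) +
        u ^ (-(((k + 1 : ℕ) : ℤ) * (2 * (i : ℕ) + 1)))) := by
    rw [psum, Finset.sum_range]
    refine Finset.sum_congr rfl fun i _ => ?_
    rw [sub_one_mul, sub_add_cancel, rhoVars, ← zpow_natCast, ← zpow_mul, ← pow_mul,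
      ← zpow_natCast u, ← zpow_add₀ hu]
    congr 1
    push_cast
    ring
  rw [h2, Finset.sum_add_distrib, h1, powerSumRho, add_sub_assoc]
  congr 1
  symm
  apply Finset.sum_subset (Finset.range_subset_range.2 h)
  intro i _ hi
  rw [Finset.mem_range, not_lt] at hi
  rw [rowLen_eq_zero hi]
  simp

/-- A Schur function of `N` variables of the alphabet `q ^ η q ^ ρ` is a polynomial in `q ^ -N`. -/
theorem exists_polynomial_schurPoly_rhoVars {u : K} (hu : u ≠ 0) (hq : ∀ n : ℕ, 0 < n → u ^ n ≠ 1)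
    (l e : YoungDiagram) :
    ∃ F : K[X], F.eval 0 = schur l (powerSumRho (u ^ 2) u e) ∧
      ∀ N, e.colLen 0 ≤ N → F.eval (((u ^ 2)⁻¹) ^ N) = schurPoly l (rhoVars u N e) := by
  obtain ⟨F, hF⟩ := exists_schur_eq (K := K) (fun k => Polynomial.C (powerSumRho (u ^ 2) u e k) -
    Polynomial.X ^ k * Polynomial.C ((u ^ k - (u ^ k)⁻¹)⁻¹)) l
  refine ⟨F, ?_, fun N hN => ?_⟩
  · have := hF (Polynomial.aeval 0)
    rw [Polynomial.coe_aeval_eq_eval] at this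
    rw [this]
    apply schur_congr
    intro k
    simp
  · have := hF (Polynomial.aeval (((u ^ 2)⁻¹) ^ N))
    rw [Polynomial.coe_aeval_eq_eval] at this
    rw [this, schurPoly_eq]
    apply schur_congr
    intro k
    rw [psum_rhoVars hu hq hN]
    simp only [Polynomial.eval_sub, Polynomial.eval_mul, Polynomial.eval_C, Polynomial.eval_pow,
      Polynomial.eval_X]

variable [CharZero K]

/-- After clearing denominators both sides contain det q^{(l+δ)_i (e+δ)_j}, which is symmetric in l
and e. The homogeneity factors agree as well. -/
theorem schurPoly_rhoVars_symm {u : K} (hu : u ≠ 0) (hq : ∀ n : ℕ, 0 < n → u ^ n ≠ 1)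
    (l e : YoungDiagram) {N : ℕ} (hl : l.colLen 0 ≤ N) (he : e.colLen 0 ≤ N) :
    schurPoly l (rhoVars u N e) * schurPoly e (rhoVars u N ⊥) =
      schurPoly l (rhoVars u N ⊥) * schurPoly e (rhoVars u N l) := by
  let y : YoungDiagram → Fin N → K := fun e i => (u ^ 2) ^ shifted N e i
  have h1 : ∀ e, rhoVars u N e = fun i => u ^ (1 - 2 * (N : ℤ)) * y e i :=
    fun e => funext fun i => rhoVars_eq hu N e i
  have hz : u ^ (1 - 2 * (N : ℤ)) ≠ 0 := zpow_ne_zero _ hu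
  have hs : ∀ a b, alternant (y a) (shifted N b) = alternant (y b) (shifted N a) := by
    intro a b
    rw [alternant, ← Matrix.det_transpose, alternant]
    congr 1
    ext i j
    simp only [Matrix.transpose_apply, Matrix.of_apply, y]
    rw [← pow_mul (u ^ 2), ← pow_mul (u ^ 2), mul_comm]
  have hne : ∀ e, alternant (y e) (shifted N ⊥) ≠ 0 := fun e => alternant_bot_ne_zero fun i j hij =>
    (shifted_strictAnti N e).injective
      (pow_injective_of_ne_one (pow_ne_zero 2 hu) (sq_pow_ne_one hq) hij)
  rw [h1, h1, h1, schurPoly_smul _ _ hz, schurPoly_smul _ _ hz, schurPoly_smul _ _ hz,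
    schurPoly_smul _ _ hz]
  have h2 := schurPoly_mul_alternant l hl (y e)
  have h3 := schurPoly_mul_alternant e he (y ⊥)
  have h4 := schurPoly_mul_alternant l hl (y ⊥)
  have h5 := schurPoly_mul_alternant e he (y l)
  rw [hs ⊥ e] at h3
  rw [hs ⊥ l] at h4
  rw [hs l e] at h5
  have key : schurPoly l (y e) * schurPoly e (y ⊥) = schurPoly l (y ⊥) * schurPoly e (y l) := by
    apply mul_right_cancel₀ (hne ⊥)
    rw [mul_assoc, h3, h2, mul_right_comm, h4, mul_comm, h5]
  linear_combination (u ^ (1 - 2 * (N : ℤ))) ^ l.card * (u ^ (1 - 2 * (N : ℤ))) ^ e.card * key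

/-- Both sides are values at q^{-N} = 0 of polynomials that agree at q^{-N} for all N not below the
two lengths. -/
theorem schur_powerSumRho_symm {u : K} (hu : u ≠ 0) (hq : ∀ n : ℕ, 0 < n → u ^ n ≠ 1)
    (l e : YoungDiagram) :
    schur l (powerSumRho (u ^ 2) u e) * schur e (powerSumRho (u ^ 2) u ⊥) =
      schur l (powerSumRho (u ^ 2) u ⊥) * schur e (powerSumRho (u ^ 2) u l) := by
  obtain ⟨F1, h1, h1'⟩ := exists_polynomial_schurPoly_rhoVars hu hq l e
  obtain ⟨F2, h2, h2'⟩ := exists_polynomial_schurPoly_rhoVars hu hq e ⊥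
  obtain ⟨F3, h3, h3'⟩ := exists_polynomial_schurPoly_rhoVars hu hq l ⊥
  obtain ⟨F4, h4, h4'⟩ := exists_polynomial_schurPoly_rhoVars hu hq e l
  have : F1 * F2 = F3 * F4 := by
    apply polynomial_eq_of_eval_pow (inv_sq_ne_zero hu) (inv_pow_ne_one (sq_pow_ne_one hq))
      (max (l.colLen 0) (e.colLen 0))
    intro N hN
    have hb : (⊥ : YoungDiagram).colLen 0 ≤ N := by rw [colLen_bot]; omega
    rw [Polynomial.eval_mul, Polynomial.eval_mul, h1' N (by omega), h2' N hb, h3' N hb,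
      h4' N (by omega)]
    exact schurPoly_rhoVars_symm hu hq l e (by omega) (by omega)
  rw [← h1, ← h2, ← h3, ← h4, ← Polynomial.eval_mul, this, Polynomial.eval_mul]

theorem cauchy_identity_rho {u : K} (hu : u ≠ 0) (hq : ∀ n : ℕ, 0 < n → u ^ n ≠ 1) (p : ℕ → K)
    (n : ℕ) :
    ∑ l ∈ partitionsOf n, schur l p * schur l (powerSumRho (u ^ 2) u ⊥) =
      complete (fun k => p k * powerSumRho (u ^ 2) u ⊥ k) n := by
  choose F hF hF' using fun l => exists_polynomial_schurPoly_rhoVars hu hq l ⊥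
  obtain ⟨G, hG⟩ := exists_complete_eq (K := K) (fun k => Polynomial.C (p k) *
    (Polynomial.C (powerSumRho (u ^ 2) u ⊥ k) -
      Polynomial.X ^ k * Polynomial.C ((u ^ k - (u ^ k)⁻¹)⁻¹))) n
  have : ∑ l ∈ partitionsOf n, Polynomial.C (schur l p) * F l = G := by
    apply polynomial_eq_of_eval_pow (inv_sq_ne_zero hu) (inv_pow_ne_one (sq_pow_ne_one hq)) 0
    intro N _
    have hb : (⊥ : YoungDiagram).colLen 0 ≤ N := by rw [colLen_bot]; omega
    have h1 := hG (Polynomial.aeval (((u ^ 2)⁻¹) ^ N))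
    rw [Polynomial.coe_aeval_eq_eval] at h1
    rw [h1, Polynomial.eval_finsetSum]
    simp only [Polynomial.eval_mul, Polynomial.eval_C, hF' _ N hb]
    rw [cauchy_identity p _ (alternant_bot_ne_zero (rhoVars_injective hu hq N ⊥))]
    apply congrFun
    apply complete_congr
    intro k
    rw [psum_rhoVars hu hq hb]
    simp only [Polynomial.eval_mul, Polynomial.eval_sub, Polynomial.eval_C, Polynomial.eval_pow,
      Polynomial.eval_X]
  have h1 := hG (Polynomial.aeval 0)
  rw [Polynomial.coe_aeval_eq_eval, ← this, Polynomial.eval_finsetSum] at h1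
  simp only [Polynomial.eval_mul, Polynomial.eval_C, hF] at h1
  rw [h1]
  apply congrFun
  apply complete_congr
  intro k
  simp

end Rho

/-! ### The hook formula and the framing factor -/

theorem prod_cells_col {M : Type*} [CommMonoid M] (l : YoungDiagram) (f : ℕ × ℕ → M) :
    ∏ c ∈ l.cells, f c =
      ∏ j ∈ Finset.range (l.rowLen 0), ∏ i ∈ Finset.range (l.colLen j), f (i, j) := by
  apply Finset.prod_finset_product_right
  intro c
  rw [YoungDiagram.mem_cells, show c = (c.1, c.2) from rfl, YoungDiagram.mem_iff_lt_colLen,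
    Finset.mem_range, Finset.mem_range]
  refine ⟨fun hc => ⟨?_, hc⟩, fun hc => hc.2⟩
  have h1 := YoungDiagram.mem_iff_lt_rowLen.1 (YoungDiagram.mem_iff_lt_colLen.2 hc)
  have h2 := l.rowLen_anti 0 c.1 (Nat.zero_le _)
  omega

theorem sum_leg_eq (l : YoungDiagram) :
    ∑ c ∈ l.cells, (l.colLen c.2 - c.1 - 1) = ∑ c ∈ l.cells, c.1 := by
  have h := fun f : ℕ × ℕ → ℕ => prod_cells_col (M := Multiplicative ℕ) l f
  have h1 : ∀ f : ℕ × ℕ → ℕ, ∑ c ∈ l.cells, f c =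
    ∑ j ∈ Finset.range (l.rowLen 0), ∑ i ∈ Finset.range (l.colLen j), f (i, j) := h
  rw [h1, h1]
  refine Finset.sum_congr rfl fun j _ => ?_
  rw [← Finset.sum_range_reflect (fun i => i)]
  refine Finset.sum_congr rfl fun i _ => ?_
  simp only
  omega

section Rho

variable {K : Type*} [Field K]

theorem prod_one_sub_pow_hook_ne_zero {q : K} (hq : ∀ n : ℕ, 0 < n → q ^ n ≠ 1) (l : YoungDiagram) :
    ∏ c ∈ l.cells, (1 - q ^ hook l c) ≠ 0 := by
  rw [Finset.prod_ne_zero_iff]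
  intro c _ h
  exact hq (hook l c) (by unfold hook; omega) (sub_eq_zero.1 h).symm

theorem inv_inv_sq (u : K) : (u⁻¹ ^ 2)⁻¹ = u ^ 2 := by rw [inv_pow, inv_inv]

variable [CharZero K]

theorem schurPoly_rhoVars_mul {u : K} (hu : u ≠ 0) (hq : ∀ n : ℕ, 0 < n → u ^ n ≠ 1)
    (l : YoungDiagram) {N : ℕ} (h : l.colLen 0 ≤ N) :
    schurPoly l (rhoVars u N ⊥) * ∏ c ∈ l.cells, (1 - ((u ^ 2)⁻¹) ^ hook l c) =
      u⁻¹ ^ l.card * ((u ^ 2)⁻¹) ^ (∑ c ∈ l.cells, c.1) *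
        ∏ c ∈ l.cells, (1 - ((u ^ 2)⁻¹) ^ ((c.2 : ℤ) - c.1) * ((u ^ 2)⁻¹) ^ N) := by
  have h1 : rhoVars u N ⊥ = fun i : Fin N => u⁻¹ * ((u ^ 2)⁻¹) ^ (i : ℕ) :=
    funext fun i => rhoVars_bot N i
  rw [h1, schurPoly_smul _ _ (inv_ne_zero hu), mul_assoc, schurPoly_geometric l h
    (inv_sq_ne_zero hu) (inv_pow_ne_one (sq_pow_ne_one hq)), ← mul_assoc]
  congr 1
  refine Finset.prod_congr rfl fun c hc => ?_
  rw [← zpow_natCast ((u ^ 2)⁻¹), ← zpow_natCast ((u ^ 2)⁻¹), ← zpow_add₀ (inv_sq_ne_zero hu)]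
  have h2 : c.1 < l.colLen c.2 := YoungDiagram.mem_iff_lt_colLen.1 ((YoungDiagram.mem_cells c).1 hc)
  have h3 := l.colLen_anti 0 c.2 (Nat.zero_le _)
  congr 2
  omega

/-- The N-variable formula at q^{-N} = 0, where all content factors become 1. -/
theorem schur_powerSumRho_mul {u : K} (hu : u ≠ 0) (hq : ∀ n : ℕ, 0 < n → u ^ n ≠ 1)
    (l : YoungDiagram) :
    schur l (powerSumRho (u ^ 2) u ⊥) * ∏ c ∈ l.cells, (1 - ((u ^ 2)⁻¹) ^ hook l c) =
      u⁻¹ ^ l.card * ((u ^ 2)⁻¹) ^ (∑ c ∈ l.cells, c.1) := by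
  obtain ⟨F, h0, hF⟩ := exists_polynomial_schurPoly_rhoVars hu hq l ⊥
  have : F * Polynomial.C (∏ c ∈ l.cells, (1 - ((u ^ 2)⁻¹) ^ hook l c)) =
      Polynomial.C (u⁻¹ ^ l.card * ((u ^ 2)⁻¹) ^ (∑ c ∈ l.cells, c.1)) *
        ∏ c ∈ l.cells, (1 - Polynomial.C (((u ^ 2)⁻¹) ^ ((c.2 : ℤ) - c.1)) * Polynomial.X) := by
    apply polynomial_eq_of_eval_pow (inv_sq_ne_zero hu) (inv_pow_ne_one (sq_pow_ne_one hq))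
      (l.colLen 0)
    intro N hN
    simp only [Polynomial.eval_mul, Polynomial.eval_C, Polynomial.eval_prod, Polynomial.eval_sub,
      Polynomial.eval_one, Polynomial.eval_X]
    rw [hF N (by rw [colLen_bot]; omega), schurPoly_rhoVars_mul hu hq l hN]
  have h1 := congrArg (Polynomial.eval 0) this
  simp only [Polynomial.eval_mul, Polynomial.eval_C, Polynomial.eval_prod, Polynomial.eval_sub,
      Polynomial.eval_one, Polynomial.eval_X, h0, mul_zero, sub_zero, Finset.prod_const_one,
      mul_one] at h1
  exact h1

theorem schurPoly_rhoVars_eq {u : K} (hu : u ≠ 0) (hq : ∀ n : ℕ, 0 < n → u ^ n ≠ 1)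
    (l : YoungDiagram) (N : ℕ) :
    schurPoly l (rhoVars u N ⊥) = schur l (powerSumRho (u ^ 2) u ⊥) *
        ∏ c ∈ l.cells, (1 - ((u ^ 2)⁻¹) ^ ((c.2 : ℤ) - c.1) * ((u ^ 2)⁻¹) ^ N) := by
  rcases Nat.lt_or_ge N (l.colLen 0) with h | h
  -- If l has more than N rows, the cell (N, 0) has content -N and its factor 1 - q^N q^{-N}
  -- vanishes, which matches the vanishing of the Schur polynomial.
  · rw [schurPoly_eq_zero l h, Finset.prod_eq_zero (i := (N, 0)), mul_zero]
    · exact (YoungDiagram.mem_cells _).2 (YoungDiagram.mem_iff_lt_colLen.2 h)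
    · rw [← zpow_natCast ((u ^ 2)⁻¹), ← zpow_add₀ (inv_sq_ne_zero hu)]
      simp
  · apply mul_right_cancel₀ (prod_one_sub_pow_hook_ne_zero (inv_pow_ne_one (sq_pow_ne_one hq)) l)
    rw [schurPoly_rhoVars_mul hu hq l h, mul_right_comm (schur _ _), schur_powerSumRho_mul hu hq]

/-- Inverting q changes each factor 1 - q^{-h} of the hook formula into 1 - q^h = -q^h (1 - q^{-h}).
With the monomial prefactors, and since the legs sum to ∑ c.1, the exponents add up to arm minus leg
for each cell, which is the framing. -/
theorem schur_powerSumRho_eq_framing_mul {u : K} (hu : u ≠ 0) (hq : ∀ n : ℕ, 0 < n → u ^ n ≠ 1)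
    (l : YoungDiagram) :
    schur l (powerSumRho (u ^ 2) u ⊥) =
      framing (u ^ 2) l * schur l (powerSumRho (u⁻¹ ^ 2) u⁻¹ ⊥) := by
  have h1 := schur_powerSumRho_mul hu hq l
  have h2 := schur_powerSumRho_mul (inv_ne_zero hu) (inv_pow_ne_one hq) l
  rw [inv_inv_sq, inv_inv] at h2
  set H := ∏ c ∈ l.cells, (1 - ((u ^ 2)⁻¹) ^ hook l c) with hH
  have hHne : H ≠ 0 := prod_one_sub_pow_hook_ne_zero (inv_pow_ne_one (sq_pow_ne_one hq)) l
  have h3 : ∏ c ∈ l.cells, (1 - (u ^ 2) ^ hook l c) =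
      (∏ c ∈ l.cells, -((u ^ 2) ^ hook l c)) * H := by
    rw [hH, ← Finset.prod_mul_distrib]
    refine Finset.prod_congr rfl fun c _ => ?_
    have : (u ^ 2) ^ hook l c ≠ 0 := pow_ne_zero _ (pow_ne_zero 2 hu)
    rw [inv_pow]
    field_simp
    ring
  have hu2 : u ^ 2 ≠ 0 := pow_ne_zero 2 hu
  have h4 : framing (u ^ 2) l * (u ^ l.card * (u ^ 2) ^ (∑ c ∈ l.cells, c.1)) =
      (∏ c ∈ l.cells, -((u ^ 2) ^ hook l c)) *
        (u⁻¹ ^ l.card * ((u ^ 2)⁻¹) ^ (∑ c ∈ l.cells, c.1)) := by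
    have h5 : (u ^ 2) ^ (2 * ∑ c ∈ l.cells, (l.colLen c.2 - c.1 - 1) + l.card) =
        u ^ l.card * (u ^ 2) ^ (∑ c ∈ l.cells, c.1) * (u ^ l.card * (u ^ 2) ^ (∑ c ∈ l.cells, c.1)) := by
      rw [sum_leg_eq]
      ring
    have h6 : (∏ c ∈ l.cells, -((u ^ 2) ^ hook l c)) = framing (u ^ 2) l *
        (u ^ 2) ^ (2 * ∑ c ∈ l.cells, (l.colLen c.2 - c.1 - 1) + l.card) := by
      have : l.card = ∑ c ∈ l.cells, 1 := by simp [YoungDiagram.card]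
      rw [this, Finset.mul_sum, ← Finset.sum_add_distrib, ← Finset.prod_pow_eq_pow_sum, framing,
        ← Finset.prod_mul_distrib]
      refine Finset.prod_congr rfl fun c hc => ?_
      rw [neg_mul, ← zpow_natCast (u ^ 2), ← zpow_natCast (u ^ 2), ← zpow_add₀ hu2]
      congr 2
      have h7 : c.1 < l.colLen c.2 :=
        YoungDiagram.mem_iff_lt_colLen.1 ((YoungDiagram.mem_cells c).1 hc)
      have h8 : c.2 < l.rowLen c.1 :=
        YoungDiagram.mem_iff_lt_rowLen.1 ((YoungDiagram.mem_cells c).1 hc)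
      simp only [hook]
      omega
    rw [h6, h5]
    have h9 : u ^ l.card ≠ 0 := pow_ne_zero _ hu
    have h10 : (u ^ 2) ^ (∑ c ∈ l.cells, c.1) ≠ 0 := pow_ne_zero _ hu2
    rw [inv_pow, inv_pow]
    field_simp
  have hP : (∏ c ∈ l.cells, -((u ^ 2) ^ hook l c)) ≠ 0 := by
    rw [Finset.prod_ne_zero_iff]
    intro c _
    exact neg_ne_zero.2 (pow_ne_zero _ hu2)
  rw [h3] at h2
  apply mul_right_cancel₀ (mul_ne_zero hP hHne)
  rw [mul_assoc (framing _ _), h2, h4, ← h1]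
  ring

/-! ### The partition sum for `t = q` -/

/-- For t = q the two factors of a cell are 1 - q^h and 1 - q^{-h} with h its hook length. The
monomials in the hook formulas for q and q⁻¹ are inverse to each other. -/
theorem prod_hook_weight_eq {u : K} (hu : u ≠ 0) (hq : ∀ n : ℕ, 0 < n → u ^ n ≠ 1)
    (e : YoungDiagram) :
    ∏ c ∈ e.cells,
        ((1 - (u ^ 2) ^ ((e.rowLen c.1 : ℤ) - c.2) * (u ^ 2) ^ ((e.colLen c.2 : ℤ) - c.1 - 1)) *
          (1 - (u ^ 2) ^ (-(e.rowLen c.1 : ℤ) + c.2 + 1) *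
            (u ^ 2) ^ (-(e.colLen c.2 : ℤ) + c.1)))⁻¹ =
      schur e (powerSumRho (u ^ 2) u ⊥) * schur e (powerSumRho (u⁻¹ ^ 2) u⁻¹ ⊥) := by
  have h1 := schur_powerSumRho_mul hu hq e
  have h2 := schur_powerSumRho_mul (inv_ne_zero hu) (inv_pow_ne_one hq) e
  rw [inv_inv_sq, inv_inv] at h2
  have hu2 : u ^ 2 ≠ 0 := pow_ne_zero 2 hu
  have hne1 := prod_one_sub_pow_hook_ne_zero (inv_pow_ne_one (sq_pow_ne_one hq)) e
  have hne2 := prod_one_sub_pow_hook_ne_zero (sq_pow_ne_one hq) e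
  have h3 : ∏ c ∈ e.cells,
        ((1 - (u ^ 2) ^ ((e.rowLen c.1 : ℤ) - c.2) * (u ^ 2) ^ ((e.colLen c.2 : ℤ) - c.1 - 1)) *
          (1 - (u ^ 2) ^ (-(e.rowLen c.1 : ℤ) + c.2 + 1) *
            (u ^ 2) ^ (-(e.colLen c.2 : ℤ) + c.1)))⁻¹ =
      ((∏ c ∈ e.cells, (1 - (u ^ 2) ^ hook e c)) *
        ∏ c ∈ e.cells, (1 - ((u ^ 2)⁻¹) ^ hook e c))⁻¹ := by
    rw [← Finset.prod_mul_distrib, ← Finset.prod_inv_distrib]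
    refine Finset.prod_congr rfl fun c hc => ?_
    have h7 : c.1 < e.colLen c.2 :=
      YoungDiagram.mem_iff_lt_colLen.1 ((YoungDiagram.mem_cells c).1 hc)
    have h8 : c.2 < e.rowLen c.1 :=
      YoungDiagram.mem_iff_lt_rowLen.1 ((YoungDiagram.mem_cells c).1 hc)
    rw [← zpow_add₀ hu2, ← zpow_add₀ hu2, inv_pow (u ^ 2), ← zpow_natCast (u ^ 2) (hook e c), ← zpow_neg]
    congr 4
    · simp only [hook]
      omega
    · simp only [hook]
      omega
  rw [h3, inv_eq_of_mul_eq_one_left]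
  have h4 : u ^ e.card ≠ 0 := pow_ne_zero _ hu
  have h5 : (u ^ 2) ^ (∑ c ∈ e.cells, c.1) ≠ 0 := pow_ne_zero _ hu2
  calc _ = (schur e (powerSumRho (u ^ 2) u ⊥) * ∏ c ∈ e.cells, (1 - ((u ^ 2)⁻¹) ^ hook e c)) *
        (schur e (powerSumRho (u⁻¹ ^ 2) u⁻¹ ⊥) * ∏ c ∈ e.cells, (1 - (u ^ 2) ^ hook e c)) := by ring
    _ = 1 := by
      rw [h1, h2, inv_pow, inv_pow]
      field_simp

/-- The power sum of q^{-ρ} is -1 / (q^{k/2} - q^{-k/2}). It turns the contribution (q^{k l_i} - 1)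
q^{-k(i - 1/2)} of row i into minus the geometric sum of the k-th powers of q^c over the contents of
that row. -/
theorem powerSumRho_mul_inv {u : K} (hu : u ≠ 0) (hq : ∀ n : ℕ, 0 < n → u ^ n ≠ 1)
    (l : YoungDiagram) (k : ℕ) :
    powerSumRho (u ^ 2) u l (k + 1) * powerSumRho (u⁻¹ ^ 2) u⁻¹ ⊥ (k + 1) =
      powerSumRho (u ^ 2) u ⊥ (k + 1) * powerSumRho (u⁻¹ ^ 2) u⁻¹ ⊥ (k + 1) -
        ∑ c ∈ l.cells, ((u ^ 2) ^ ((c.2 : ℤ) - c.1)) ^ (k + 1) := by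
  have h1 : powerSumRho (u⁻¹ ^ 2) u⁻¹ ⊥ (k + 1) = -(u ^ (k + 1) - (u ^ (k + 1))⁻¹)⁻¹ := by
    rw [powerSumRho, colLen_bot, Finset.range_zero, Finset.sum_empty, zero_add, inv_pow, inv_inv,
      ← inv_neg]
    congr 1
    ring
  have h2 : powerSumRho (u ^ 2) u ⊥ (k + 1) = (u ^ (k + 1) - (u ^ (k + 1))⁻¹)⁻¹ := by
    rw [powerSumRho, colLen_bot, Finset.range_zero, Finset.sum_empty, zero_add]
  have hne := sub_inv_ne_zero hu hq k
  rw [h1, h2, sum_cells l le_rfl, powerSumRho, add_mul, add_comm,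
    sub_eq_add_neg (_ * _)]
  congr 1
  rw [mul_neg, neg_inj, Finset.sum_mul]
  refine Finset.sum_congr rfl fun i _ => ?_
  rw [mul_inv_eq_iff_eq_mul₀ hne]
  have h3 : ∀ j : ℕ, ((u ^ 2) ^ ((j : ℤ) - (i : ℕ))) ^ (k + 1) =
      u ^ (-(((k + 1 : ℕ) : ℤ) * (2 * (i : ℕ)))) * ((u ^ 2) ^ (k + 1)) ^ j := by
    intro j
    rw [← zpow_natCast _ (k + 1), ← zpow_mul, ← pow_mul, ← pow_mul, ← zpow_natCast u (2 * _),
      ← zpow_natCast u 2, ← zpow_mul, ← zpow_add₀ hu]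
    congr 1
    push_cast
    ring
  have h4 : u ^ (k + 1) - (u ^ (k + 1))⁻¹ =
      u ^ (-(((k + 1 : ℕ) : ℤ))) * ((u ^ 2) ^ (k + 1) - 1) := by
    rw [mul_sub, mul_one, zpow_neg, zpow_natCast, ← pow_mul, mul_comm 2, pow_mul, sq]
    have : u ^ (k + 1) ≠ 0 := pow_ne_zero _ hu
    field_simp
  have h5 := geom_sum_mul ((u ^ 2) ^ (k + 1)) (l.rowLen i)
  simp only [h3]
  rw [← Finset.mul_sum, h4]
  have h6 : u ^ (-(((k + 1 : ℕ) : ℤ) * (2 * (i : ℕ) + 1))) =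
      u ^ (-(((k + 1 : ℕ) : ℤ) * (2 * (i : ℕ)))) * u ^ (-(((k + 1 : ℕ) : ℤ))) := by
    rw [← zpow_add₀ hu]
    congr 1
    ring
  rw [h6, pow_mul (u ^ 2), ← h5]
  ring

theorem completeSeries_neg_pow (y : K) :
    completeSeries (-fun k => y ^ k) = 1 - PowerSeries.C y * PowerSeries.X := by
  have h1 := completeSeries_neg_mul (fun k => y ^ k)
  have h2 := completeSeries_pow_mul y
  calc _ = completeSeries (-fun k => y ^ k) *
        (completeSeries (fun k => y ^ k) * (1 - PowerSeries.C y * PowerSeries.X)) := by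
          rw [h2, mul_one]
    _ = _ := by rw [← mul_assoc, h1, one_mul]

theorem completeSeries_powerSumRho {u : K} (hu : u ≠ 0) (hq : ∀ n : ℕ, 0 < n → u ^ n ≠ 1)
    (l : YoungDiagram) :
    completeSeries (fun k => powerSumRho (u ^ 2) u l k * powerSumRho (u⁻¹ ^ 2) u⁻¹ ⊥ k) =
      completeSeries (fun k => powerSumRho (u ^ 2) u ⊥ k * powerSumRho (u⁻¹ ^ 2) u⁻¹ ⊥ k) *
        ((∏ c ∈ l.cells, (1 - Polynomial.C ((u ^ 2) ^ ((c.2 : ℤ) - c.1)) * Polynomial.X) : K[X]) :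
          K⟦X⟧) := by
  have h1 : ((∏ c ∈ l.cells, (1 - Polynomial.C ((u ^ 2) ^ ((c.2 : ℤ) - c.1)) * Polynomial.X) :
      K[X]) : K⟦X⟧) =
      completeSeries (∑ c ∈ l.cells, -fun k => ((u ^ 2) ^ ((c.2 : ℤ) - c.1)) ^ k) := by
    rw [completeSeries_sum, ← Polynomial.coeToPowerSeries.ringHom_apply, map_prod]
    refine Finset.prod_congr rfl fun c _ => ?_
    rw [completeSeries_neg_pow]
    simp
  rw [h1, ← completeSeries_add, completeSeries, completeSeries]
  congr 1
  apply complete_congr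
  intro k
  rw [powerSumRho_mul_inv hu hq l k, sub_eq_add_neg]
  simp

/-- Replace the product of Schur functions by its expansion, move η out of the argument with the
symmetry, and sum over η with the Cauchy identity. Only the polynomial factor depends on the labels,
so it survives in the quotient. -/
theorem Z_eq_sum {u : K} (hu : u ≠ 0) (hq : ∀ n : ℕ, 0 < n → u ^ n ≠ 1) (l m : YoungDiagram)
    (c : YoungDiagram →₀ K)
    (hc : ∀ p : ℕ → K, schur l p * schur m p = c.sum fun n a => a * schur n p) :
    Z (u ^ 2) u l m = ((c.sum fun n a => Polynomial.C (a * schur n (powerSumRho (u ^ 2) u ⊥)) *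
      ∏ c ∈ n.cells, (1 - Polynomial.C ((u ^ 2) ^ ((c.2 : ℤ) - c.1)) * Polynomial.X) : K[X]) : K⟦X⟧) *
      completeSeries (fun k => powerSumRho (u ^ 2) u ⊥ k * powerSumRho (u⁻¹ ^ 2) u⁻¹ ⊥ k) := by
  have h1 : Z (u ^ 2) u l m = c.sum fun n a =>
      PowerSeries.C (a * schur n (powerSumRho (u ^ 2) u ⊥)) *
        completeSeries (fun k => powerSumRho (u ^ 2) u n k * powerSumRho (u⁻¹ ^ 2) u⁻¹ ⊥ k) := by
    ext d
    rw [Z, PowerSeries.coeff_mk, Finsupp.sum, map_sum]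
    simp only [PowerSeries.coeff_C_mul, coeff_completeSeries]
    have h2 : ∀ n : YoungDiagram, complete (fun k => powerSumRho (u ^ 2) u n k *
        powerSumRho (u⁻¹ ^ 2) u⁻¹ ⊥ k) d = ∑ e ∈ partitionsOf d,
          schur e (powerSumRho (u ^ 2) u n) * schur e (powerSumRho (u⁻¹ ^ 2) u⁻¹ ⊥) := fun n =>
      (cauchy_identity_rho (inv_ne_zero hu) (inv_pow_ne_one hq) _ d).symm
    simp only [h2, Finset.mul_sum]
    rw [Finset.sum_comm]
    refine Finset.sum_congr rfl fun e _ => ?_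
    rw [prod_hook_weight_eq hu hq e, hc, Finsupp.sum, Finset.sum_mul]
    refine Finset.sum_congr rfl fun n _ => ?_
    have := schur_powerSumRho_symm hu hq n e
    linear_combination (c n * schur e (powerSumRho (u⁻¹ ^ 2) u⁻¹ ⊥)) * this
  rw [h1, Finsupp.sum, Finsupp.sum, ← Polynomial.coeToPowerSeries.ringHom_apply, map_sum,
    Finset.sum_mul]
  refine Finset.sum_congr rfl fun n _ => ?_
  rw [completeSeries_powerSumRho hu hq n, Polynomial.coeToPowerSeries.ringHom_apply,
    Polynomial.coe_mul, Polynomial.coe_C]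
  ring

theorem exists_Zinst_eq {u : K} (hu : u ≠ 0) (hq : ∀ n : ℕ, 0 < n → u ^ n ≠ 1)
    (l m : YoungDiagram) (c : YoungDiagram →₀ K)
    (hc : ∀ p : ℕ → K, schur l p * schur m p = c.sum fun n a => a * schur n p) :
    ∃ F : K[X], (F : K⟦X⟧) = Zinst (u ^ 2) u l m ∧ ∀ N : ℕ, F.eval ((u ^ 2) ^ N) =
      c.sum fun n a => a * (framing (u ^ 2) n * schurPoly n (rhoVars u⁻¹ N ⊥)) := by
  -- The polynomial factor of `Z_eq_sum`. The remaining series is `Z` for the empty labels, which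
  -- has constant term 1 and is therefore invertible.
  refine ⟨c.sum fun n a => Polynomial.C (a * schur n (powerSumRho (u ^ 2) u ⊥)) *
    ∏ c ∈ n.cells, (1 - Polynomial.C ((u ^ 2) ^ ((c.2 : ℤ) - c.1)) * Polynomial.X), ?_,
      fun N => ?_⟩
  rotate_left
  · rw [Finsupp.sum, Finsupp.sum, Polynomial.eval_finsetSum]
    refine Finset.sum_congr rfl fun n _ => ?_
    rw [schurPoly_rhoVars_eq (inv_ne_zero hu) (inv_pow_ne_one hq), ← mul_assoc (framing _ _),
      ← schur_powerSumRho_eq_framing_mul hu hq, inv_inv_sq]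
    simp only [Polynomial.eval_mul, Polynomial.eval_C, Polynomial.eval_prod, Polynomial.eval_sub,
      Polynomial.eval_one, Polynomial.eval_X]
    ring
  · have h0 : Z (u ^ 2) u ⊥ ⊥ =
        completeSeries (fun k => powerSumRho (u ^ 2) u ⊥ k * powerSumRho (u⁻¹ ^ 2) u⁻¹ ⊥ k) := by
      rw [Z_eq_sum hu hq ⊥ ⊥ (Finsupp.single ⊥ 1)]
      · simp [schur_bot]
      · intro p
        simp [schur_bot]
    rw [Zinst, Z_eq_sum hu hq l m c hc, h0, mul_assoc, PowerSeries.mul_inv_cancel, mul_one]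
    rw [← PowerSeries.coeff_zero_eq_constantCoeff_apply, coeff_completeSeries, complete_zero]
    exact one_ne_zero

end Rho

/-! ### The Gaussian functional -/

theorem add_choose_two (a b : ℕ) : (a + b).choose 2 = a.choose 2 + b.choose 2 + a * b := by
  induction b with
  | zero => simp
  | succ b ih =>
    rw [← add_assoc, Nat.choose_succ_succ' (a + b) 1, Nat.choose_succ_succ' b 1, ih]
    simp only [Nat.choose_one_right]
    ring

section Gaussian

variable {K : Type*} [Field K] {N : ℕ}

/-- The Gaussian weight of an exponent vector. -/
def gaussWeight (k q : K) (e : Fin N → ℕ) : K := ∏ i, k ^ e i * q ^ (e i).choose 2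

theorem gaussWeight_add (k q : K) (e f : Fin N → ℕ) :
    gaussWeight k q (e + f) = gaussWeight k q e * gaussWeight k q f * ∏ i, q ^ (e i * f i) := by
  simp only [gaussWeight, ← Finset.prod_mul_distrib]
  refine Finset.prod_congr rfl fun i _ => ?_
  rw [Pi.add_apply, add_choose_two]
  ring

theorem gaussWeight_comp_perm (k q : K) (e : Fin N → ℕ) (s : Equiv.Perm (Fin N)) :
    gaussWeight k q (e ∘ s) = gaussWeight k q e :=
  Equiv.prod_comp s fun i => k ^ e i * q ^ (e i).choose 2

theorem gaussWeight_ne_zero {k q : K} (hk : k ≠ 0) (hq : q ≠ 0) (e : Fin N → ℕ) :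
    gaussWeight k q e ≠ 0 :=
  Finset.prod_ne_zero_iff.2 fun _ _ => mul_ne_zero (pow_ne_zero _ hk) (pow_ne_zero _ hq)

/-- The functional that multiplies the monomial `x ^ e` by its Gaussian weight and evaluates at
`x_i = q ^ b_i`. -/
def gaussFunctional (k q : K) (b : Fin N → ℕ) : MvPolynomial (Fin N) K →ₗ[K] K :=
  (MvPolynomial.basisMonomials (Fin N) K).constr K fun e =>
    gaussWeight k q e * ∏ i, q ^ (e i * b i)

theorem gaussFunctional_monomial (k q : K) (b : Fin N → ℕ) (e : Fin N →₀ ℕ) (a : K) :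
    gaussFunctional k q b (MvPolynomial.monomial e a) =
      a * (gaussWeight k q e * ∏ i, q ^ (e i * b i)) := by
  have h1 : MvPolynomial.monomial e a = a • MvPolynomial.basisMonomials (Fin N) K e := by
    rw [MvPolynomial.coe_basisMonomials, MvPolynomial.smul_monomial, smul_eq_mul, mul_one]
  rw [h1, map_smul, gaussFunctional, Module.Basis.constr_basis, smul_eq_mul]

/-- The monomial with exponents given by a function. -/
def mono (e : Fin N → ℕ) : MvPolynomial (Fin N) K :=
  MvPolynomial.monomial (Finsupp.equivFunOnFinite.symm e) 1

theorem mono_eq_prod (e : Fin N → ℕ) : (mono e : MvPolynomial (Fin N) K) =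
    ∏ i, MvPolynomial.X i ^ e i := by
  rw [mono, MvPolynomial.monomial_eq, MvPolynomial.C_1, one_mul, Finsupp.prod_fintype]
  · rfl
  · intro i
    exact pow_zero _

theorem gaussFunctional_rename (k q : K) (b : Fin N → ℕ) (s : Equiv.Perm (Fin N))
    (P : MvPolynomial (Fin N) K) :
    gaussFunctional k q b (MvPolynomial.rename s P) = gaussFunctional k q (b ∘ s) P := by
  induction P using MvPolynomial.induction_on' with
  | monomial e a =>
    rw [MvPolynomial.rename_monomial, gaussFunctional_monomial, gaussFunctional_monomial]
    have h1 : ∀ i, Finsupp.mapDomain s e (s i) = e i := fun i =>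
      Finsupp.mapDomain_apply s.injective e i
    congr 1
    unfold gaussWeight
    rw [← Finset.prod_mul_distrib, ← Finset.prod_mul_distrib, ← Equiv.prod_comp s]
    simp only [h1, Function.comp_apply]
  | add p r hp hr => rw [map_add, map_add, map_add, hp, hr]

/-- On a monomial x^e, both sides are the product of the weights of a, b, e times q^{a·b + a·e +
b·e}, because binom(a + e, 2) has cross term a·e. -/
theorem gaussFunctional_mono_mul (k q : K) (a b : Fin N → ℕ) (P : MvPolynomial (Fin N) K) :
    gaussWeight k q b * gaussFunctional k q b (mono a * P) =
      gaussWeight k q a * gaussFunctional k q a (mono b * P) := by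
  induction P using MvPolynomial.induction_on' with
  | monomial e c =>
    rw [mono, mono, MvPolynomial.monomial_mul, MvPolynomial.monomial_mul, gaussFunctional_monomial,
      gaussFunctional_monomial, one_mul]
    simp only [Finsupp.coe_add, Finsupp.coe_equivFunOnFinite_symm, gaussWeight_add, Pi.add_apply,
      add_mul, pow_add, Finset.prod_mul_distrib]
    have h1 : ∀ a b : Fin N → ℕ, ∏ i, q ^ (a i * b i) = ∏ i, q ^ (b i * a i) := fun a b =>
      Finset.prod_congr rfl fun i _ => by rw [mul_comm]
    rw [h1 a b, h1 e a, h1 e b]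
    ring
  | add p r hp hr => rw [mul_add, map_add, mul_add, mul_add, map_add, mul_add, hp, hr]

/-- The alternant as a polynomial. -/
def altPoly (a : Fin N → ℕ) : MvPolynomial (Fin N) K := alternant (fun i => MvPolynomial.X i) a

theorem altPoly_eq_sum (a : Fin N → ℕ) : (altPoly a : MvPolynomial (Fin N) K) =
    ∑ s : Equiv.Perm (Fin N), ((Equiv.Perm.sign s : ℤ) : K) • mono (a ∘ s) := by
  rw [altPoly, alternant_eq_sum]
  refine Finset.sum_congr rfl fun s _ => ?_
  rw [mono_eq_prod, MvPolynomial.smul_eq_C_mul]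
  simp

theorem eval_altPoly (x : Fin N → K) (a : Fin N → ℕ) :
    MvPolynomial.eval x (altPoly a) = alternant x a := by
  rw [altPoly, alternant, RingHom.map_det, alternant]
  congr 1
  ext i j
  simp

theorem mono_comp_perm (a : Fin N → ℕ) (s : Equiv.Perm (Fin N)) :
    (mono (a ∘ s) : MvPolynomial (Fin N) K) = MvPolynomial.rename (s⁻¹ : Equiv.Perm (Fin N)) (mono a) := by
  rw [mono_eq_prod, mono_eq_prod, map_prod]
  conv_rhs => rw [← Equiv.prod_comp s]
  refine Finset.prod_congr rfl fun i _ => ?_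
  simp

/-- Antisymmetrization of the exchange rule for monomials: since S is symmetric, a permutation of
the exponents a can be moved to the evaluation point, and then to b. -/
theorem gaussFunctional_altPoly_mul (k q : K) (a b : Fin N → ℕ) (S : MvPolynomial (Fin N) K)
    (hS : ∀ s : Equiv.Perm (Fin N), MvPolynomial.rename s S = S) :
    gaussWeight k q b * gaussFunctional k q b (altPoly a * S) =
      gaussWeight k q a * gaussFunctional k q a (altPoly b * S) := by
  have h1 : ∀ s : Equiv.Perm (Fin N), gaussWeight k q b * gaussFunctional k q b (mono (a ∘ s) * S) =
      gaussWeight k q a * gaussFunctional k q a (mono (b ∘ (s⁻¹ : Equiv.Perm (Fin N))) * S) := by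
    intro s
    have h2 : mono (a ∘ s) * S =
        MvPolynomial.rename (s⁻¹ : Equiv.Perm (Fin N)) (mono a * S) := by
      rw [map_mul, hS, mono_comp_perm]
    rw [h2, gaussFunctional_rename, ← gaussWeight_comp_perm k q b (s⁻¹ : Equiv.Perm (Fin N)),
      gaussFunctional_mono_mul]
  rw [altPoly_eq_sum, altPoly_eq_sum, Finset.sum_mul, Finset.sum_mul, map_sum, map_sum,
    Finset.mul_sum, Finset.mul_sum, ← Equiv.sum_comp (Equiv.inv (Equiv.Perm (Fin N)))]
  refine Finset.sum_congr rfl fun s _ => ?_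
  rw [smul_mul_assoc, smul_mul_assoc, map_smul, map_smul, smul_eq_mul, smul_eq_mul,
    mul_left_comm, h1]
  simp only [Equiv.inv_apply, inv_inv, Equiv.Perm.sign_inv]
  ring

theorem gaussFunctional_altPoly (k q : K) (a b : Fin N → ℕ) :
    gaussFunctional k q b (altPoly a) = gaussWeight k q a * alternant (fun i => q ^ b i) a := by
  rw [altPoly_eq_sum, map_sum, alternant_eq_sum, Finset.mul_sum]
  refine Finset.sum_congr rfl fun s _ => ?_
  rw [map_smul, mono, gaussFunctional_monomial, smul_eq_mul, one_mul,
    Finsupp.coe_equivFunOnFinite_symm, gaussWeight_comp_perm, mul_left_comm]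
  congr 2
  refine Finset.prod_congr rfl fun i _ => ?_
  rw [← pow_mul, mul_comm, Function.comp_apply]

theorem alternant_pow_symm (q : K) (a b : Fin N → ℕ) :
    alternant (fun i => q ^ a i) b = alternant (fun i => q ^ b i) a := by
  rw [alternant, ← Matrix.det_transpose, alternant]
  congr 1
  ext i j
  rw [Matrix.transpose_apply, Matrix.of_apply, Matrix.of_apply, ← pow_mul, ← pow_mul, mul_comm]

theorem schurPoly_comp_perm (l : YoungDiagram) (x : Fin N → K) (s : Equiv.Perm (Fin N)) :
    schurPoly l (x ∘ s) = schurPoly l x := by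
  rw [schurPoly_eq, schurPoly_eq]
  congr 1
  ext k
  exact Equiv.sum_comp s fun i => x i ^ k

variable (K N) in
theorem exists_schur_mvPolynomial (l : YoungDiagram) :
    ∃ S : MvPolynomial (Fin N) K, ∀ x : Fin N → K, MvPolynomial.eval x S = schurPoly l x := by
  obtain ⟨S, hS⟩ := exists_schur_eq (K := K) (A := MvPolynomial (Fin N) K)
    (fun k => ∑ i, MvPolynomial.X i ^ k) l
  refine ⟨S, fun x => ?_⟩
  have := hS (MvPolynomial.aeval x)
  have h : ∀ P, MvPolynomial.aeval x P = MvPolynomial.eval x P := fun P => by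
    rw [MvPolynomial.aeval_eq_eval]
  rw [← h, this, schurPoly_eq]
  congr 1
  ext k
  simp [psum]

/-- The Schur polynomial as a polynomial. -/
def schurMv (l : YoungDiagram) : MvPolynomial (Fin N) K :=
  (exists_schur_mvPolynomial K N l).choose

theorem eval_schurMv (l : YoungDiagram) (x : Fin N → K) :
    MvPolynomial.eval x (schurMv l) = schurPoly l x :=
  (exists_schur_mvPolynomial K N l).choose_spec x

variable [CharZero K]

theorem rename_schurMv (l : YoungDiagram) (s : Equiv.Perm (Fin N)) :
    MvPolynomial.rename s (schurMv l : MvPolynomial (Fin N) K) = schurMv l := by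
  apply MvPolynomial.funext
  intro x
  rw [MvPolynomial.eval_rename, eval_schurMv, eval_schurMv, schurPoly_comp_perm]

theorem schurMv_mul_altPoly (l : YoungDiagram) (h : l.colLen 0 ≤ N) :
    (schurMv l : MvPolynomial (Fin N) K) * altPoly (shifted N ⊥) = altPoly (shifted N l) := by
  apply MvPolynomial.funext
  intro x
  rw [map_mul, eval_schurMv, eval_altPoly, eval_altPoly, schurPoly_mul_alternant l h]

theorem schurMv_eq_zero (l : YoungDiagram) (h : N < l.colLen 0) :
    (schurMv l : MvPolynomial (Fin N) K) = 0 := by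
  apply MvPolynomial.funext
  intro x
  rw [eval_schurMv, schurPoly_eq_zero l h, map_zero]

end Gaussian

/-! ### The framing factor and the contents -/

section Framing

variable {K : Type*} [Field K]

theorem sum_arm_eq (l : YoungDiagram) :
    ∑ c ∈ l.cells, (l.rowLen c.1 - c.2 - 1) = ∑ c ∈ l.cells, c.2 := by
  rw [sum_cells l le_rfl, sum_cells l le_rfl]
  refine Finset.sum_congr rfl fun i _ => ?_
  rw [← Finset.sum_range_reflect (fun j => j)]
  refine Finset.sum_congr rfl fun j _ => ?_
  simp only
  omega

theorem framing_mul {q : K} (hq : q ≠ 0) (l : YoungDiagram) :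
    framing q l * q ^ (∑ c ∈ l.cells, c.1) = (-1) ^ l.card * q ^ (∑ c ∈ l.cells, c.2) := by
  rw [← sum_leg_eq, ← sum_arm_eq, framing, YoungDiagram.card, ← Finset.prod_const,
    ← Finset.prod_pow_eq_pow_sum, ← Finset.prod_pow_eq_pow_sum, ← Finset.prod_mul_distrib,
    ← Finset.prod_mul_distrib]
  refine Finset.prod_congr rfl fun c hc => ?_
  have h7 : c.1 < l.colLen c.2 :=
    YoungDiagram.mem_iff_lt_colLen.1 ((YoungDiagram.mem_cells c).1 hc)
  have h8 : c.2 < l.rowLen c.1 :=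
    YoungDiagram.mem_iff_lt_rowLen.1 ((YoungDiagram.mem_cells c).1 hc)
  rw [neg_mul, neg_one_mul, ← zpow_natCast, ← zpow_natCast, ← zpow_add₀ hq]
  congr 2
  omega

theorem sum_snd_cells (l : YoungDiagram) {N : ℕ} (h : l.colLen 0 ≤ N) :
    ∑ c ∈ l.cells, c.2 = ∑ i : Fin N, (l.rowLen i).choose 2 := by
  rw [sum_cells l h, Finset.sum_range]
  refine Finset.sum_congr rfl fun i _ => ?_
  rw [Finset.sum_range_id, Nat.choose_two_right]

/-- The constant k = -u q^{1-N} is chosen so that, with the cross term q^{(N-1-i) l_i} against the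
staircase, row i contributes (-u)^{l_i} q^{binom(l_i, 2) - i l_i}. -/
theorem gaussWeight_shifted {u : K} (hu : u ≠ 0) (l : YoungDiagram) {N : ℕ} (h : l.colLen 0 ≤ N) :
    gaussWeight (-u * (u ^ 2) ^ (1 - (N : ℤ))) (u ^ 2) (shifted N l) =
      gaussWeight (-u * (u ^ 2) ^ (1 - (N : ℤ))) (u ^ 2) (shifted N ⊥) *
        (framing (u ^ 2) l * u ^ l.card) := by
  have hq : u ^ 2 ≠ 0 := pow_ne_zero 2 hu
  set k := -u * (u ^ 2) ^ (1 - (N : ℤ)) with hk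
  have h1 : shifted N l = shifted N ⊥ + fun i : Fin N => l.rowLen i := by
    ext i
    rw [Pi.add_apply, shifted_bot, shifted, add_comm]
  rw [h1, gaussWeight_add, mul_assoc]
  congr 1
  apply mul_right_cancel₀ (pow_ne_zero (∑ c ∈ l.cells, c.1) hq)
  rw [mul_right_comm (framing _ _), framing_mul hq, sum_fst_cells l h, sum_snd_cells l h,
    card_eq_sum_rowLen_fin l h, gaussWeight]
  simp only [← Finset.prod_pow_eq_pow_sum, ← Finset.prod_mul_distrib]
  refine Finset.prod_congr rfl fun i _ => ?_
  have hi := i.2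
  rw [hk, mul_pow, neg_pow, shifted_bot, ← zpow_natCast ((u ^ 2) ^ (1 - (N : ℤ))) (l.rowLen i), ← zpow_mul,
    ← zpow_natCast (u ^ 2) ((N - 1 - i) * l.rowLen i), ← zpow_natCast (u ^ 2) (i * l.rowLen i)]
  have h2 : (u ^ 2) ^ ((1 - (N : ℤ)) * (l.rowLen i : ℕ)) *
      (u ^ 2) ^ ((((N - 1 - i) * l.rowLen i : ℕ)) : ℤ) *
      (u ^ 2) ^ (((i * l.rowLen i : ℕ)) : ℤ) = 1 := by
    rw [← zpow_add₀ hq, ← zpow_add₀ hq]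
    have : (1 - (N : ℤ)) * (l.rowLen i : ℕ) + (((N - 1 - i) * l.rowLen i : ℕ)) +
        ((i * l.rowLen i : ℕ)) = 0 := by
      push_cast [Nat.cast_sub (show (i : ℕ) ≤ N - 1 by omega),
        Nat.cast_sub (show 1 ≤ N by omega)]
      ring
    rw [this, zpow_zero]
  linear_combination ((-1) ^ l.rowLen i * u ^ l.rowLen i * (u ^ 2) ^ (l.rowLen i).choose 2) * h2

theorem rhoVars_inv_bot {u : K} (N : ℕ) :
    rhoVars u⁻¹ N ⊥ = fun i : Fin N => u ^ (2 * (i : ℕ) + 1) := by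
  ext i
  rw [rhoVars_bot, inv_inv_sq, inv_inv, ← pow_mul, ← pow_succ']

theorem schurPoly_odd_powers {u : K} (hu : u ≠ 0) (l : YoungDiagram) (N : ℕ) :
    schurPoly l (fun i : Fin N => u ^ (2 * (i : ℕ) + 1)) =
      u ^ l.card * schurPoly l (fun i : Fin N => (u ^ 2) ^ shifted N ⊥ i) := by
  rw [← schurPoly_smul l _ hu, ← schurPoly_comp_perm l _ Fin.revPerm]
  congr 1
  ext i
  simp only [Function.comp_apply, Fin.revPerm_apply, Fin.val_rev, shifted_bot]
  rw [← pow_mul, ← pow_succ']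
  congr 1
  omega

theorem schurPoly_shifted {u : K} (hu : u ≠ 0) (l m : YoungDiagram) (N : ℕ) :
    schurPoly m (fun i : Fin N => u ^ (2 * ((l.rowLen i : ℤ) + N - i) - 1)) =
      u ^ m.card * schurPoly m (fun i : Fin N => (u ^ 2) ^ shifted N l i) := by
  rw [← schurPoly_smul m _ hu]
  congr 1
  ext i
  have := i.2
  rw [← pow_mul, ← pow_succ', ← zpow_natCast, shifted]
  congr 1
  omega

variable [CharZero K]

/-- The twist formula for the Hopf link. -/
theorem sum_framing_mul_schurPoly {u : K} (hu : u ≠ 0) (hq : ∀ n : ℕ, 0 < n → u ^ n ≠ 1)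
    (l m : YoungDiagram) (c : YoungDiagram →₀ K)
    (hc : ∀ p : ℕ → K, schur l p * schur m p = c.sum fun n a => a * schur n p) (N : ℕ) :
    (c.sum fun n a => a * (framing (u ^ 2) n * schurPoly n (rhoVars u⁻¹ N ⊥))) =
      framing (u ^ 2) l * framing (u ^ 2) m *
        schurPoly m (fun i : Fin N => u ^ (2 * ((l.rowLen i : ℤ) + N - i) - 1)) *
        schurPoly l (fun i : Fin N => u ^ (2 * (i : ℕ) + 1)) := by
  have hu2 : u ^ 2 ≠ 0 := pow_ne_zero 2 hu
  set k := -u * (u ^ 2) ^ (1 - (N : ℤ)) with hk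
  have hk0 : k ≠ 0 := mul_ne_zero (neg_ne_zero.2 hu) (zpow_ne_zero _ hu2)
  set G := gaussFunctional k (u ^ 2) (shifted N ⊥) with hG
  set w := gaussWeight k (u ^ 2) (shifted N ⊥) with hw
  have hw0 : w ≠ 0 := gaussWeight_ne_zero hk0 hu2 _
  set D := alternant (fun i : Fin N => (u ^ 2) ^ shifted N ⊥ i) (shifted N ⊥) with hD
  have hD0 : D ≠ 0 := alternant_bot_ne_zero fun i j hij =>
    (shifted_strictAnti N ⊥).injective (pow_injective_of_ne_one hu2 (sq_pow_ne_one hq) hij)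
  -- The Gaussian functional diagonalizes the framing: the alternant of n is multiplied by its
  -- framing and evaluated at the staircase powers.
  have h1 : ∀ n : YoungDiagram, G (schurMv n * altPoly (shifted N ⊥)) =
      w * D * (framing (u ^ 2) n * schurPoly n (rhoVars u⁻¹ N ⊥)) := by
    intro n
    rw [rhoVars_inv_bot, schurPoly_odd_powers hu]
    rcases Nat.lt_or_ge N (n.colLen 0) with h | h
    · rw [schurMv_eq_zero n h, schurPoly_eq_zero n h]
      simp
    · rw [schurMv_mul_altPoly n h, hG, gaussFunctional_altPoly, gaussWeight_shifted hu n h,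
        ← schurPoly_mul_alternant n h]
      ring
  have h2 : G (schurMv l * schurMv m * altPoly (shifted N ⊥)) =
      w * D * c.sum fun n a => a * (framing (u ^ 2) n * schurPoly n (rhoVars u⁻¹ N ⊥)) := by
    have h3 : (schurMv l * schurMv m : MvPolynomial (Fin N) K) =
        c.sum fun n a => a • schurMv n := by
      apply MvPolynomial.funext
      intro x
      rw [map_mul, eval_schurMv, eval_schurMv, schurPoly_eq, schurPoly_eq, hc, Finsupp.sum,
        Finsupp.sum, map_sum]
      refine Finset.sum_congr rfl fun n _ => ?_
      rw [MvPolynomial.smul_eval, eval_schurMv, schurPoly_eq]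
    rw [h3, Finsupp.sum, Finsupp.sum, Finset.sum_mul, map_sum, Finset.mul_sum]
    refine Finset.sum_congr rfl fun n _ => ?_
    rw [smul_mul_assoc, map_smul, h1, smul_eq_mul]
    ring
  apply mul_left_cancel₀ (mul_ne_zero hw0 hD0)
  rw [← h2, schurPoly_odd_powers hu, schurPoly_shifted hu]
  rcases Nat.lt_or_ge N (l.colLen 0) with hl | hl
  · rw [schurMv_eq_zero l hl, schurPoly_eq_zero l hl]
    simp
  rcases Nat.lt_or_ge N (m.colLen 0) with hm | hm
  · rw [schurMv_eq_zero m hm, schurPoly_eq_zero m hm]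
    simp
  -- The exchange between the exponents of l and the staircase, with s_m as symmetric factor. On the
  -- other side s_m is absorbed by the staircase alternant, leaving one alternant evaluated at
  -- q^{l+δ}.
  have h4 := gaussFunctional_altPoly_mul k (u ^ 2) (shifted N l) (shifted N ⊥) (schurMv m)
    (rename_schurMv m)
  rw [mul_comm (altPoly (shifted N ⊥)), schurMv_mul_altPoly m hm, gaussFunctional_altPoly,
    gaussWeight_shifted hu l hl, gaussWeight_shifted hu m hm, ← schurMv_mul_altPoly l hl,
    ← schurPoly_mul_alternant m hm, alternant_pow_symm, ← schurPoly_mul_alternant l hl] at h4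
  apply mul_left_cancel₀ hw0
  rw [mul_right_comm (schurMv l), h4]
  ring

end Framing

/-- Non-negativity of the coefficients of the evaluation. -/
theorem exists_nat_polynomial (l m : YoungDiagram) (N : ℕ) :
    ∃ P : ℕ[X], ∀ (K : Type*) [Field K] [CharZero K] (u : K), u ≠ 0 →
      (-1) ^ (l.card + m.card) * (framing (u ^ 2) l * framing (u ^ 2) m *
        schurPoly m (fun i : Fin N => u ^ (2 * ((l.rowLen i : ℤ) + N - i) - 1)) *
        schurPoly l (fun i : Fin N => u ^ (2 * (i : ℕ) + 1))) =
      u ^ (l.card + m.card) * Polynomial.aeval (u ^ 2) P := by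
  -- In reversed order the exponent of variable i is at least i, as `exists_schurPoly_pow_eq`
  -- requires.
  have hge : ∀ (e : YoungDiagram) (i : Fin N), (i : ℕ) ≤ shifted N e (Fin.revPerm i) := by
    intro e i
    rw [Fin.revPerm_apply, shifted, Fin.val_rev]
    omega
  obtain ⟨P1, h1⟩ := exists_schurPoly_pow_eq N _ (hge l) m
  obtain ⟨P2, h2⟩ := exists_schurPoly_pow_eq N _ (hge ⊥) l
  -- Each framing is a sign times q^{∑ c.2 - ∑ c.1}. The powers q^{∑ c.1} supplied by the Schur
  -- polynomials cancel the negative part.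
  refine ⟨Polynomial.X ^ (∑ c ∈ l.cells, c.2) * Polynomial.X ^ (∑ c ∈ m.cells, c.2) * P1 * P2,
    fun K _ _ u hu => ?_⟩
  have hu2 : u ^ 2 ≠ 0 := pow_ne_zero 2 hu
  rw [schurPoly_odd_powers hu, schurPoly_shifted hu, ← schurPoly_comp_perm m _ Fin.revPerm,
    ← schurPoly_comp_perm l _ Fin.revPerm]
  have h3 := h1 K (u ^ 2)
  have h4 := h2 K (u ^ 2)
  have h5 := framing_mul hu2 l
  have h6 := framing_mul hu2 m
  have e : ∀ e : YoungDiagram, ((fun i : Fin N => (u ^ 2) ^ shifted N e i) ∘ Fin.revPerm) =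
    fun i => (u ^ 2) ^ shifted N e (Fin.revPerm i) := fun _ => rfl
  rw [e, e, h3, h4]
  simp only [map_mul, map_pow, Polynomial.aeval_X]
  have h7 : ((-1 : K)) ^ l.card * (-1) ^ l.card = 1 := by rw [← mul_pow]; simp
  have h8 : ((-1 : K)) ^ m.card * (-1) ^ m.card = 1 := by rw [← mul_pow]; simp
  set a1 := Polynomial.aeval (u ^ 2) P1
  set a2 := Polynomial.aeval (u ^ 2) P2
  calc _ = (-1) ^ l.card * (-1) ^ m.card *
        (framing (u ^ 2) l * (u ^ 2) ^ (∑ c ∈ l.cells, c.1)) *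
        (framing (u ^ 2) m * (u ^ 2) ^ (∑ c ∈ m.cells, c.1)) *
        (u ^ (l.card + m.card) * (a1 * a2)) := by ring
    _ = ((-1 : K) ^ l.card * (-1) ^ l.card) * ((-1) ^ m.card * (-1) ^ m.card) *
        (u ^ (l.card + m.card) * ((u ^ 2) ^ (∑ c ∈ l.cells, c.2) *
          (u ^ 2) ^ (∑ c ∈ m.cells, c.2) * a1 * a2)) := by rw [h5, h6]; ring
    _ = _ := by rw [h7, h8, one_mul, one_mul]

/-! ### Positive braids -/

section Braid

variable {M : Type*} [Monoid M]

/-- The product `T_{a+n-1} ⋯ T_a`. -/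
def desc (T : ℕ → M) (a : ℕ) : ℕ → M
  | 0 => 1
  | n + 1 => T (a + n) * desc T a n

/-- The product `T_a ⋯ T_{a+n-1}`. -/
def asc (T : ℕ → M) (a : ℕ) : ℕ → M
  | 0 => 1
  | n + 1 => asc T a n * T (a + n)

/-- The braid in which `n` strands cross `m` strands. -/
def cross (T : ℕ → M) (n : ℕ) : ℕ → M
  | 0 => 1
  | m + 1 => cross T n m * desc T m n

/-- The Jucys-Murphy braid. -/
def murphy (T : ℕ → M) (a n : ℕ) : M := desc T a n * asc T a n

theorem desc_zero (T : ℕ → M) (a : ℕ) : desc T a 0 = 1 := rfl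

theorem desc_succ (T : ℕ → M) (a n : ℕ) : desc T a (n + 1) = T (a + n) * desc T a n := rfl

theorem asc_succ (T : ℕ → M) (a n : ℕ) : asc T a (n + 1) = asc T a n * T (a + n) := rfl

theorem cross_succ (T : ℕ → M) (n m : ℕ) : cross T n (m + 1) = cross T n m * desc T m n := rfl

theorem murphy_zero (T : ℕ → M) (a : ℕ) : murphy T a 0 = 1 := mul_one _

theorem murphy_succ (T : ℕ → M) (a n : ℕ) :
    murphy T a (n + 1) = T (a + n) * murphy T a n * T (a + n) := by
  rw [murphy, desc_succ, asc_succ, murphy]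
  simp only [mul_assoc]

theorem map_desc {M' F : Type*} [Monoid M'] [FunLike F M M'] [MonoidHomClass F M M'] (φ : F)
    (T : ℕ → M) (a n : ℕ) : φ (desc T a n) = desc (fun i => φ (T i)) a n := by
  induction n with
  | zero => exact map_one φ
  | succ n ih => rw [desc_succ, map_mul, ih]; rfl

theorem map_asc {M' F : Type*} [Monoid M'] [FunLike F M M'] [MonoidHomClass F M M'] (φ : F)
    (T : ℕ → M) (a n : ℕ) : φ (asc T a n) = asc (fun i => φ (T i)) a n := by
  induction n with
  | zero => exact map_one φ
  | succ n ih => rw [asc_succ, map_mul, ih]; rfl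

theorem map_murphy {M' F : Type*} [Monoid M'] [FunLike F M M'] [MonoidHomClass F M M'] (φ : F)
    (T : ℕ → M) (a n : ℕ) : φ (murphy T a n) = murphy (fun i => φ (T i)) a n := by
  rw [murphy, map_mul, map_desc, map_asc]; rfl

theorem desc_congr {T T' : ℕ → M} {a a' n : ℕ} (h : ∀ i < n, T (a + i) = T' (a' + i)) :
    desc T a n = desc T' a' n := by
  induction n with
  | zero => rfl
  | succ n ih =>
    rw [desc_succ, desc_succ, h n n.lt_succ_self, ih fun i hi => h i (hi.trans n.lt_succ_self)]

theorem asc_congr {T T' : ℕ → M} {a a' n : ℕ} (h : ∀ i < n, T (a + i) = T' (a' + i)) :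
    asc T a n = asc T' a' n := by
  induction n with
  | zero => rfl
  | succ n ih =>
    rw [asc_succ, asc_succ, h n n.lt_succ_self, ih fun i hi => h i (hi.trans n.lt_succ_self)]

theorem commute_desc {T : ℕ → M} {x : M} {a n : ℕ} (h : ∀ i < n, Commute x (T (a + i))) :
    Commute x (desc T a n) := by
  induction n with
  | zero => exact Commute.one_right x
  | succ n ih =>
    exact (h n n.lt_succ_self).mul_right (ih fun i hi => h i (hi.trans n.lt_succ_self))

theorem commute_asc {T : ℕ → M} {x : M} {a n : ℕ} (h : ∀ i < n, Commute x (T (a + i))) :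
    Commute x (asc T a n) := by
  induction n with
  | zero => exact Commute.one_right x
  | succ n ih =>
    exact (ih fun i hi => h i (hi.trans n.lt_succ_self)).mul_right (h n n.lt_succ_self)

theorem commute_cross {T : ℕ → M} {x : M} {n m : ℕ} (h : ∀ i, i + 1 < n + m → Commute x (T i)) :
    Commute x (cross T n m) := by
  induction m with
  | zero => exact Commute.one_right x
  | succ m ih =>
    exact (ih fun i hi => h i (by omega)).mul_right
      (commute_desc fun i hi => h (m + i) (by omega))

/-- The braid relations on `k` strands. -/
structure IsBraided (T : ℕ → M) (k : ℕ) : Prop where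
  comm : ∀ i j, i + 2 ≤ j → Commute (T i) (T j)
  braid : ∀ i, i + 2 < k → T i * T (i + 1) * T i = T (i + 1) * T i * T (i + 1)

variable {T : ℕ → M} {k : ℕ}

/-- A crossing slides through a strand that passes over its two strands; the positions shift by one.
-/
theorem IsBraided.mul_desc (h : IsBraided T k) {a i n : ℕ} (hi : i + 1 < n) (hk : a + n < k) :
    T (a + i) * desc T a n = desc T a n * T (a + i + 1) := by
  induction n with
  | zero => omega
  | succ n ih =>
    rcases Nat.lt_or_ge (i + 1) n with h1 | h1
    · rw [desc_succ, ← mul_assoc, (h.comm (a + i) (a + n) (by omega)).eq, mul_assoc,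
        ih h1 (by omega), mul_assoc]
    · obtain rfl : n = i + 1 := by omega
      rw [desc_succ, desc_succ, ← add_assoc, ← mul_assoc, ← mul_assoc, h.braid (a + i) (by omega),
        mul_assoc, mul_assoc, mul_assoc]
      have := commute_desc (T := T) (x := T (a + i + 1)) (a := a) (n := i)
        fun j hj => (h.comm (a + j) (a + i + 1) (by omega)).symm
      rw [this.eq, mul_assoc]

theorem IsBraided.mul_asc (h : IsBraided T k) {a i n : ℕ} (hi : i + 1 < n) (hk : a + n < k) :
    T (a + i + 1) * asc T a n = asc T a n * T (a + i) := by
  induction n with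
  | zero => omega
  | succ n ih =>
    rcases Nat.lt_or_ge (i + 1) n with h1 | h1
    · rw [asc_succ, ← mul_assoc, ih h1 (by omega), mul_assoc,
        (h.comm (a + i) (a + n) (by omega)).eq, mul_assoc]
    · obtain rfl : n = i + 1 := by omega
      have := commute_asc (T := T) (x := T (a + i + 1)) (a := a) (n := i)
        fun j hj => (h.comm (a + j) (a + i + 1) (by omega)).symm
      rw [asc_succ, asc_succ, ← add_assoc, ← mul_assoc, ← mul_assoc, this.eq,
        mul_assoc (asc T a i), mul_assoc (asc T a i), ← h.braid (a + i) (by omega)]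
      simp only [mul_assoc]

/-- The braid relation in palindromic form, by applying it to the three innermost letters and moving
the outer ones past by far commutativity. Read in blocks it becomes `passBlock_exchange`. -/
theorem IsBraided.asc_mul_desc (h : IsBraided T k) {a n : ℕ} (hk : a + n + 1 < k) :
    asc T a n * T (a + n) * desc T a n = desc T (a + 1) n * T a * asc T (a + 1) n := by
  induction n with
  | zero => simp [asc, desc]
  | succ n ih =>
    have h1 : Commute (T (a + n + 1)) (asc T a n) :=
      commute_asc fun j hj => (h.comm (a + j) (a + n + 1) (by omega)).symm
    have h2 : Commute (T (a + n + 1)) (desc T a n) :=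
      commute_desc fun j hj => (h.comm (a + j) (a + n + 1) (by omega)).symm
    calc asc T a (n + 1) * T (a + (n + 1)) * desc T a (n + 1)
        = asc T a n * (T (a + n) * T (a + n + 1) * T (a + n)) * desc T a n := by
          rw [asc_succ, desc_succ]; simp only [mul_assoc]; rfl
      _ = (asc T a n * T (a + n + 1)) * T (a + n) * (T (a + n + 1) * desc T a n) := by
          rw [h.braid (a + n) (by omega)]; simp only [mul_assoc]
      _ = T (a + n + 1) * (asc T a n * T (a + n) * desc T a n) * T (a + n + 1) := by
          rw [← h1.eq, h2.eq]; simp only [mul_assoc]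
      _ = _ := by
          rw [ih (by omega), desc_succ, asc_succ, Nat.add_right_comm a 1 n]
          simp only [mul_assoc]

/-- `cross` is built by enlarging the second cable; this is the recursion in the first one. -/
theorem IsBraided.cross_succ_left (h : IsBraided T k) (n m : ℕ) :
    cross T (n + 1) m = asc T n m * cross T n m := by
  induction m with
  | zero => exact (mul_one _).symm
  | succ m ih =>
    have h1 : Commute (T (n + m)) (cross T n m) :=
      commute_cross fun i hi => (h.comm i (n + m) (by omega)).symm
    rw [cross_succ, ih, desc_succ, cross_succ, asc_succ, mul_assoc, ← mul_assoc (cross T n m),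
      add_comm m n, ← h1.eq]
    simp only [mul_assoc]

theorem IsBraided.mul_cross_left (h : IsBraided T k) {i n m : ℕ} (hi : i + 1 < n)
    (hk : n + m ≤ k) : T i * cross T n m = cross T n m * T (i + m) := by
  induction m with
  | zero => simp [cross]
  | succ m ih =>
    rw [cross_succ, ← mul_assoc, ih (by omega), mul_assoc, add_comm i m,
      h.mul_desc hi (by omega), mul_assoc]
    congr 3
    omega

theorem IsBraided.mul_cross_right (h : IsBraided T k) {j n m : ℕ} (hj : j + 1 < m)
    (hk : n + m ≤ k) : T (n + j) * cross T n m = cross T n m * T j := by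
  induction n with
  | zero =>
    have : ∀ m, cross T 0 m = 1 := fun m => by
      induction m with
      | zero => rfl
      | succ m ih => rw [cross_succ, ih, desc_zero, mul_one]
    rw [this, zero_add, one_mul, mul_one]
  | succ n ih =>
    rw [h.cross_succ_left, ← mul_assoc, Nat.add_right_comm, h.mul_asc hj (by omega), mul_assoc,
      ih (by omega), mul_assoc]

theorem IsBraided.commute_murphy (h : IsBraided T k) {a i n : ℕ} (hi : i + 1 < n) (hk : a + n < k) :
    Commute (T (a + i)) (murphy T a n) := by
  rw [Commute, SemiconjBy, murphy, ← mul_assoc, h.mul_desc hi hk, mul_assoc, h.mul_asc hi hk,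
    mul_assoc]

end Braid

/-! ### The R-matrix representation of the braid group -/

section RMatrix

variable {K : Type*} [Field K]

/-- The off-diagonal entries of the R-matrix. -/
def rOff (u : K) {N : ℕ} (p m : Fin N) : K := if p = m then u else 1

/-- The diagonal entries of the R-matrix. -/
def rDiag (u : K) {N : ℕ} (p m : Fin N) : K := if m < p then u - u⁻¹ else 0

theorem rOff_comm (u : K) {N : ℕ} (p m : Fin N) : rOff u p m = rOff u m p := by
  simp only [rOff, eq_comm]

theorem rDiag_self (u : K) {N : ℕ} (p : Fin N) : rDiag u p p = 0 := by simp [rDiag]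

theorem comp_swap_eq {n N : ℕ} {f g : Fin n → Fin N} {a b : Fin n} :
    f = g ∘ Equiv.swap a b ↔ g = f ∘ Equiv.swap a b := by
  constructor
  · rintro rfl
    ext x
    simp
  · rintro rfl
    ext x
    simp

theorem comp_swap_self {n N : ℕ} {f : Fin n → Fin N} {a b : Fin n} (h : f a = f b) :
    f ∘ Equiv.swap a b = f := by
  ext x
  rw [Function.comp_apply, Equiv.swap_apply_def]
  split_ifs with h1 h2
  · rw [h1, h]
  · rw [h2, h]
  · rfl

variable (u : K) (N : ℕ)

theorem braidGen_apply {n i : ℕ} (h : i + 1 < n) (f g : Fin n → Fin N) :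
    braidGen u N n i f g =
      (if f = g ∘ Equiv.swap ⟨i, by omega⟩ ⟨i + 1, h⟩ then
        rOff u (g ⟨i, by omega⟩) (g ⟨i + 1, h⟩) else 0) +
      if f = g then rDiag u (g ⟨i, by omega⟩) (g ⟨i + 1, h⟩) else 0 := by
  rw [braidGen, dif_pos h]
  simp only [Matrix.of_apply]
  by_cases h1 : f = g
  · subst h1
    by_cases h2 : f ⟨i, by omega⟩ = f ⟨i + 1, h⟩
    · rw [comp_swap_self h2, if_pos rfl, if_pos rfl, if_pos rfl, if_pos h2, h2, rDiag_self,
        rOff, if_pos rfl, add_zero]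
    · have h3 : f ≠ f ∘ Equiv.swap ⟨i, by omega⟩ ⟨i + 1, h⟩ := fun h4 => h2 (by
        have := congrFun h4 ⟨i, by omega⟩
        rwa [Function.comp_apply, Equiv.swap_apply_left] at this)
      rw [if_neg h3, if_neg h3, if_pos rfl, zero_add, rDiag]
      simp only [true_and]
  · simp only [h1, false_and, if_false, add_zero, rOff]

theorem braidGen_of_le {n i : ℕ} (h : n ≤ i + 1) : braidGen u N n i = 1 := by
  rw [braidGen, dif_neg (by omega)]

theorem braidGen_mul_apply {n i : ℕ} (h : i + 1 < n) (M : TensorEnd K N n) (f g : Fin n → Fin N) :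
    (braidGen u N n i * M) f g =
      rOff u (f ⟨i, by omega⟩) (f ⟨i + 1, h⟩) * M (f ∘ Equiv.swap ⟨i, by omega⟩ ⟨i + 1, h⟩) g +
        rDiag u (f ⟨i, by omega⟩) (f ⟨i + 1, h⟩) * M f g := by
  rw [Matrix.mul_apply]
  simp only [braidGen_apply u N h, add_mul, Finset.sum_add_distrib, ite_mul, zero_mul]
  congr 1
  · simp only [comp_swap_eq (f := f)]
    rw [Finset.sum_ite_eq' Finset.univ, if_pos (Finset.mem_univ _)]
    simp only [Function.comp_apply, Equiv.swap_apply_left, Equiv.swap_apply_right]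
    rw [rOff_comm]
  · rw [Finset.sum_ite_eq Finset.univ, if_pos (Finset.mem_univ _)]

theorem mul_braidGen_apply {n i : ℕ} (h : i + 1 < n) (M : TensorEnd K N n) (f g : Fin n → Fin N) :
    (M * braidGen u N n i) f g =
      rOff u (g ⟨i, by omega⟩) (g ⟨i + 1, h⟩) * M f (g ∘ Equiv.swap ⟨i, by omega⟩ ⟨i + 1, h⟩) +
        rDiag u (g ⟨i, by omega⟩) (g ⟨i + 1, h⟩) * M f g := by
  rw [Matrix.mul_apply]
  simp only [braidGen_apply u N h, mul_add, Finset.sum_add_distrib, mul_ite, mul_zero]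
  congr 1
  · rw [Finset.sum_ite_eq' Finset.univ, if_pos (Finset.mem_univ _), mul_comm]
  · rw [Finset.sum_ite_eq' Finset.univ, if_pos (Finset.mem_univ _), mul_comm]

theorem braidGen_transpose (n i : ℕ) : (braidGen u N n i).transpose = braidGen u N n i := by
  rcases Nat.lt_or_ge (i + 1) n with h | h
  · ext f g
    rw [Matrix.transpose_apply, braidGen_apply u N h, braidGen_apply u N h]
    congr 1
    · by_cases h1 : f = g ∘ Equiv.swap ⟨i, by omega⟩ ⟨i + 1, h⟩
      · rw [if_pos h1, if_pos (comp_swap_eq.1 h1), h1]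
        simp only [Function.comp_apply, Equiv.swap_apply_left, Equiv.swap_apply_right]
        rw [rOff_comm]
      · rw [if_neg h1, if_neg fun h2 => h1 (comp_swap_eq.1 h2)]
    · by_cases h1 : f = g
      · rw [h1]
      · rw [if_neg h1, if_neg (Ne.symm h1)]
  · rw [braidGen_of_le u N h, Matrix.transpose_one]

theorem commute_braidGen (n : ℕ) {i j : ℕ} (hij : i + 2 ≤ j) :
    Commute (braidGen u N n i) (braidGen u N n j) := by
  rcases Nat.lt_or_ge (j + 1) n with h | h
  · have hi : i + 1 < n := by omega
    have h0 : (⟨i, by omega⟩ : Fin n) ≠ ⟨j, by omega⟩ := by simp; omega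
    have h1 : (⟨i, by omega⟩ : Fin n) ≠ ⟨j + 1, h⟩ := by simp; omega
    have h2 : (⟨i + 1, hi⟩ : Fin n) ≠ ⟨j, by omega⟩ := by simp; omega
    have h3 : (⟨i + 1, hi⟩ : Fin n) ≠ ⟨j + 1, h⟩ := by simp; omega
    have hc : Equiv.swap (⟨i, by omega⟩ : Fin n) ⟨i + 1, hi⟩ *
        Equiv.swap (⟨j, by omega⟩ : Fin n) ⟨j + 1, h⟩ =
        Equiv.swap (⟨j, by omega⟩ : Fin n) ⟨j + 1, h⟩ *
        Equiv.swap (⟨i, by omega⟩ : Fin n) ⟨i + 1, hi⟩ := by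
      refine (Equiv.Perm.Disjoint.commute fun y => ?_).eq
      by_cases hy : y = ⟨i, by omega⟩ ∨ y = ⟨i + 1, hi⟩
      · right
        rcases hy with rfl | rfl
        · exact Equiv.swap_apply_of_ne_of_ne h0 h1
        · exact Equiv.swap_apply_of_ne_of_ne h2 h3
      · left
        push Not at hy
        exact Equiv.swap_apply_of_ne_of_ne hy.1 hy.2
    ext f g
    rw [← mul_one (braidGen u N n i * braidGen u N n j),
      ← mul_one (braidGen u N n j * braidGen u N n i), mul_assoc, mul_assoc]
    -- A column of the identity matrix, kept abstract. Operators now act on an arbitrary function V,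
    -- and only its values at permuted index tuples occur.
    obtain ⟨V, hV⟩ : ∃ V : (Fin n → Fin N) → K, ∀ f, (1 : TensorEnd K N n) f g = V f :=
      ⟨_, fun _ => rfl⟩
    simp only [braidGen_mul_apply u N hi, braidGen_mul_apply u N h, hV]
    have e2 : (f ∘ Equiv.swap (⟨i, by omega⟩ : Fin n) ⟨i + 1, hi⟩) ∘
        Equiv.swap (⟨j, by omega⟩ : Fin n) ⟨j + 1, h⟩ =
        (f ∘ Equiv.swap (⟨j, by omega⟩ : Fin n) ⟨j + 1, h⟩) ∘
        Equiv.swap (⟨i, by omega⟩ : Fin n) ⟨i + 1, hi⟩ := by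
      rw [Function.comp_assoc, Function.comp_assoc, ← Equiv.Perm.coe_mul, ← Equiv.Perm.coe_mul, hc]
    simp only [e2, Function.comp_apply, Equiv.swap_apply_of_ne_of_ne h0.symm h2.symm,
      Equiv.swap_apply_of_ne_of_ne h1.symm h3.symm, Equiv.swap_apply_of_ne_of_ne h0 h1,
      Equiv.swap_apply_of_ne_of_ne h2 h3]
    ring
  · rw [braidGen_of_le u N h]
    exact Commute.one_right _

variable {u}

/-- The Yang-Baxter equation in coordinates. -/
theorem yangBaxter_aux (hu : u ≠ 0) {N : ℕ} (p q r : Fin N) (v v1 v2 v12 v21 v121 : K)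
    (h1 : p = q → v1 = v ∧ v12 = v2 ∧ v121 = v21) (h2 : q = r → v2 = v ∧ v21 = v1 ∧ v121 = v12)
    (h3 : p = r → v121 = v ∧ v12 = v1 ∧ v21 = v2) :
    rOff u p q * (rOff u p r * (rOff u q r * v121 + rDiag u q r * v12) +
        rDiag u p r * (rOff u q p * v + rDiag u q p * v1)) +
      rDiag u p q * (rOff u q r * (rOff u p r * v21 + rDiag u p r * v2) +
        rDiag u q r * (rOff u p q * v1 + rDiag u p q * v)) =
    rOff u q r * (rOff u p r * (rOff u p q * v121 + rDiag u p q * v21) +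
        rDiag u p r * (rOff u r q * v + rDiag u r q * v2)) +
      rDiag u q r * (rOff u p q * (rOff u p r * v12 + rDiag u p r * v1) +
        rDiag u p q * (rOff u q r * v2 + rDiag u q r * v)) := by
  -- All weak orderings of the three labels. When labels coincide, permuted tuples coincide too, and
  -- h1, h2, h3 identify the corresponding values.
  rcases lt_trichotomy p q with h | rfl | h
  · rcases lt_trichotomy q r with h' | rfl | h'
    · simp [rOff, rDiag, h.ne, h'.ne, (h.trans h').ne, h.not_gt,
        h'.not_gt, (h.trans h').not_gt, h, h', h.ne', h'.ne']
    · obtain ⟨rfl, rfl, rfl⟩ := h2 rfl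
      simp [rOff, rDiag, h.ne, h.not_gt]
    · rcases lt_trichotomy p r with h'' | rfl | h''
      · simp [rOff, rDiag, h.ne, h'.ne, h'.ne', h''.ne, h.not_gt, h', h'.not_gt, h''.not_gt]
      · obtain ⟨rfl, rfl, rfl⟩ := h3 rfl
        simp [rOff, rDiag, h.ne, h'.ne', h', h'.not_gt]
        ring
      · simp [rOff, rDiag, h.ne, h'.ne, h'.ne', h''.ne', h, h.ne', h.not_gt, h', h'.not_gt, h'']
        ring
  · obtain ⟨rfl, rfl, rfl⟩ := h1 rfl
    rcases lt_trichotomy p r with h' | rfl | h'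
    · simp [rOff, rDiag, h'.ne, h'.ne', h', h'.not_gt]
    · simp [rOff, rDiag]
    · simp [rOff, rDiag, h'.ne, h'.ne', h', h'.not_gt]
      field_simp
      ring
  · rcases lt_trichotomy q r with h' | rfl | h'
    · rcases lt_trichotomy p r with h'' | rfl | h''
      · simp [rOff, rDiag, h.ne', h'.ne, h'.ne', h''.ne, h, h.not_gt, h', h'.not_gt, h''.not_gt]
      · obtain ⟨rfl, rfl, rfl⟩ := h3 rfl
        simp [rOff, rDiag, h.ne, h.ne', h, h.not_gt]
        ring
      · simp [rOff, rDiag, h.ne', h'.ne, h'.ne', h''.ne', h, h.ne, h.not_gt, h', h'.not_gt, h'']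
        ring
    · obtain ⟨rfl, rfl, rfl⟩ := h2 rfl
      simp [rOff, rDiag, h.ne', h, h.ne, h.not_gt]
      field_simp
      ring
    · simp [rOff, rDiag, h.ne', h'.ne, h'.ne', (h'.trans h).ne', h, h.ne, h.not_gt, h',
        h'.not_gt, h'.trans h]
      ring

theorem braidGen_braid (hu : u ≠ 0) (n : ℕ) {i : ℕ} (hi : i + 2 < n) :
    braidGen u N n i * braidGen u N n (i + 1) * braidGen u N n i =
      braidGen u N n (i + 1) * braidGen u N n i * braidGen u N n (i + 1) := by
  have hi1 : i + 1 < n := by omega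
  have hi2 : i + 1 + 1 < n := hi
  set a : Fin n := ⟨i, by omega⟩ with ha
  set b : Fin n := ⟨i + 1, hi1⟩ with hb
  set c : Fin n := ⟨i + 1 + 1, hi⟩ with hc
  have hab : a ≠ b := by simp [ha, hb]
  have hac : a ≠ c := by simp [ha, hc]; omega
  have hbc : b ≠ c := by simp [hb, hc]
  ext f g
  rw [← mul_one (braidGen u N n i * braidGen u N n (i + 1) * braidGen u N n i),
    ← mul_one (braidGen u N n (i + 1) * braidGen u N n i * braidGen u N n (i + 1))]
  simp only [mul_assoc]
  obtain ⟨V, hV⟩ : ∃ V : (Fin n → Fin N) → K, ∀ f, (1 : TensorEnd K N n) f g = V f :=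
    ⟨_, fun _ => rfl⟩
  simp only [braidGen_mul_apply u N hi1, braidGen_mul_apply u N hi2, ← ha, ← hb, ← hc, hV]
  have s1 : ∀ f : Fin n → Fin N, (f ∘ Equiv.swap a b) ∘ Equiv.swap a b = f := fun f => by
    ext; simp
  have s2 : ∀ f : Fin n → Fin N, (f ∘ Equiv.swap b c) ∘ Equiv.swap b c = f := fun f => by
    ext; simp
  have s3 : ((f ∘ Equiv.swap b c) ∘ Equiv.swap a b) ∘ Equiv.swap b c =
      ((f ∘ Equiv.swap a b) ∘ Equiv.swap b c) ∘ Equiv.swap a b := by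
    simp only [Function.comp_assoc, ← Equiv.Perm.coe_mul]
    congr 2
    rw [Equiv.swap_mul_swap_mul_swap hab hac]
    rw [Equiv.swap_comm b c, Equiv.swap_comm a b, Equiv.swap_mul_swap_mul_swap hbc.symm hac.symm,
      Equiv.swap_comm]
  simp only [s1, s2, s3, Function.comp_apply, Equiv.swap_apply_left, Equiv.swap_apply_right,
    Equiv.swap_apply_of_ne_of_ne hac.symm hbc.symm, Equiv.swap_apply_of_ne_of_ne hab hac]
  refine yangBaxter_aux hu (f a) (f b) (f c) _ _ _ _ _ _ (fun h => ?_) (fun h => ?_) fun h => ?_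
  · rw [← s3, comp_swap_self h]
    refine ⟨rfl, rfl, ?_⟩
    rw [s3, comp_swap_self h]
  · rw [comp_swap_self h]
    refine ⟨rfl, rfl, ?_⟩
    rw [← s3, comp_swap_self h]
  · have e1 : (f ∘ Equiv.swap a b) ∘ Equiv.swap b c = f ∘ Equiv.swap a b := by
      apply comp_swap_self
      simp [Equiv.swap_apply_of_ne_of_ne hac.symm hbc.symm, h]
    have e2 : (f ∘ Equiv.swap b c) ∘ Equiv.swap a b = f ∘ Equiv.swap b c := by
      apply comp_swap_self
      simp [Equiv.swap_apply_of_ne_of_ne hab hac, h]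
    rw [e1, e2, s1]
    exact ⟨rfl, rfl, rfl⟩

theorem isBraided_braidGen (hu : u ≠ 0) (n : ℕ) : IsBraided (braidGen u N n) n :=
  ⟨fun _ _ h => commute_braidGen u N n h, fun _ h => braidGen_braid N hu n h⟩

end RMatrix

/-! ### Adding a strand -/

section Strand

variable {N n : ℕ}

/-- Appending an index. -/
def snocFun (f : Fin n → Fin N) (a : Fin N) : Fin (n + 1) → Fin N :=
  Fin.snoc (α := fun _ => Fin N) f a

/-- Prepending an index. -/
def consFun (a : Fin N) (f : Fin n → Fin N) : Fin (n + 1) → Fin N :=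
  Fin.cons (α := fun _ => Fin N) a f

theorem snocFun_castSucc (f : Fin n → Fin N) (a : Fin N) (i : Fin n) :
    snocFun f a i.castSucc = f i := Fin.snoc_castSucc (α := fun _ => Fin N) ..

theorem snocFun_last (f : Fin n → Fin N) (a : Fin N) : snocFun f a (Fin.last n) = a :=
  Fin.snoc_last (α := fun _ => Fin N) ..

theorem consFun_succ (f : Fin n → Fin N) (a : Fin N) (i : Fin n) :
    consFun a f i.succ = f i := rfl

theorem consFun_zero (f : Fin n → Fin N) (a : Fin N) : consFun a f 0 = a := rfl

theorem snocFun_inj {f g : Fin n → Fin N} {a b : Fin N} :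
    snocFun f a = snocFun g b ↔ a = b ∧ f = g := by
  rw [snocFun, snocFun, Fin.snoc_inj, and_comm]

theorem consFun_inj {f g : Fin n → Fin N} {a b : Fin N} :
    consFun a f = consFun b g ↔ a = b ∧ f = g := by
  rw [consFun, consFun, Fin.cons_inj]

theorem consFun_snocFun (a b : Fin N) (f : Fin n → Fin N) :
    consFun a (snocFun f b) = snocFun (consFun a f) b :=
  Fin.cons_snoc_eq_snoc_cons a f b

theorem exists_snocFun (f : Fin (n + 1) → Fin N) : ∃ g a, f = snocFun g a :=
  ⟨Fin.init f, f (Fin.last n), (Fin.snoc_init_self f).symm⟩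

theorem exists_consFun (f : Fin (n + 1) → Fin N) : ∃ a g, f = consFun a g :=
  ⟨f 0, Fin.tail f, (Fin.cons_self_tail f).symm⟩

theorem sum_snocFun {A : Type*} [AddCommMonoid A] (φ : (Fin (n + 1) → Fin N) → A) :
    ∑ f, φ f = ∑ a, ∑ f, φ (snocFun f a) := by
  rw [← Equiv.sum_comp (Fin.snocEquiv fun _ => Fin N), Fintype.sum_prod_type]
  rfl

theorem sum_consFun {A : Type*} [AddCommMonoid A] (φ : (Fin (n + 1) → Fin N) → A) :
    ∑ f, φ f = ∑ a, ∑ f, φ (consFun a f) := by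
  rw [← Equiv.sum_comp (Fin.consEquiv fun _ => Fin N), Fintype.sum_prod_type]
  rfl

theorem prod_snocFun {A : Type*} [CommMonoid A] (x : Fin N → A) (f : Fin n → Fin N) (a : Fin N) :
    ∏ i, x (snocFun f a i) = (∏ i, x (f i)) * x a := by
  rw [Fin.prod_univ_castSucc]
  simp only [snocFun_castSucc, snocFun_last]

theorem prod_consFun {A : Type*} [CommMonoid A] (x : Fin N → A) (f : Fin n → Fin N) (a : Fin N) :
    ∏ i, x (consFun a f i) = x a * ∏ i, x (f i) := by
  rw [Fin.prod_univ_succ]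
  simp only [consFun_succ, consFun_zero]

theorem snocFun_comp_swap (f : Fin n → Fin N) (a : Fin N) (i j : Fin n) :
    snocFun f a ∘ Equiv.swap i.castSucc j.castSucc = snocFun (f ∘ Equiv.swap i j) a := by
  ext x
  congr 1
  refine Fin.lastCases ?_ (fun x => ?_) x
  · rw [Function.comp_apply, Equiv.swap_apply_of_ne_of_ne (Fin.castSucc_lt_last i).ne'
      (Fin.castSucc_lt_last j).ne', snocFun_last, snocFun_last]
  · rw [Function.comp_apply, snocFun_castSucc, Function.comp_apply, ← snocFun_castSucc f a,
      ← (Fin.castSucc_injective n).swap_apply]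

theorem consFun_comp_swap (f : Fin n → Fin N) (a : Fin N) (i j : Fin n) :
    consFun a f ∘ Equiv.swap i.succ j.succ = consFun a (f ∘ Equiv.swap i j) := by
  ext x
  congr 1
  refine Fin.cases ?_ (fun x => ?_) x
  · rw [Function.comp_apply, Equiv.swap_apply_of_ne_of_ne (Fin.succ_ne_zero i).symm
      (Fin.succ_ne_zero j).symm, consFun_zero, consFun_zero]
  · rw [Function.comp_apply, consFun_succ, Function.comp_apply, ← consFun_succ f a,
      ← (Fin.succ_injective n).swap_apply]

theorem snocFun_snocFun_comp_swap (f : Fin n → Fin N) (a b : Fin N) :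
    snocFun (snocFun f a) b ∘ Equiv.swap (Fin.last n).castSucc (Fin.last (n + 1)) =
      snocFun (snocFun f b) a := by
  ext x
  congr 1
  refine Fin.lastCases ?_ (fun x => Fin.lastCases ?_ (fun x => ?_) x) x
  · simp only [Function.comp_apply, Equiv.swap_apply_right, snocFun_castSucc, snocFun_last]
  · simp only [Function.comp_apply, Equiv.swap_apply_left, snocFun_castSucc, snocFun_last]
  · rw [Function.comp_apply, Equiv.swap_apply_of_ne_of_ne _ (Fin.castSucc_lt_last _).ne]
    · simp only [snocFun_castSucc]
    · exact fun h => (Fin.castSucc_lt_last x).ne (Fin.castSucc_injective _ h)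

theorem consFun_consFun_comp_swap (f : Fin n → Fin N) (a b : Fin N) :
    consFun a (consFun b f) ∘ Equiv.swap 0 (Fin.succ 0) = consFun b (consFun a f) := by
  ext x
  congr 1
  refine Fin.cases ?_ (fun x => Fin.cases ?_ (fun x => ?_) x) x
  · simp only [Function.comp_apply, Equiv.swap_apply_left, consFun_succ, consFun_zero]
  · simp only [Function.comp_apply, Equiv.swap_apply_right, consFun_succ, consFun_zero]
  · rw [Function.comp_apply, Equiv.swap_apply_of_ne_of_ne (Fin.succ_ne_zero _)]
    · simp only [consFun_succ]
    · exact fun h => Fin.succ_ne_zero x (Fin.succ_injective _ h)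

variable {K : Type*} [Field K]

/-- The operator `1 ⊗ A` for an isomorphism of the index set with a product. -/
def extend (e : (Fin (n + 1) → Fin N) ≃ Fin N × (Fin n → Fin N)) :
    TensorEnd K N n →ₐ[K] TensorEnd K N (n + 1) where
  toFun A := Matrix.of fun f g => if (e f).1 = (e g).1 then A (e f).2 (e g).2 else 0
  map_one' := by
    ext f g
    simp only [Matrix.of_apply, Matrix.one_apply, ← ite_and, ← Prod.ext_iff, e.injective.eq_iff]
  map_mul' A B := by
    ext f g
    rw [Matrix.of_apply, Matrix.mul_apply, Matrix.mul_apply, ← Equiv.sum_comp e.symm,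
      Fintype.sum_prod_type, Finset.sum_eq_single (e f).1]
    · simp only [Matrix.of_apply, Equiv.apply_symm_apply, if_true]
      split_ifs with h
      · rfl
      · simp
    · intro b _ hb
      refine Finset.sum_eq_zero fun h _ => ?_
      simp only [Matrix.of_apply, Equiv.apply_symm_apply, if_neg hb.symm, zero_mul]
    · intro h
      exact absurd (Finset.mem_univ _) h
  map_zero' := by ext; simp
  map_add' A B := by
    ext f g
    simp only [Matrix.of_apply, Matrix.add_apply]
    split_ifs <;> simp
  commutes' c := by
    ext f g
    simp only [Matrix.of_apply, Matrix.algebraMap_matrix_apply, ← e.injective.eq_iff, Prod.ext_iff,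
      ite_and]

/-- The operator `A ⊗ 1`. -/
def extLast (K : Type*) [Field K] (N n : ℕ) : TensorEnd K N n →ₐ[K] TensorEnd K N (n + 1) :=
  extend (Fin.snocEquiv fun _ => Fin N).symm

/-- The operator `1 ⊗ A`. -/
def extHead (K : Type*) [Field K] (N n : ℕ) : TensorEnd K N n →ₐ[K] TensorEnd K N (n + 1) :=
  extend (Fin.consEquiv fun _ => Fin N).symm

theorem extLast_apply (A : TensorEnd K N n) (f g : Fin n → Fin N) (a b : Fin N) :
    extLast K N n A (snocFun f a) (snocFun g b) = if a = b then A f g else 0 := by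
  have h : ∀ (f : Fin n → Fin N) a, (Fin.snocEquiv fun _ => Fin N).symm (snocFun f a) = (a, f) :=
    fun f a => (Equiv.symm_apply_eq _).2 rfl
  change (if _ then _ else _) = _
  rw [h, h]

theorem extHead_apply (A : TensorEnd K N n) (f g : Fin n → Fin N) (a b : Fin N) :
    extHead K N n A (consFun a f) (consFun b g) = if a = b then A f g else 0 := by
  have h : ∀ (f : Fin n → Fin N) a, (Fin.consEquiv fun _ => Fin N).symm (consFun a f) = (a, f) :=
    fun f a => (Equiv.symm_apply_eq _).2 rfl
  change (if _ then _ else _) = _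
  rw [h, h]

variable (u : K)

theorem extLast_braidGen {i : ℕ} (h : i + 1 < n) :
    extLast K N n (braidGen u N n i) = braidGen u N (n + 1) i := by
  ext F G
  obtain ⟨f, a, rfl⟩ := exists_snocFun F
  obtain ⟨g, b, rfl⟩ := exists_snocFun G
  have h1 := snocFun_comp_swap g b ⟨i, by omega⟩ ⟨i + 1, h⟩
  have h2 := snocFun_castSucc g b ⟨i, by omega⟩
  have h3 := snocFun_castSucc g b ⟨i + 1, h⟩
  rw [Fin.castSucc_mk] at h1 h2 h3
  rw [Fin.castSucc_mk] at h1
  rw [extLast_apply, braidGen_apply u N h, braidGen_apply u N (by omega), h1, h2, h3]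
  simp only [snocFun_inj]
  by_cases hab : a = b <;> simp [hab]

theorem extHead_braidGen (i : ℕ) :
    extHead K N n (braidGen u N n i) = braidGen u N (n + 1) (i + 1) := by
  rcases Nat.lt_or_ge (i + 1) n with h | h
  · ext F G
    obtain ⟨a, f, rfl⟩ := exists_consFun F
    obtain ⟨b, g, rfl⟩ := exists_consFun G
    have h1 := consFun_comp_swap g b ⟨i, by omega⟩ ⟨i + 1, h⟩
    have h2 := consFun_succ g b ⟨i, by omega⟩
    have h3 := consFun_succ g b ⟨i + 1, h⟩
    rw [Fin.succ_mk] at h1 h2 h3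
    rw [Fin.succ_mk] at h1
    rw [extHead_apply, braidGen_apply u N h, braidGen_apply u N (by omega), h1, h2, h3]
    simp only [consFun_inj]
    by_cases hab : a = b <;> simp [hab]
  · rw [braidGen_of_le u N h, braidGen_of_le u N (by omega), map_one]

theorem braidGen_last_mul_apply (M : TensorEnd K N (n + 2)) (f : Fin n → Fin N) (a b : Fin N)
    (G : Fin (n + 2) → Fin N) :
    (braidGen u N (n + 2) n * M) (snocFun (snocFun f a) b) G =
      rOff u a b * M (snocFun (snocFun f b) a) G +
        rDiag u a b * M (snocFun (snocFun f a) b) G := by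
  have h := braidGen_mul_apply u N (n := n + 2) (i := n) (by omega) M (snocFun (snocFun f a) b) G
  have e1 : (⟨n, by omega⟩ : Fin (n + 2)) = (Fin.last n).castSucc := rfl
  have e2 : (⟨n + 1, by omega⟩ : Fin (n + 2)) = Fin.last (n + 1) := rfl
  rw [e1, e2, snocFun_snocFun_comp_swap, snocFun_castSucc, snocFun_last, snocFun_last] at h
  exact h

theorem mul_braidGen_last_apply (M : TensorEnd K N (n + 2)) (f : Fin n → Fin N) (a b : Fin N)
    (F : Fin (n + 2) → Fin N) :
    (M * braidGen u N (n + 2) n) F (snocFun (snocFun f a) b) =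
      rOff u a b * M F (snocFun (snocFun f b) a) +
        rDiag u a b * M F (snocFun (snocFun f a) b) := by
  have h := mul_braidGen_apply u N (n := n + 2) (i := n) (by omega) M F (snocFun (snocFun f a) b)
  have e1 : (⟨n, by omega⟩ : Fin (n + 2)) = (Fin.last n).castSucc := rfl
  have e2 : (⟨n + 1, by omega⟩ : Fin (n + 2)) = Fin.last (n + 1) := rfl
  rw [e1, e2, snocFun_snocFun_comp_swap, snocFun_castSucc, snocFun_last, snocFun_last] at h
  exact h

theorem braidGen_zero_mul_apply (M : TensorEnd K N (n + 2)) (f : Fin n → Fin N) (a b : Fin N)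
    (G : Fin (n + 2) → Fin N) :
    (braidGen u N (n + 2) 0 * M) (consFun a (consFun b f)) G =
      rOff u a b * M (consFun b (consFun a f)) G +
        rDiag u a b * M (consFun a (consFun b f)) G := by
  have h := braidGen_mul_apply u N (n := n + 2) (i := 0) (by omega) M (consFun a (consFun b f)) G
  have e1 : (⟨0, by omega⟩ : Fin (n + 2)) = 0 := rfl
  have e2 : (⟨0 + 1, by omega⟩ : Fin (n + 2)) = Fin.succ 0 := rfl
  rw [e1, e2, consFun_consFun_comp_swap, consFun_zero, consFun_succ, consFun_zero] at h
  exact h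

/-! ### The blocks of the braid in which one strand passes the others -/

/-- The blocks of the operator of the braid in which the first strand becomes the last. -/
def passBlock (n : ℕ) (a b : Fin N) : TensorEnd K N n :=
  Matrix.of fun f g => desc (braidGen u N (n + 1)) 0 n (snocFun f a) (consFun b g)

theorem desc_transpose (n a k : ℕ) :
    (desc (braidGen u N n) a k).transpose = asc (braidGen u N n) a k := by
  induction k with
  | zero => exact Matrix.transpose_one
  | succ k ih => rw [desc_succ, Matrix.transpose_mul, ih, braidGen_transpose, asc_succ]

theorem asc_apply (n : ℕ) (f g : Fin n → Fin N) (a b : Fin N) :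
    asc (braidGen u N (n + 1)) 0 n (consFun a f) (snocFun g b) =
      (passBlock u n b a).transpose f g := by
  rw [← desc_transpose]; rfl

theorem extLast_desc {a k : ℕ} (h : a + k < n) :
    extLast K N n (desc (braidGen u N n) a k) = desc (braidGen u N (n + 1)) a k := by
  rw [map_desc]
  exact desc_congr fun i hi => extLast_braidGen u (by omega)

theorem extLast_asc {a k : ℕ} (h : a + k < n) :
    extLast K N n (asc (braidGen u N n) a k) = asc (braidGen u N (n + 1)) a k := by
  rw [map_asc]
  exact asc_congr fun i hi => extLast_braidGen u (by omega)

theorem extHead_desc (a k : ℕ) :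
    extHead K N n (desc (braidGen u N n) a k) = desc (braidGen u N (n + 1)) (a + 1) k := by
  rw [map_desc]
  exact desc_congr fun i hi => by rw [extHead_braidGen, Nat.add_right_comm]

theorem extHead_asc (a k : ℕ) :
    extHead K N n (asc (braidGen u N n) a k) = asc (braidGen u N (n + 1)) (a + 1) k := by
  rw [map_asc]
  exact asc_congr fun i hi => by rw [extHead_braidGen, Nat.add_right_comm]

theorem passBlock_succ_apply (n : ℕ) (a b p r : Fin N) (f g : Fin n → Fin N) :
    passBlock u (n + 1) a b (snocFun f p) (snocFun g r) =
      rOff u p a * (if p = r then passBlock u n a b f g else 0) +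
        rDiag u p a * if a = r then passBlock u n p b f g else 0 := by
  rw [passBlock, Matrix.of_apply, desc_succ, zero_add, braidGen_last_mul_apply,
    ← extLast_desc u (n := n + 1) (by omega), consFun_snocFun, extLast_apply, extLast_apply]
  rfl

theorem passBlock_zero_apply (a b : Fin N) (f g : Fin 0 → Fin N) :
    passBlock u 0 a b f g = if a = b then 1 else 0 := by
  have h : (snocFun f a = consFun b g) ↔ a = b := by
    constructor
    · intro h
      exact congrFun h 0
    · rintro rfl
      ext x
      obtain rfl : x = 0 := Subsingleton.elim (α := Fin 1) x 0
      rfl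
  rw [passBlock, Matrix.of_apply, desc_zero, Matrix.one_apply]
  simp only [h]

/-- The R-matrix is triangular: the label of the passing strand can only decrease from b to a. This
makes the later linear system triangular. -/
theorem passBlock_eq_zero (n : ℕ) {a b : Fin N} (h : b < a) : passBlock u n a b = 0 := by
  induction n generalizing a with
  | zero =>
    ext f g
    rw [passBlock_zero_apply, if_neg h.ne', Matrix.zero_apply]
  | succ n ih =>
    ext F G
    obtain ⟨f, p, rfl⟩ := exists_snocFun F
    obtain ⟨g, r, rfl⟩ := exists_snocFun G
    rw [passBlock_succ_apply, ih h, rDiag]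
    rcases lt_or_ge a p with h1 | h1
    · rw [ih (h.trans h1)]
      simp
    · rw [if_neg h1.not_gt]
      simp

/-- With triangularity, a label that ends unchanged never changed on the way, so the block is
diagonal. Two such blocks multiply the variable x_a by u² in a trace against `torus x`. -/
theorem passBlock_self (n : ℕ) (a : Fin N) :
    passBlock u n a a = Matrix.diagonal fun f => ∏ i, if f i = a then u else 1 := by
  induction n with
  | zero =>
    ext f g
    rw [passBlock_zero_apply, if_pos rfl, Subsingleton.elim f g, Matrix.diagonal_apply_eq]
    simp
  | succ n ih =>
    ext F G
    obtain ⟨f, p, rfl⟩ := exists_snocFun F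
    obtain ⟨g, r, rfl⟩ := exists_snocFun G
    have h0 : rDiag u p a * (if a = r then passBlock u n p a f g else 0) = 0 := by
      rw [rDiag]
      split_ifs with h1
      · rw [passBlock_eq_zero u n h1, Matrix.zero_apply, mul_zero]
      · rw [mul_zero]
      · rw [zero_mul]
      · rw [zero_mul]
    rw [passBlock_succ_apply, h0, add_zero, ih, Matrix.diagonal_apply, Matrix.diagonal_apply,
      prod_snocFun (fun c => if c = a then u else 1)]
    simp only [snocFun_inj, ite_and, rOff]
    split_ifs <;> ring

/-- The action of a diagonal matrix on the tensor power. -/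
def torus (x : Fin N → K) (n : ℕ) : TensorEnd K N n := Matrix.diagonal fun f => ∏ i, x (f i)

theorem commute_torus_braidGen (x : Fin N → K) (n i : ℕ) :
    Commute (torus x n) (braidGen u N n i) := by
  rcases Nat.lt_or_ge (i + 1) n with h | h
  · ext f g
    rw [torus, Matrix.diagonal_mul, Matrix.mul_diagonal, braidGen_apply u N h]
    by_cases h1 : f = g
    · rw [h1, mul_comm]
    · by_cases h2 : f = g ∘ Equiv.swap ⟨i, by omega⟩ ⟨i + 1, h⟩
      · have : ∏ i, x (f i) = ∏ i, x (g i) := by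
          rw [h2]
          exact Equiv.prod_comp (Equiv.swap _ _) fun i => x (g i)
        rw [this, mul_comm]
      · rw [if_neg h1, if_neg h2]
        ring
  · rw [braidGen_of_le u N h]
    exact Commute.one_right _

/-- Conservation of weight for the whole braid: the passing strand contributes x_a at its end and
x_b at its start. -/
theorem torus_passBlock (x : Fin N → K) (n : ℕ) (a b : Fin N) :
    x a • (torus x n * passBlock u n a b) = x b • (passBlock u n a b * torus x n) := by
  ext f g
  have h := congrFun (congrFun (commute_desc (a := 0) (n := n)
    fun i _ => commute_torus_braidGen (N := N) u x (n + 1) (0 + i)).eq (snocFun f a)) (consFun b g)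
  rw [torus, Matrix.diagonal_mul, Matrix.mul_diagonal, prod_snocFun, prod_consFun] at h
  rw [torus, Matrix.smul_apply, Matrix.smul_apply, Matrix.diagonal_mul, Matrix.mul_diagonal,
    smul_eq_mul, smul_eq_mul, passBlock, Matrix.of_apply]
  linear_combination h

/-- Sliding T_i through the passing strand gives T_{i+1}. Once the passing strand is removed at
either end, both are T_i on the remaining n strands. -/
theorem commute_braidGen_passBlock (hu : u ≠ 0) (n i : ℕ) (a b : Fin N) :
    Commute (braidGen u N n i) (passBlock u n a b) := by
  rcases Nat.lt_or_ge (i + 1) n with h | h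
  · have h1 := (isBraided_braidGen N hu (n + 1)).mul_desc (a := 0) h (by omega)
    rw [zero_add, ← extLast_braidGen u h, ← extHead_braidGen u i] at h1
    ext f g
    have h2 := congrFun (congrFun h1 (snocFun f a)) (consFun b g)
    rw [Matrix.mul_apply, Matrix.mul_apply, sum_snocFun, sum_consFun,
      Finset.sum_eq_single_of_mem a (Finset.mem_univ _), Finset.sum_eq_single_of_mem b
      (Finset.mem_univ _)] at h2
    · simp only [extLast_apply, extHead_apply, if_true] at h2
      rw [Matrix.mul_apply, Matrix.mul_apply]
      exact h2
    · intro c _ hc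
      refine Finset.sum_eq_zero fun k _ => ?_
      rw [extHead_apply, if_neg hc, mul_zero]
    · intro c _ hc
      refine Finset.sum_eq_zero fun k _ => ?_
      rw [extLast_apply, if_neg hc.symm, zero_mul]
  · rw [braidGen_of_le u N h]
    exact Commute.one_left _

theorem commute_braidGen_passBlock_transpose (hu : u ≠ 0) (n i : ℕ) (a b : Fin N) :
    Commute (braidGen u N n i) (passBlock u n a b).transpose := by
  have h := congrArg Matrix.transpose (commute_braidGen_passBlock u hu n i a b).eq
  rw [Matrix.transpose_mul, Matrix.transpose_mul, braidGen_transpose] at h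
  exact h.symm

theorem extLast_mul_braidGen_mul_apply (X Y : TensorEnd K N (n + 1)) (F G : Fin (n + 1) → Fin N)
    (d : Fin N) :
    (extLast K N (n + 1) X * (braidGen u N (n + 2) n * extLast K N (n + 1) Y)) (snocFun F d)
        (snocFun G d) =
      ∑ a, ∑ h : Fin n → Fin N, X F (snocFun h a) *
        ((if a = d then u * Y (snocFun h d) G else 0) + rDiag u a d * Y (snocFun h a) G) := by
  rw [Matrix.mul_apply, sum_snocFun, Finset.sum_eq_single_of_mem d (Finset.mem_univ _), sum_snocFun]
  · refine Finset.sum_congr rfl fun a _ => Finset.sum_congr rfl fun h _ => ?_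
    rw [extLast_apply, if_pos rfl, braidGen_last_mul_apply, extLast_apply, extLast_apply,
      if_pos rfl, rOff]
    by_cases had : a = d <;> simp [had]
  · intro c _ hc
    refine Finset.sum_eq_zero fun k _ => ?_
    rw [extLast_apply, if_neg hc.symm, zero_mul]

theorem extHead_mul_braidGen_mul_apply (X Y : TensorEnd K N (n + 1)) (F G : Fin (n + 1) → Fin N)
    (b : Fin N) :
    (extHead K N (n + 1) X * (braidGen u N (n + 2) 0 * extHead K N (n + 1) Y)) (consFun b F)
        (consFun b G) =
      ∑ a, ∑ h : Fin n → Fin N, X F (consFun a h) *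
        ((if a = b then u * Y (consFun b h) G else 0) + rDiag u b a * Y (consFun a h) G) := by
  rw [Matrix.mul_apply, sum_consFun, Finset.sum_eq_single_of_mem b (Finset.mem_univ _), sum_consFun]
  · refine Finset.sum_congr rfl fun a _ => Finset.sum_congr rfl fun h _ => ?_
    rw [extHead_apply, if_pos rfl, braidGen_zero_mul_apply, extHead_apply, extHead_apply,
      if_pos rfl, rOff]
    by_cases had : a = b
    · simp [had]
    · simp [had, Ne.symm had]
  · intro c _ hc
    refine Finset.sum_eq_zero fun k _ => ?_
    rw [extHead_apply, if_neg hc.symm, zero_mul]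

/-- The exchange relation between the blocks. -/
theorem passBlock_exchange (hu : u ≠ 0) (n : ℕ) (d b : Fin N) :
    u • ((passBlock u n d b).transpose * passBlock u n d b) +
        (u - u⁻¹) • ∑ a ∈ Finset.Ioi d, (passBlock u n a b).transpose * passBlock u n a b =
      u • (passBlock u n d b * (passBlock u n d b).transpose) +
        (u - u⁻¹) • ∑ c ∈ Finset.Iio b, passBlock u n d c * (passBlock u n d c).transpose := by
  have h := (isBraided_braidGen N hu (n + 2)).asc_mul_desc (a := 0) (n := n) (by omega)
  rw [zero_add, zero_add, ← extLast_desc u (by omega), ← extLast_asc u (by omega)] at h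
  have h0 := extHead_desc (N := N) (n := n + 1) u 0 n
  have h0' := extHead_asc (N := N) (n := n + 1) u 0 n
  rw [zero_add] at h0 h0'
  rw [← h0, ← h0', mul_assoc, mul_assoc] at h
  ext f g
  -- The palindromic braid identity in the block where the first label is b and the last label is d
  -- on both sides. The diagonal part of the R-matrix in the middle produces the sums over a > d and
  -- c < b.
  have h1 := congrFun (congrFun h (consFun b (snocFun f d))) (consFun b (snocFun g d))
  rw [extHead_mul_braidGen_mul_apply, consFun_snocFun, consFun_snocFun,
    extLast_mul_braidGen_mul_apply] at h1
  simp only [asc_apply] at h1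
  simp only [Matrix.add_apply, Matrix.smul_apply, Matrix.sum_apply, smul_eq_mul, Finset.mul_sum,
    ← Finset.filter_lt_eq_Ioi, ← Finset.filter_gt_eq_Iio, Finset.sum_filter, Matrix.mul_apply]
  simp only [mul_add, Finset.sum_add_distrib, mul_ite, mul_zero] at h1
  rw [Finset.sum_eq_single_of_mem d (Finset.mem_univ _),
    Finset.sum_eq_single_of_mem (f := fun a => ∑ h, if a = b then _ else _) b
      (Finset.mem_univ _)] at h1
  · simp only [if_true] at h1
    refine Eq.trans ?_ (h1.trans ?_)
    · congr 1
      · exact Finset.sum_congr rfl fun i _ => mul_left_comm ..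
      · refine Finset.sum_congr rfl fun a _ => ?_
        rw [rDiag]
        split_ifs with hd
        · rw [Matrix.mul_apply, Finset.mul_sum]
          exact Finset.sum_congr rfl fun i _ => mul_left_comm ..
        · simp
    · congr 1
      · exact Finset.sum_congr rfl fun i _ => mul_left_comm ..
      · refine Finset.sum_congr rfl fun a _ => ?_
        rw [rDiag]
        split_ifs with hd
        · rw [Matrix.mul_apply, Finset.mul_sum]
          exact Finset.sum_congr rfl fun i _ => (mul_left_comm ..).symm
        · simp
  · intro c _ hc
    simp [hc]
  · intro c _ hc
    simp [hc]

end Strand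

/-! ### A triangular system of linear equations -/

section Triangular

variable {K : Type*} [Field K]

/-- The sum `∑_{i ∈ S} F_i ∏_{j ∈ S, j ≠ i} (x_i - r x_j) / (x_i - x_j)`. -/
def macdonaldSum {ι : Type*} [DecidableEq ι] (r : K) (x F : ι → K) (S : Finset ι) : K :=
  ∑ i ∈ S, F i * ∏ j ∈ S.erase i, (x i - r * x j) / (x i - x j)

theorem macdonaldSum_insert {ι : Type*} [DecidableEq ι] (r : K) (x F : ι → K) {S : Finset ι} {d : ι}
    (hd : d ∉ S) : macdonaldSum r x F (insert d S) =
      F d * ∏ j ∈ S, (x d - r * x j) / (x d - x j) +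
        ∑ i ∈ S, (x i - r * x d) / (x i - x d) *
          (F i * ∏ j ∈ S.erase i, (x i - r * x j) / (x i - x j)) := by
  rw [macdonaldSum, Finset.sum_insert hd, Finset.erase_insert hd]
  congr 1
  refine Finset.sum_congr rfl fun i hi => ?_
  have hid : i ≠ d := fun h => hd (h ▸ hi)
  rw [Finset.erase_insert_of_ne hid.symm, Finset.prod_insert fun h => hd (Finset.mem_of_mem_erase h),
    mul_left_comm]

/-- A partial fraction identity, checked term by term: `key` treats the indices in S, and the terms
of d and e match directly. -/
theorem macdonaldSum_insert_insert {ι : Type*} [DecidableEq ι] (r : K) (x F : ι → K) {S : Finset ι}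
    {d e : ι} (hd : d ∉ S) (he : e ∉ S) (hde : d ≠ e)
    (hx : ∀ i ∈ insert d (insert e S), ∀ j ∈ insert d (insert e S), i ≠ j → x i ≠ x j) :
    macdonaldSum r x F (insert d (insert e S)) =
      (x e - r * x d) / (x e - x d) * macdonaldSum r x F (insert e S) +
        (x d - r * x e) / (x d - x e) * macdonaldSum r x F (insert d S) -
          r * macdonaldSum r x F S := by
  have hd' : d ∉ insert e S := by simp [hd, hde]
  rw [macdonaldSum_insert r x F hd', Finset.prod_insert he, Finset.sum_insert he,
    Finset.erase_insert he, macdonaldSum_insert r x F he, macdonaldSum_insert r x F hd,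
    macdonaldSum]
  have h : ∑ i ∈ S, (x i - r * x d) / (x i - x d) *
      (F i * ∏ j ∈ (insert e S).erase i, (x i - r * x j) / (x i - x j)) =
      (x e - r * x d) / (x e - x d) * ∑ i ∈ S, (x i - r * x e) / (x i - x e) *
          (F i * ∏ j ∈ S.erase i, (x i - r * x j) / (x i - x j)) +
      (x d - r * x e) / (x d - x e) * ∑ i ∈ S, (x i - r * x d) / (x i - x d) *
          (F i * ∏ j ∈ S.erase i, (x i - r * x j) / (x i - x j)) -
      r * ∑ i ∈ S, F i * ∏ j ∈ S.erase i, (x i - r * x j) / (x i - x j) := by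
    rw [Finset.mul_sum, Finset.mul_sum, Finset.mul_sum, ← Finset.sum_add_distrib,
      ← Finset.sum_sub_distrib]
    refine Finset.sum_congr rfl fun i hi => ?_
    have hid : i ≠ d := fun h => hd (h ▸ hi)
    have hie : i ≠ e := fun h => he (h ▸ hi)
    rw [Finset.erase_insert_of_ne hie.symm,
      Finset.prod_insert fun h => he (Finset.mem_of_mem_erase h)]
    have h1 : x i - x d ≠ 0 := sub_ne_zero.2 (hx i (by simp [hi]) d (by simp) hid)
    have h2 : x i - x e ≠ 0 := sub_ne_zero.2 (hx i (by simp [hi]) e (by simp) hie)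
    have h3 : x d - x e ≠ 0 := sub_ne_zero.2 (hx d (by simp) e (by simp) hde)
    have h4 : x e - x d ≠ 0 := sub_ne_zero.2 (hx e (by simp) d (by simp) hde.symm)
    have key : (x i - r * x d) / (x i - x d) * ((x i - r * x e) / (x i - x e)) =
        (x e - r * x d) / (x e - x d) * ((x i - r * x e) / (x i - x e)) +
        (x d - r * x e) / (x d - x e) * ((x i - r * x d) / (x i - x d)) - r := by
      have h5 : x e - x d = -(x d - x e) := by ring
      rw [h5]
      field_simp
      ring
    linear_combination (F i * ∏ j ∈ S.erase i, (x i - r * x j) / (x i - x j)) * key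
  rw [h]
  ring

/-- The relations determine s d b by induction on b - d from the diagonal entries. The solution is
best stated for sums along rows and columns, which are differences of Macdonald sums over intervals;
the weighted sum over d then telescopes. -/
theorem sum_triangular {N : ℕ} {r : K} {x : ℕ → K} {s : ℕ → ℕ → K}
    (hx : ∀ i < N, ∀ j < N, i ≠ j → x i ≠ x j) (hs : ∀ a b, b < a → s a b = 0)
    (h : ∀ d b, d < b → b < N → (x b - x d) * s d b = (1 - r) *
      ((∑ a ∈ Finset.range N, if d < a then x a * s a b else 0) -
        ∑ c ∈ Finset.range N, if c < b then x c * s d c else 0)) :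
    ∑ d ∈ Finset.range N, r ^ d * ∑ c ∈ Finset.range N, x c * s d c =
      macdonaldSum r x (fun i => x i * s i i) (Finset.range N) := by
  set Φ := fun d e => macdonaldSum r x (fun i => x i * s i i) (Finset.Ico d e) with hΦ
  -- Rows and columns go together: the relation for s d b involves the row d up to b - 1 and the
  -- column b from d + 1 on, both of length k.
  have main : ∀ k d, d + k < N →
      ∑ c ∈ Finset.Ico d (d + k + 1), x c * s d c = Φ d (d + k + 1) - r * Φ (d + 1) (d + k + 1) ∧
      ∑ a ∈ Finset.Ico d (d + k + 1), x a * s a (d + k) =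
        Φ d (d + k + 1) - r * Φ d (d + k) := by
    intro k
    induction k with
    | zero =>
      intro d hd
      simp [hΦ, macdonaldSum]
    | succ k ih =>
      intro d hd
      have h1 := (ih d (by omega)).1
      have h2 := (ih (d + 1) (by omega)).2
      have e1 : d + 1 + k = d + (k + 1) := by omega
      have e2 : d + k + 1 = d + (k + 1) := by omega
      rw [e1] at h2
      rw [e2] at h1
      set b := d + (k + 1) with hb
      have hS : Finset.Ico d (b + 1) = insert d (insert b (Finset.Ico (d + 1) b)) := by
        ext y; simp only [Finset.mem_Ico, Finset.mem_insert]; omega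
      have hS1 : Finset.Ico (d + 1) (b + 1) = insert b (Finset.Ico (d + 1) b) := by
        ext y; simp only [Finset.mem_Ico, Finset.mem_insert]; omega
      have hS2 : Finset.Ico d b = insert d (Finset.Ico (d + 1) b) := by
        ext y; simp only [Finset.mem_Ico, Finset.mem_insert]; omega
      have hkey : Φ d (b + 1) = (x b - r * x d) / (x b - x d) * Φ (d + 1) (b + 1) +
          (x d - r * x b) / (x d - x b) * Φ d b - r * Φ (d + 1) b := by
        simp only [hΦ]
        rw [hS, hS1, hS2]
        refine macdonaldSum_insert_insert r x _ (by simp) (by simp) (by omega) ?_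
        rw [← hS]
        intro i hi j hj
        rw [Finset.mem_Ico] at hi hj
        exact hx i (by omega) j (by omega)
      have hr := h d b (by omega) hd
      have e3 : (∑ a ∈ Finset.range N, if d < a then x a * s a b else 0) =
          ∑ a ∈ Finset.Ico (d + 1) (b + 1), x a * s a b := by
        rw [← Finset.sum_filter]
        refine (Finset.sum_subset (fun y hy => ?_) fun y hy hy' => ?_).symm
        · simp only [Finset.mem_Ico, Finset.mem_filter, Finset.mem_range] at hy ⊢
          omega
        · simp only [Finset.mem_Ico, Finset.mem_filter, Finset.mem_range] at hy hy'
          rw [hs y b (by omega), mul_zero]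
      have e4 : (∑ c ∈ Finset.range N, if c < b then x c * s d c else 0) =
          ∑ c ∈ Finset.Ico d b, x c * s d c := by
        rw [← Finset.sum_filter]
        refine (Finset.sum_subset (fun y hy => ?_) fun y hy hy' => ?_).symm
        · simp only [Finset.mem_Ico, Finset.mem_filter, Finset.mem_range] at hy ⊢
          omega
        · simp only [Finset.mem_Ico, Finset.mem_filter, Finset.mem_range] at hy hy'
          rw [hs d y (by omega), mul_zero]
      rw [e3, e4, h1, h2] at hr
      have hne : x b - x d ≠ 0 := sub_ne_zero.2 (hx b (by omega) d (by omega) (by omega))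
      have hne' : x d - x b ≠ 0 := sub_ne_zero.2 (hx d (by omega) b (by omega) (by omega))
      have hneg : x d - x b = -(x b - x d) := by ring
      have hs' : s d b = (1 - r) * (Φ (d + 1) (b + 1) - Φ d b) / (x b - x d) := by
        rw [eq_div_iff hne]
        linear_combination hr
      rw [Finset.sum_Ico_succ_top (by omega), h1, Finset.sum_eq_sum_Ico_succ_bot (by omega), h2, hs',
        hkey, hneg]
      constructor
      · field_simp
        ring
      · field_simp
        ring
  have hU : ∀ d < N, ∑ c ∈ Finset.range N, x c * s d c = Φ d N - r * Φ (d + 1) N := by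
    intro d hd
    obtain ⟨k, rfl⟩ : ∃ k, N = d + k + 1 := ⟨N - d - 1, by omega⟩
    rw [← (main k d (by omega)).1]
    refine (Finset.sum_subset (fun y hy => ?_) fun y hy hy' => ?_).symm
    · simp only [Finset.mem_Ico, Finset.mem_range] at hy ⊢
      omega
    · simp only [Finset.mem_Ico, Finset.mem_range] at hy hy'
      rw [hs d y (by omega), mul_zero]
  have e : ∀ d ∈ Finset.range N, r ^ d * ∑ c ∈ Finset.range N, x c * s d c =
      r ^ d * Φ d N - r ^ (d + 1) * Φ (d + 1) N := by
    intro d hd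
    rw [hU d (Finset.mem_range.1 hd)]
    ring
  rw [Finset.sum_congr rfl e, Finset.sum_range_sub' (fun d => r ^ d * Φ d N)]
  simp [hΦ, macdonaldSum]

end Triangular

/-! ### The trace of the encircling operator -/

section Encircle

variable {K : Type*} [Field K] {N : ℕ} (u : K)

/-- Move the transposed block past the torus, which exchanges the factors x_d and x_b, and around
the trace, where it commutes with A. -/
theorem trace_passBlock (x : Fin N → K) {n : ℕ} {A : TensorEnd K N n} {d b : Fin N}
    (hA : Commute A (passBlock u n d b).transpose) :
    x d * Matrix.trace (A * (passBlock u n d b * (passBlock u n d b).transpose) * torus x n) =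
      x b * Matrix.trace (A * ((passBlock u n d b).transpose * passBlock u n d b) * torus x n) := by
  have h := congrArg Matrix.transpose (torus_passBlock u x n d b)
  rw [Matrix.transpose_smul, Matrix.transpose_smul, Matrix.transpose_mul, Matrix.transpose_mul,
    torus, Matrix.diagonal_transpose, ← torus] at h
  set w := passBlock u n d b
  calc x d * Matrix.trace (A * (w * w.transpose) * torus x n)
      = Matrix.trace (A * w * (x d • (w.transpose * torus x n))) := by
        rw [Matrix.mul_smul, Matrix.trace_smul, smul_eq_mul]
        simp only [mul_assoc]
    _ = x b * Matrix.trace ((A * w * torus x n) * w.transpose) := by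
        rw [h, Matrix.mul_smul, Matrix.trace_smul, smul_eq_mul]
        simp only [mul_assoc]
    _ = _ := by
        rw [Matrix.trace_mul_comm, ← mul_assoc, ← mul_assoc, ← hA.eq]
        simp only [mul_assoc]

/-- The weighted trace of the encircling operator times an operator that commutes with it. -/
theorem trace_encircle (hu : u ≠ 0) {x : Fin N → K} (hx : Function.Injective x)
    (hx0 : ∀ i, x i ≠ 0) {n : ℕ} {A : TensorEnd K N n}
    (hA : ∀ d b, Commute A (passBlock u n d b).transpose) :
    ∑ d : Fin N, (u ^ 2)⁻¹ ^ (d : ℕ) * ∑ c,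
        Matrix.trace (A * (passBlock u n d c * (passBlock u n d c).transpose) * torus x n) =
      macdonaldSum (u ^ 2)⁻¹ x
        (fun i => Matrix.trace (A * torus (Function.update x i (u ^ 2 * x i)) n)) Finset.univ := by
  set t := fun d b => Matrix.trace
    (A * (passBlock u n d b * (passBlock u n d b).transpose) * torus x n) with ht
  set t' := fun d b => Matrix.trace
    (A * ((passBlock u n d b).transpose * passBlock u n d b) * torus x n) with ht'
  have htt : ∀ d b, t' d b = x d * (t d b / x b) := fun d b => by
    have h1 := trace_passBlock u x (hA d b)
    have h2 := hx0 b
    field_simp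
    rw [mul_comm]
    exact h1.symm
  -- `sum_triangular` indexes by ℕ, so x and s = t / x are extended by 0. This normalization makes t
  -- = x_b s and t' = x_d s, so the exchange relation becomes an equation for s alone.
  set x' : ℕ → K := fun i => if h : i < N then x ⟨i, h⟩ else 0 with hx'
  set s' : ℕ → ℕ → K := fun d b => if hd : d < N then if hb : b < N then
    t ⟨d, hd⟩ ⟨b, hb⟩ / x ⟨b, hb⟩ else 0 else 0 with hs'
  have ex : ∀ i : Fin N, x' i = x i := fun i => by simp [hx']
  have es : ∀ d b : Fin N, s' d b = t d b / x b := fun d b => by simp [hs']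
  have hex : ∀ d b : Fin N, u * t' d b + (u - u⁻¹) * (∑ a ∈ Finset.Ioi d, t' a b) =
      u * t d b + (u - u⁻¹) * ∑ c ∈ Finset.Iio b, t d c := by
    intro d b
    have h := congrArg (fun M => Matrix.trace (A * M * torus x n)) (passBlock_exchange u hu n d b)
    simp only [mul_add, add_mul, Matrix.mul_smul, Matrix.smul_mul, Matrix.trace_add,
      Matrix.trace_smul, smul_eq_mul, Finset.mul_sum, Finset.sum_mul, Matrix.trace_sum] at h
    simp only [Finset.mul_sum]
    exact h
  have h1 := sum_triangular (N := N) (r := (u ^ 2)⁻¹) (x := x') (s := s') ?_ ?_ ?_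
  · rw [Finset.sum_range] at h1
    simp only [Finset.sum_range, macdonaldSum, ex, es] at h1
    have e1 : ∀ d c : Fin N, x c * (t d c / x c) = t d c := fun d c => mul_div_cancel₀ _ (hx0 c)
    simp only [e1] at h1
    rw [h1, macdonaldSum]
    refine Finset.sum_congr rfl fun i _ => ?_
    congr 1
    · simp only [ht]
      rw [passBlock_self, Matrix.diagonal_transpose, Matrix.diagonal_mul_diagonal, mul_assoc, torus,
        torus, Matrix.diagonal_mul_diagonal]
      congr 3
      ext f
      rw [← Finset.prod_mul_distrib, ← Finset.prod_mul_distrib]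
      refine Finset.prod_congr rfl fun k _ => ?_
      rw [Function.update_apply]
      split_ifs with hk
      · rw [hk]; ring
      · ring
    · have : Finset.erase (Finset.range N) i =
          (Finset.univ.erase i).map Fin.valEmbedding := by
        ext y
        simp only [Finset.mem_erase, Finset.mem_range, Finset.mem_map, Finset.mem_univ, and_true,
          Fin.valEmbedding_apply]
        constructor
        · rintro ⟨h1, h2⟩
          exact ⟨⟨y, h2⟩, fun h => h1 (congrArg Fin.val h), rfl⟩
        · rintro ⟨a, ha, rfl⟩
          exact ⟨fun h => ha (Fin.ext h), a.2⟩
      rw [this, Finset.prod_map]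
      simp only [Fin.valEmbedding_apply, ex]
  · intro i hi j hj hij
    simp only [hx', dif_pos hi, dif_pos hj]
    exact fun h => hij (congrArg Fin.val (hx h))
  · intro a b hab
    simp only [hs']
    split_ifs with h2 h3
    · simp only [ht]
      rw [passBlock_eq_zero u n (show (⟨b, h3⟩ : Fin N) < ⟨a, h2⟩ from hab)]
      simp
    · rfl
    · rfl
  · intro d b hdb hb
    have hd : d < N := hdb.trans hb
    have h2 := hex ⟨d, hd⟩ ⟨b, hb⟩
    rw [Finset.sum_range, Finset.sum_range]
    have h3 := es ⟨d, hd⟩ ⟨b, hb⟩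
    have h4 := ex ⟨d, hd⟩
    have h5 := ex ⟨b, hb⟩
    simp only at h3 h4 h5
    simp only [h3, h4, h5]
    have e3 : (∑ a : Fin N, if d < (a : ℕ) then x' a * s' a b else 0) =
        ∑ a ∈ Finset.Ioi (⟨d, hd⟩ : Fin N), t' a ⟨b, hb⟩ := by
      rw [← Finset.filter_lt_eq_Ioi, Finset.sum_filter]
      refine Finset.sum_congr rfl fun a _ => ?_
      have := es a ⟨b, hb⟩
      simp only at this
      rw [this, ex, htt]
      rfl
    have e4 : (∑ c : Fin N, if (c : ℕ) < b then x' c * s' d c else 0) =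
        ∑ c ∈ Finset.Iio (⟨b, hb⟩ : Fin N), t ⟨d, hd⟩ c := by
      rw [← Finset.filter_gt_eq_Iio, Finset.sum_filter]
      refine Finset.sum_congr rfl fun c _ => ?_
      have := es ⟨d, hd⟩ c
      simp only at this
      rw [this, ex, mul_div_cancel₀ _ (hx0 c)]
      rfl
    rw [e3, e4]
    rw [htt ⟨d, hd⟩ ⟨b, hb⟩] at h2
    have h6 := hx0 ⟨b, hb⟩
    have h7 : t ⟨d, hd⟩ ⟨b, hb⟩ = x ⟨b, hb⟩ * (t ⟨d, hd⟩ ⟨b, hb⟩ / x ⟨b, hb⟩) :=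
      (mul_div_cancel₀ _ h6).symm
    set s0 := t ⟨d, hd⟩ ⟨b, hb⟩ / x ⟨b, hb⟩
    rw [h7] at h2
    have h8 : u⁻¹ * u = 1 := inv_mul_cancel₀ hu
    rw [sq, mul_inv]
    -- The exchange relation divided by u, where (u - u⁻¹) / u = 1 - r with r = q⁻¹.
    linear_combination (-u⁻¹) * h2 + (x ⟨d, hd⟩ * s0 +
      (∑ a ∈ Finset.Ioi (⟨d, hd⟩ : Fin N), t' a ⟨b, hb⟩) - x ⟨b, hb⟩ * s0 -
      ∑ c ∈ Finset.Iio (⟨b, hb⟩ : Fin N), t ⟨d, hd⟩ c) * h8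

end Encircle

/-! ### The partial quantum trace -/

section PartialTrace

variable {K : Type*} [Field K] {N : ℕ} (u : K)

/-- The weights of the quantum trace. -/
def quantumWeight (N : ℕ) (a : Fin N) : K := u ^ ((N : ℤ) - 1 - 2 * (a : ℕ))

theorem pivotal_eq_torus (N n : ℕ) : pivotal u N n = torus (quantumWeight u N) n := rfl

/-- The quantum trace over the last strand. -/
def partialTrace (n : ℕ) : TensorEnd K N (n + 1) →ₗ[K] TensorEnd K N n where
  toFun M := Matrix.of fun f g => ∑ a, quantumWeight u N a * M (snocFun f a) (snocFun g a)
  map_add' M M' := by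
    ext f g
    simp only [Matrix.of_apply, Matrix.add_apply, mul_add, Finset.sum_add_distrib]
  map_smul' c M := by
    ext f g
    simp only [Matrix.of_apply, Matrix.smul_apply, smul_eq_mul, Finset.mul_sum, RingHom.id_apply]
    exact Finset.sum_congr rfl fun _ _ => mul_left_comm ..

theorem partialTrace_apply (n : ℕ) (M : TensorEnd K N (n + 1)) (f g : Fin n → Fin N) :
    partialTrace u n M f g = ∑ a, quantumWeight u N a * M (snocFun f a) (snocFun g a) := rfl

theorem trace_partialTrace (n : ℕ) (M : TensorEnd K N (n + 1)) :
    Matrix.trace (partialTrace u n M * torus (quantumWeight u N) n) =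
      Matrix.trace (M * torus (quantumWeight u N) (n + 1)) := by
  simp only [Matrix.trace, Matrix.diag_apply, torus, Matrix.mul_diagonal]
  rw [sum_snocFun, Finset.sum_comm]
  refine Finset.sum_congr rfl fun f _ => ?_
  rw [partialTrace_apply, Finset.sum_mul]
  refine Finset.sum_congr rfl fun a _ => ?_
  rw [prod_snocFun]
  ring

theorem partialTrace_extLast_mul (n : ℕ) (A : TensorEnd K N n) (M : TensorEnd K N (n + 1)) :
    partialTrace u n (extLast K N n A * M) = A * partialTrace u n M := by
  ext f g
  rw [partialTrace_apply, Matrix.mul_apply]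
  simp only [partialTrace_apply, Finset.mul_sum]
  rw [Finset.sum_comm]
  refine Finset.sum_congr rfl fun a _ => ?_
  rw [Matrix.mul_apply, sum_snocFun, Finset.sum_eq_single_of_mem a (Finset.mem_univ _),
    Finset.mul_sum]
  · refine Finset.sum_congr rfl fun h _ => ?_
    rw [extLast_apply, if_pos rfl]
    ring
  · intro c _ hc
    refine Finset.sum_eq_zero fun h _ => ?_
    rw [extLast_apply, if_neg hc.symm, zero_mul]

theorem partialTrace_mul_extLast (n : ℕ) (A : TensorEnd K N n) (M : TensorEnd K N (n + 1)) :
    partialTrace u n (M * extLast K N n A) = partialTrace u n M * A := by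
  ext f g
  rw [partialTrace_apply, Matrix.mul_apply]
  simp only [partialTrace_apply, Finset.sum_mul]
  rw [Finset.sum_comm]
  refine Finset.sum_congr rfl fun a _ => ?_
  rw [Matrix.mul_apply, sum_snocFun, Finset.sum_eq_single_of_mem a (Finset.mem_univ _),
    Finset.mul_sum]
  · refine Finset.sum_congr rfl fun h _ => ?_
    rw [extLast_apply, if_pos rfl]
    ring
  · intro c _ hc
    refine Finset.sum_eq_zero fun h _ => ?_
    rw [extLast_apply, if_neg hc, mul_zero]

theorem partialTrace_one (n : ℕ) :
    partialTrace u n (1 : TensorEnd K N (n + 1)) = (∑ a, quantumWeight u N a) • 1 := by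
  ext f g
  rw [partialTrace_apply, Matrix.smul_apply, smul_eq_mul, Finset.sum_mul]
  refine Finset.sum_congr rfl fun a _ => ?_
  rw [Matrix.one_apply, Matrix.one_apply]
  simp only [snocFun_inj, true_and]

variable {u}

theorem sum_quantumWeight (hu : u ≠ 0) {m : ℕ} (hm : m ≤ N) :
    ∑ a : Fin N, (if (a : ℕ) < m then (u - u⁻¹) * quantumWeight u N a else 0) =
      u ^ (N : ℤ) - u ^ ((N : ℤ) - 2 * m) := by
  have h : ∀ i : ℕ, (u - u⁻¹) * u ^ ((N : ℤ) - 1 - 2 * i) =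
      u ^ ((N : ℤ) - 2 * i) - u ^ ((N : ℤ) - 2 * (i + 1 : ℕ)) := by
    intro i
    have e1 : (N : ℤ) - 2 * i = ((N : ℤ) - 1 - 2 * i) + 1 := by ring
    have e2 : (N : ℤ) - 2 * (i + 1 : ℕ) = ((N : ℤ) - 1 - 2 * i) - 1 := by push_cast; ring
    rw [e1, e2, zpow_add_one₀ hu, zpow_sub_one₀ hu]
    ring
  simp only [quantumWeight]
  rw [← Finset.sum_range (fun i => if i < m then (u - u⁻¹) * u ^ ((N : ℤ) - 1 - 2 * (i : ℕ)) else 0),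
    ← Finset.sum_filter]
  have : (Finset.range N).filter (· < m) = Finset.range m := by
    ext; simp; omega
  rw [this, Finset.sum_congr rfl fun i _ => h i,
    Finset.sum_range_sub' (fun i : ℕ => u ^ ((N : ℤ) - 2 * i))]
  simp

/-- The scalar in front of M in `partialTrace_conj`, for boundary labels p and q. The sum over a
stops at min(p, q) and telescopes, so the same constant results in all three orderings. -/
theorem quantumWeight_identity (hu : u ≠ 0) (p q : Fin N) :
    (if p = q then quantumWeight u N p * (u ^ 2 - 1) else 0) +
        quantumWeight u N p * (u * rDiag u q p) + quantumWeight u N q * (rDiag u p q * u) +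
        ∑ a, quantumWeight u N a * (rDiag u p a * rDiag u q a) =
      u ^ ((N : ℤ) - 1) * (u ^ 2 - 1) := by
  have h : ∀ m : Fin N, m ≤ p → m ≤ q → (m = p ∨ m = q) →
      ∑ a, quantumWeight u N a * (rDiag u p a * rDiag u q a) =
        (u - u⁻¹) * (u ^ (N : ℤ) - u ^ ((N : ℤ) - 2 * (m : ℕ))) := by
    intro m hp hq hm
    rw [← sum_quantumWeight hu m.2.le, Finset.mul_sum]
    refine Finset.sum_congr rfl fun a _ => ?_
    rw [rDiag, rDiag]
    by_cases ham : a < m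
    · rw [if_pos (ham.trans_le hp), if_pos (ham.trans_le hq), if_pos (show (a : ℕ) < m from ham)]
      ring
    · rw [if_neg (show ¬(a : ℕ) < m from ham)]
      rcases hm with rfl | rfl
      · rw [if_neg ham]; ring
      · rw [if_neg ham]; ring
  have hw : ∀ m : Fin N, u ^ ((N : ℤ) - 2 * (m : ℕ)) = quantumWeight u N m * u := by
    intro m
    rw [quantumWeight, ← zpow_add_one₀ hu]
    congr 1
    ring
  have hN : u ^ (N : ℤ) = u ^ ((N : ℤ) - 1) * u := by
    rw [← zpow_add_one₀ hu, sub_add_cancel]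
  have hi : u⁻¹ * u = 1 := inv_mul_cancel₀ hu
  rcases lt_trichotomy p q with hpq | rfl | hpq
  · rw [h p le_rfl hpq.le (Or.inl rfl), if_neg hpq.ne, rDiag, rDiag, if_pos hpq,
      if_neg hpq.not_gt, hw, hN]
    linear_combination (-u ^ ((N : ℤ) - 1)) * hi
  · rw [h p le_rfl le_rfl (Or.inl rfl), if_pos rfl, rDiag_self, hw, hN]
    linear_combination (quantumWeight u N p - u ^ ((N : ℤ) - 1)) * hi
  · rw [h q hpq.le le_rfl (Or.inr rfl), if_neg hpq.ne', rDiag, rDiag, if_pos hpq,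
      if_neg hpq.not_gt, hw, hN]
    linear_combination (-u ^ ((N : ℤ) - 1)) * hi

/-- Summing over the label of the closed strand splits into the term where both R-matrices exchange
labels, which leaves the trace of M on one strand less, and terms proportional to M. This is the
recursion step for loops. -/
theorem partialTrace_conj (hu : u ≠ 0) (n : ℕ) (M : TensorEnd K N (n + 1)) :
    partialTrace u (n + 1)
        (braidGen u N (n + 2) n * extLast K N (n + 1) M * braidGen u N (n + 2) n) =
      extLast K N n (partialTrace u n M) + (u ^ ((N : ℤ) - 1) * (u ^ 2 - 1)) • M := by
  ext F G
  obtain ⟨f, p, rfl⟩ := exists_snocFun F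
  obtain ⟨g, q, rfl⟩ := exists_snocFun G
  rw [partialTrace_apply, Matrix.add_apply, Matrix.smul_apply, extLast_apply, smul_eq_mul,
    ← quantumWeight_identity hu p q, partialTrace_apply]
  rw [mul_assoc]
  simp only [braidGen_last_mul_apply]
  simp only [mul_braidGen_last_apply, extLast_apply, if_true]
  have h1 : ∀ a, quantumWeight u N a * (rOff u p a * (rOff u q a *
        (if p = q then M (snocFun f a) (snocFun g a) else 0) +
          rDiag u q a * (if p = a then M (snocFun f a) (snocFun g q) else 0)) +
        rDiag u p a * (rOff u q a * (if a = q then M (snocFun f p) (snocFun g a) else 0) +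
          rDiag u q a * M (snocFun f p) (snocFun g q))) =
      ((if p = q then quantumWeight u N a * M (snocFun f a) (snocFun g a) else 0) +
        (if p = a then if p = q then
          quantumWeight u N p * (u ^ 2 - 1) * M (snocFun f p) (snocFun g q) else 0 else 0)) +
      (if p = a then quantumWeight u N p * (u * rDiag u q p) * M (snocFun f p) (snocFun g q)
        else 0) +
      (if q = a then quantumWeight u N q * (rDiag u p q * u) * M (snocFun f p) (snocFun g q)
        else 0) +
      quantumWeight u N a * (rDiag u p a * rDiag u q a) * M (snocFun f p) (snocFun g q) := by
    intro a
    have e1 : (if p = q then quantumWeight u N a * M (snocFun f a) (snocFun g a) else 0) +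
        (if p = a then if p = q then
          quantumWeight u N p * (u ^ 2 - 1) * M (snocFun f p) (snocFun g q) else 0 else 0) =
        quantumWeight u N a * (rOff u p a * (rOff u q a *
          (if p = q then M (snocFun f a) (snocFun g a) else 0))) := by
      by_cases hpq : p = q
      · subst hpq
        by_cases hpa : p = a
        · subst hpa
          simp only [if_true, rOff]
          ring
        · simp [hpa, rOff]
      · simp [hpq]
    have e2 : (if p = a then quantumWeight u N p * (u * rDiag u q p) *
        M (snocFun f p) (snocFun g q) else 0) = quantumWeight u N a * (rOff u p a *
          (rDiag u q a * (if p = a then M (snocFun f a) (snocFun g q) else 0))) := by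
      by_cases hpa : p = a
      · subst hpa
        simp only [if_true, rOff]
        ring
      · simp [hpa]
    have e3 : (if q = a then quantumWeight u N q * (rDiag u p q * u) *
        M (snocFun f p) (snocFun g q) else 0) = quantumWeight u N a * (rDiag u p a *
          (rOff u q a * (if a = q then M (snocFun f p) (snocFun g a) else 0))) := by
      by_cases hqa : q = a
      · subst hqa
        simp only [if_true, rOff]
        ring
      · simp [hqa, Ne.symm hqa]
    rw [e1, e2, e3]
    ring
  rw [Finset.sum_congr rfl fun a _ => h1 a]
  simp only [Finset.sum_add_distrib, Finset.sum_ite_eq, Finset.mem_univ, if_true, add_mul,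
    Finset.sum_mul, ite_mul, zero_mul]
  have h2 : (∑ a, if p = q then quantumWeight u N a * M (snocFun f a) (snocFun g a) else 0) =
      if p = q then ∑ a, quantumWeight u N a * M (snocFun f a) (snocFun g a) else 0 := by
    split_ifs <;> simp
  rw [h2]
  ring

end PartialTrace

/-! ### Elements of the braid algebra -/

section BraidAlgebra

variable {K : Type*} [Field K] (u : K) (N : ℕ)

/-- The action of a linear combination of braids on the strands from `a` on. -/
def braidAct (k a : ℕ) : FreeAlgebra K ℕ →ₐ[K] TensorEnd K N k :=
  FreeAlgebra.lift K fun i => braidGen u N k (a + i)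

theorem braidAct_ι (k a i : ℕ) : braidAct u N k a (FreeAlgebra.ι K i) = braidGen u N k (a + i) :=
  FreeAlgebra.lift_ι_apply _ _

variable (K) in
/-- The linear combinations of braids on `n` strands. -/
def braidAlgebra (n : ℕ) : Subalgebra K (FreeAlgebra K ℕ) :=
  Algebra.adjoin K (FreeAlgebra.ι K '' {i | i + 1 < n})

variable (K) in
/-- The Jucys-Murphy braid in the braid algebra. -/
def murphyElem (n : ℕ) : FreeAlgebra K ℕ := murphy (FreeAlgebra.ι K) 0 n

theorem ι_mem_braidAlgebra {i n : ℕ} (h : i + 1 < n) : FreeAlgebra.ι K i ∈ braidAlgebra K n :=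
  Algebra.subset_adjoin ⟨i, h, rfl⟩

theorem braidAlgebra_mono {n m : ℕ} (h : n ≤ m) : braidAlgebra K n ≤ braidAlgebra K m :=
  Algebra.adjoin_mono (Set.image_mono fun i (hi : i + 1 < n) => show i + 1 < m by omega)

theorem murphyElem_mem (n : ℕ) : murphyElem K n ∈ braidAlgebra K (n + 1) := by
  induction n with
  | zero =>
    rw [murphyElem, murphy_zero]
    exact one_mem _
  | succ n ih =>
    rw [murphyElem, murphy_succ, zero_add]
    have h : FreeAlgebra.ι K n ∈ braidAlgebra K (n + 1 + 1) := ι_mem_braidAlgebra (by omega)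
    exact mul_mem (mul_mem h (braidAlgebra_mono (by omega) ih)) h

theorem braidAct_murphyElem (k a n : ℕ) :
    braidAct u N k a (murphyElem K n) = murphy (braidGen u N k) a n := by
  rw [murphyElem, map_murphy, murphy, murphy]
  congr 1
  · exact desc_congr fun i _ => by rw [braidAct_ι, zero_add]
  · exact asc_congr fun i _ => by rw [braidAct_ι, zero_add]

theorem extLast_braidAct {k a n : ℕ} (h : a + n ≤ k) {A : FreeAlgebra K ℕ}
    (hA : A ∈ braidAlgebra K n) : extLast K N k (braidAct u N k a A) = braidAct u N (k + 1) a A := by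
  have : braidAlgebra K n ≤ AlgHom.equalizer ((extLast K N k).comp (braidAct u N k a))
      (braidAct u N (k + 1) a) := by
    refine Algebra.adjoin_le ?_
    rintro _ ⟨i, hi, rfl⟩
    simp only [Set.mem_ofPred_eq] at hi
    simp only [SetLike.mem_coe, AlgHom.mem_equalizer, AlgHom.comp_apply, braidAct_ι]
    exact extLast_braidGen u (by omega)
  exact this hA

theorem commute_braidAct {k a n : ℕ} {X : TensorEnd K N k}
    (hX : ∀ i, i + 1 < n → Commute (braidGen u N k (a + i)) X) {A : FreeAlgebra K ℕ}
    (hA : A ∈ braidAlgebra K n) : Commute (braidAct u N k a A) X := by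
  induction hA using Algebra.adjoin_induction with
  | mem x hx =>
    obtain ⟨i, hi, rfl⟩ := hx
    rw [braidAct_ι]
    exact hX i hi
  | algebraMap c =>
    rw [AlgHom.commutes]
    exact Algebra.commutes c X
  | add x y _ _ hx hy =>
    rw [map_add]
    exact hx.add_left hy
  | mul x y _ _ hx hy =>
    rw [map_mul]
    exact hx.mul_left hy

theorem braidAct_mul_eq {k a b n : ℕ} {X : TensorEnd K N k}
    (hX : ∀ i, i + 1 < n → braidGen u N k (a + i) * X = X * braidGen u N k (b + i))
    {A : FreeAlgebra K ℕ} (hA : A ∈ braidAlgebra K n) :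
    braidAct u N k a A * X = X * braidAct u N k b A := by
  induction hA using Algebra.adjoin_induction with
  | mem x hx =>
    obtain ⟨i, hi, rfl⟩ := hx
    rw [braidAct_ι, braidAct_ι]
    exact hX i hi
  | algebraMap c =>
    rw [AlgHom.commutes, AlgHom.commutes]
    exact Algebra.commutes c X
  | add x y _ _ hx hy => rw [map_add, map_add, add_mul, mul_add, hx, hy]
  | mul x y _ _ hx hy => rw [map_mul, map_mul, mul_assoc, hy, ← mul_assoc, hx, mul_assoc]

/-- The element of the braid algebra that acts as a closed loop around `n` strands. -/
def encircle (n : ℕ) : FreeAlgebra K ℕ :=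
  (∑ a, quantumWeight u N a) • 1 +
    (u ^ ((N : ℤ) - 1) * (u ^ 2 - 1)) • ∑ k ∈ Finset.range n, murphyElem K k

theorem encircle_mem (n : ℕ) : encircle u N n ∈ braidAlgebra K n :=
  add_mem (Subalgebra.smul_mem _ (one_mem _) _) (Subalgebra.smul_mem _ (sum_mem fun k hk =>
    braidAlgebra_mono (Finset.mem_range.1 hk) (murphyElem_mem k)) _)

theorem encircle_succ (n : ℕ) : encircle u N (n + 1) =
    encircle u N n + (u ^ ((N : ℤ) - 1) * (u ^ 2 - 1)) • murphyElem K n := by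
  rw [encircle, encircle, Finset.sum_range_succ, smul_add, add_assoc]

variable {u}

/-- Unroll `partialTrace_conj` along J_{n+1} = T_n J_n T_n. The start is the quantum dimension, and
every step adds a multiple of a Jucys-Murphy element. -/
theorem partialTrace_murphy (hu : u ≠ 0) (a n : ℕ) :
    partialTrace u (a + n) (murphy (braidGen u N (a + n + 1)) a n) =
      braidAct u N (a + n) a (encircle u N n) := by
  induction n with
  | zero =>
    rw [murphy_zero, partialTrace_one, encircle, Finset.sum_range_zero, smul_zero, add_zero, add_zero,
      map_smul, map_one]
  | succ n ih =>
    have h : murphy (braidGen u N (a + n + 1 + 1)) a n =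
        extLast K N (a + n + 1) (murphy (braidGen u N (a + n + 1)) a n) := by
      rw [murphy, murphy, map_mul, extLast_desc u (by omega), extLast_asc u (by omega)]
    have e : partialTrace u (a + n + 1) (murphy (braidGen u N (a + n + 1 + 1)) a (n + 1)) =
      braidAct u N (a + n + 1) a (encircle u N (n + 1)) := by
      rw [murphy_succ, h, partialTrace_conj hu, ih, extLast_braidAct u N le_rfl (encircle_mem u N n),
        encircle_succ, map_add, map_smul, braidAct_murphyElem]
    exact e

theorem partialTrace_murphy_eq (hu : u ≠ 0) {a n k : ℕ} (hk : a + n = k) :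
    partialTrace u k (murphy (braidGen u N (k + 1)) a n) = braidAct u N k a (encircle u N n) := by
  subst hk
  exact partialTrace_murphy N hu a n

/-- The loop is the closure of the strand going around, whose two halves are a passing strand and
its transpose; d is the closed label and c the label between the halves. -/
theorem encircle_eq_sum_passBlock (hu : u ≠ 0) (n : ℕ) :
    braidAct u N n 0 (encircle u N n) = ∑ d : Fin N, quantumWeight u N d •
      ∑ c, passBlock u n d c * (passBlock u n d c).transpose := by
  rw [← partialTrace_murphy_eq N hu (zero_add n)]
  ext f g
  rw [partialTrace_apply]
  simp only [Matrix.sum_apply, Matrix.smul_apply, smul_eq_mul]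
  refine Finset.sum_congr rfl fun d _ => ?_
  rw [murphy, Matrix.mul_apply, sum_consFun]
  congr 1
  refine Finset.sum_congr rfl fun c _ => ?_
  rw [Matrix.mul_apply]
  refine Finset.sum_congr rfl fun h _ => ?_
  rw [asc_apply]
  rfl

end BraidAlgebra

/-! ### The weight characters of operators -/

section WeightCharacter

variable {K : Type*} [Field K] {N : ℕ}

theorem alternant_bot_eq (x : Fin N → K) : alternant x (shifted N ⊥) =
    ((Equiv.Perm.sign (Fin.revPerm : Equiv.Perm (Fin N)) : ℤ) : K) *
      ∏ i, ∏ j ∈ Finset.Ioi i, (x j - x i) := by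
  rw [← Matrix.det_vandermonde, ← Matrix.det_permute', alternant]
  congr 1
  ext i j
  simp only [Matrix.of_apply, Matrix.submatrix_apply, Matrix.vandermonde_apply, id,
    Fin.revPerm_apply, Fin.val_rev, shifted_bot]
  congr 1
  omega

/-- Only the differences that contain x_i change. The coefficients of the Macdonald sum are thus
quotients of Weyl denominators, up to a power of q. -/
theorem alternant_bot_update (q : K) {x : Fin N → K} (hx : Function.Injective x) (i : Fin N) :
    alternant (Function.update x i (q * x i)) (shifted N ⊥) =
      alternant x (shifted N ⊥) * ∏ j ∈ Finset.univ.erase i, (q * x i - x j) / (x i - x j) := by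
  set r := fun j => (q * x i - x j) / (x i - x j) with hr
  have h1 : ∀ a, ∀ b ∈ Finset.Ioi a,
      Function.update x i (q * x i) b - Function.update x i (q * x i) a =
      (x b - x a) * ((if a = i then r b else 1) * if b = i then r a else 1) := by
    intro a b hb
    rw [Finset.mem_Ioi] at hb
    rw [Function.update_apply, Function.update_apply]
    have hne : x b - x a ≠ 0 := sub_ne_zero.2 fun h => hb.ne' (hx h)
    by_cases ha : a = i
    · have hbi : b ≠ i := fun h => hb.ne (ha.trans h.symm)
      rw [if_pos ha, if_neg hbi, if_pos ha, if_neg hbi, mul_one]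
      rw [ha] at hne ⊢
      have hne' : x i - x b ≠ 0 := by rw [← neg_sub]; exact neg_ne_zero.2 hne
      simp only [hr]
      field_simp
      ring
    · by_cases hbi : b = i
      · rw [if_neg ha, if_pos hbi, if_neg ha, if_pos hbi, one_mul]
        rw [hbi] at hne ⊢
        simp only [hr]
        field_simp
      · simp [ha, hbi]
  rw [alternant_bot_eq, alternant_bot_eq, mul_assoc]
  congr 1
  rw [Finset.prod_congr rfl fun a _ => Finset.prod_congr rfl (h1 a)]
  simp only [Finset.prod_mul_distrib]
  congr 1
  have h2 : ∀ a, (∏ b ∈ Finset.Ioi a, if a = i then r b else 1) =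
      if a = i then ∏ b ∈ Finset.Ioi i, r b else 1 := by
    intro a
    split_ifs with h
    · rw [h]
    · exact Finset.prod_const_one
  have h3 : ∀ a, (∏ b ∈ Finset.Ioi a, if b = i then r a else 1) =
      if a ∈ Finset.Iio i then r a else 1 := by
    intro a
    rw [Finset.prod_ite_eq' (Finset.Ioi a) i fun _ => r a]
    simp only [Finset.mem_Ioi, Finset.mem_Iio]
  simp only [h2, h3]
  rw [Finset.prod_ite_eq' Finset.univ i, if_pos (Finset.mem_univ _), Finset.prod_ite_mem,
    Finset.univ_inter, ← Finset.prod_union]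
  · congr 1
    ext j
    simp only [Finset.mem_union, Finset.mem_Ioi, Finset.mem_Iio, Finset.mem_erase, Finset.mem_univ,
      and_true]
    rw [ne_iff_lt_or_gt, or_comm]
  · rw [Finset.disjoint_left]
    intro j hj hj'
    rw [Finset.mem_Ioi] at hj
    rw [Finset.mem_Iio] at hj'
    exact hj.not_gt hj'

/-- The character of an operator on the weight spaces, times the Weyl denominator. -/
def altCharacter (n : ℕ) : TensorEnd K N n →ₗ[K] MvPolynomial (Fin N) K where
  toFun M := altPoly (shifted N ⊥) *
    ∑ f : Fin n → Fin N, MvPolynomial.C (M f f) * ∏ i, MvPolynomial.X (f i)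
  map_add' M M' := by
    rw [← mul_add, ← Finset.sum_add_distrib]
    refine congrArg _ (Finset.sum_congr rfl fun f _ => ?_)
    rw [Matrix.add_apply, MvPolynomial.C_add, add_mul]
  map_smul' c M := by
    rw [RingHom.id_apply, MvPolynomial.smul_eq_C_mul, mul_left_comm]
    refine congrArg _ ?_
    rw [Finset.mul_sum]
    refine Finset.sum_congr rfl fun f _ => ?_
    rw [Matrix.smul_apply, smul_eq_mul, MvPolynomial.C_mul, mul_assoc]

theorem altCharacter_apply (n : ℕ) (M : TensorEnd K N n) : altCharacter n M =
    altPoly (shifted N ⊥) * ∑ f, MvPolynomial.C (M f f) * ∏ i, MvPolynomial.X (f i) := rfl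

theorem eval_altCharacter (x : Fin N → K) (n : ℕ) (M : TensorEnd K N n) :
    MvPolynomial.eval x (altCharacter n M) =
      alternant x (shifted N ⊥) * Matrix.trace (M * torus x n) := by
  rw [altCharacter_apply, map_mul, eval_altPoly, map_sum, Matrix.trace]
  congr 1
  refine Finset.sum_congr rfl fun f _ => ?_
  rw [Matrix.diag_apply, torus, Matrix.mul_diagonal]
  simp

theorem altCharacter_one_zero :
    altCharacter 0 (1 : TensorEnd K N 0) = altPoly (shifted N ⊥) := by
  rw [altCharacter_apply, Fintype.sum_unique]
  simp

theorem altCharacter_extLast (n : ℕ) (M : TensorEnd K N n) :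
    altCharacter (n + 1) (extLast K N n M) = (∑ i, MvPolynomial.X i) * altCharacter n M := by
  rw [altCharacter_apply, altCharacter_apply, mul_left_comm, sum_snocFun, Finset.sum_mul]
  congr 1
  refine Finset.sum_congr rfl fun a _ => ?_
  rw [Finset.mul_sum]
  refine Finset.sum_congr rfl fun f _ => ?_
  rw [extLast_apply, if_pos rfl, prod_snocFun]
  ring

/-- The sum of the operators that multiply one of the variables by `q`. -/
def scaleSum (q : K) : MvPolynomial (Fin N) K →ₗ[K] MvPolynomial (Fin N) K :=
  (MvPolynomial.basisMonomials (Fin N) K).constr K fun e =>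
    (∑ i, q ^ e i) • MvPolynomial.monomial e 1

theorem scaleSum_monomial (q : K) (e : Fin N →₀ ℕ) (a : K) :
    scaleSum q (MvPolynomial.monomial e a) = (∑ i, q ^ e i) • MvPolynomial.monomial e a := by
  have h1 : MvPolynomial.monomial e a = a • MvPolynomial.basisMonomials (Fin N) K e := by
    rw [MvPolynomial.coe_basisMonomials, MvPolynomial.smul_monomial, smul_eq_mul, mul_one]
  rw [h1, map_smul, scaleSum, Module.Basis.constr_basis, MvPolynomial.coe_basisMonomials, smul_comm]

theorem eval_scaleSum (q : K) (x : Fin N → K) (P : MvPolynomial (Fin N) K) :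
    MvPolynomial.eval x (scaleSum q P) =
      ∑ i, MvPolynomial.eval (Function.update x i (q * x i)) P := by
  induction P using MvPolynomial.induction_on' with
  | monomial e a =>
    rw [scaleSum_monomial, MvPolynomial.smul_eval, Finset.sum_mul]
    refine Finset.sum_congr rfl fun i _ => ?_
    have h : ∀ j ∈ Finset.univ.erase i, Function.update x i (q * x i) j ^ e j = x j ^ e j :=
      fun j hj => by rw [Function.update_of_ne (Finset.ne_of_mem_erase hj)]
    rw [MvPolynomial.eval_monomial, MvPolynomial.eval_monomial, Finsupp.prod_fintype _ _ fun _ =>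
      pow_zero _, Finsupp.prod_fintype _ _ fun _ => pow_zero _, ← Finset.mul_prod_erase Finset.univ _
      (Finset.mem_univ i), ← Finset.mul_prod_erase Finset.univ
      (fun j => Function.update x i (q * x i) j ^ e j) (Finset.mem_univ i), Function.update_self,
      Finset.prod_congr rfl h, mul_pow]
    ring
  | add p r hp hr => simp only [map_add, hp, hr, Finset.sum_add_distrib]

variable {u : K}

theorem commute_braidAct_passBlock_transpose (hu : u ≠ 0) (n a : ℕ) (A : FreeAlgebra K ℕ)
    (d b : Fin N) : Commute (braidAct u N n a A) (passBlock u n d b).transpose := by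
  induction A using FreeAlgebra.induction with
  | grade0 c => rw [AlgHom.commutes]; exact Algebra.commutes c _
  | grade1 i => rw [braidAct_ι]; exact commute_braidGen_passBlock_transpose u hu n _ d b
  | mul x y hx hy => rw [map_mul]; exact hx.mul_left hy
  | add x y hx hy => rw [map_add]; exact hx.add_left hy

variable [CharZero K]

/-- `trace_encircle` expresses the trace through the shifts x_i ↦ q x_i with Macdonald coefficients.
Multiplication by the Weyl denominator absorbs these coefficients and leaves the plain sum of the
shifts. -/
theorem altCharacter_mul_encircle (hu : u ≠ 0) (n : ℕ) (A : FreeAlgebra K ℕ) :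
    altCharacter n (braidAct u N n 0 (A * encircle u N n)) =
      u ^ (1 - (N : ℤ)) • scaleSum (u ^ 2) (altCharacter n (braidAct u N n 0 A)) := by
  -- `trace_encircle` needs distinct non-zero coordinates. This non-zero factor vanishes at all
  -- other points, so the identity can be tested everywhere.
  have hne : (altPoly (shifted N ⊥) * ∏ i, MvPolynomial.X i : MvPolynomial (Fin N) K) ≠ 0 := by
    refine mul_ne_zero (fun h => ?_) (Finset.prod_ne_zero_iff.2 fun i _ => MvPolynomial.X_ne_zero i)
    have h1 := congrArg (MvPolynomial.eval fun i : Fin N => ((i : ℕ) : K)) h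
    rw [eval_altPoly, map_zero] at h1
    exact alternant_bot_ne_zero (fun i j hij => Fin.ext (Nat.cast_injective hij)) h1
  apply mul_left_cancel₀ hne
  apply MvPolynomial.funext
  intro x
  rw [map_mul, map_mul _ _ (u ^ (1 - (N : ℤ)) • _), map_mul, eval_altPoly, map_prod]
  by_cases hx : Function.Injective x
  swap
  · have h0 : alternant x (shifted N ⊥) = 0 := by
      rw [Function.Injective] at hx
      push Not at hx
      obtain ⟨i, j, hij, hne⟩ := hx
      refine Matrix.det_zero_of_row_eq hne ?_
      ext k
      simp only [Matrix.of_apply, hij]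
    rw [h0, zero_mul, zero_mul, zero_mul]
  by_cases hx0 : ∀ i, x i ≠ 0
  swap
  · push Not at hx0
    obtain ⟨i, hi⟩ := hx0
    have h0 : ∏ i, MvPolynomial.eval x (MvPolynomial.X i) = 0 :=
      Finset.prod_eq_zero (Finset.mem_univ i) (by rw [MvPolynomial.eval_X, hi])
    rw [h0, mul_zero, zero_mul, zero_mul]
  congr 1
  rw [MvPolynomial.smul_eval, eval_scaleSum, eval_altCharacter]
  simp only [eval_altCharacter, alternant_bot_update _ hx]
  have h1 := trace_encircle u hu hx hx0
    (commute_braidAct_passBlock_transpose (N := N) hu n 0 A)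
  have hu2 : u ^ 2 ≠ 0 := pow_ne_zero 2 hu
  have h2 : ∀ d : Fin N, quantumWeight u N d = u ^ ((N : ℤ) - 1) * (u ^ 2)⁻¹ ^ (d : ℕ) := by
    intro d
    rw [quantumWeight, zpow_sub₀ hu, zpow_mul, div_eq_mul_inv, zpow_natCast, inv_pow]
    norm_cast
  have h3 : Matrix.trace (braidAct u N n 0 (A * encircle u N n) * torus x n) =
      u ^ ((N : ℤ) - 1) * macdonaldSum (u ^ 2)⁻¹ x
        (fun i => Matrix.trace (braidAct u N n 0 A *
          torus (Function.update x i (u ^ 2 * x i)) n)) Finset.univ := by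
    rw [← h1, map_mul, encircle_eq_sum_passBlock N hu, Finset.mul_sum, Finset.sum_mul,
      Matrix.trace_sum, Finset.mul_sum]
    refine Finset.sum_congr rfl fun d _ => ?_
    rw [Matrix.mul_smul, Matrix.smul_mul, Matrix.trace_smul, smul_eq_mul, h2, mul_assoc,
      Finset.mul_sum, Finset.sum_mul, Matrix.trace_sum]
  rw [h3, macdonaldSum, Finset.mul_sum, Finset.mul_sum, Finset.mul_sum]
  refine Finset.sum_congr rfl fun i _ => ?_
  have h4 : ∏ j ∈ Finset.univ.erase i, (u ^ 2 * x i - x j) / (x i - x j) =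
      (u ^ 2) ^ ((N : ℤ) - 1) * ∏ j ∈ Finset.univ.erase i,
        (x i - (u ^ 2)⁻¹ * x j) / (x i - x j) := by
    have e : ∀ j, (u ^ 2 * x i - x j) / (x i - x j) =
        u ^ 2 * ((x i - (u ^ 2)⁻¹ * x j) / (x i - x j)) := by
      intro j
      rw [← mul_div_assoc, mul_sub, mul_inv_cancel_left₀ hu2]
    have hi := i.2
    rw [Finset.prod_congr rfl fun j _ => e j, Finset.prod_mul_distrib, Finset.prod_const,
      Finset.card_erase_of_mem (Finset.mem_univ i), Finset.card_univ, Fintype.card_fin,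
      ← zpow_natCast, Nat.cast_sub (by omega), Nat.cast_one]
  rw [h4]
  have h5 : u ^ ((N : ℤ) - 1) = u ^ (1 - (N : ℤ)) * (u ^ 2) ^ ((N : ℤ) - 1) := by
    rw [← zpow_natCast u 2, ← zpow_mul, ← zpow_add₀ hu]
    congr 1
    push_cast
    ring
  rw [h5]
  ring

end WeightCharacter

/-! ### The Hopf link as a pairing of characters -/

section Pairing

variable {K : Type*} [Field K] {N : ℕ}

/-- The pairing `⟨x ^ e, Q⟩ = Q (q ^ e)`. -/
def powPairing (q : K) (Q : MvPolynomial (Fin N) K) : MvPolynomial (Fin N) K →ₗ[K] K :=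
  (MvPolynomial.basisMonomials (Fin N) K).constr K fun e =>
    MvPolynomial.eval (fun i => q ^ e i) Q

theorem powPairing_monomial (q : K) (Q : MvPolynomial (Fin N) K) (e : Fin N →₀ ℕ) (a : K) :
    powPairing q Q (MvPolynomial.monomial e a) = a * MvPolynomial.eval (fun i => q ^ e i) Q := by
  have h1 : MvPolynomial.monomial e a = a • MvPolynomial.basisMonomials (Fin N) K e := by
    rw [MvPolynomial.coe_basisMonomials, MvPolynomial.smul_monomial, smul_eq_mul, mul_one]
  rw [h1, map_smul, powPairing, Module.Basis.constr_basis, smul_eq_mul]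

theorem powPairing_smul_right (q c : K) (Q P : MvPolynomial (Fin N) K) :
    powPairing q (c • Q) P = c * powPairing q Q P := by
  induction P using MvPolynomial.induction_on' with
  | monomial e a =>
    rw [powPairing_monomial, powPairing_monomial, MvPolynomial.smul_eval]
    ring
  | add p r hp hr => rw [map_add, map_add, hp, hr, mul_add]

theorem powPairing_zero_right (q : K) (P : MvPolynomial (Fin N) K) : powPairing q 0 P = 0 := by
  have := powPairing_smul_right q 0 0 P
  rwa [zero_smul, zero_mul] at this

/-- Adding a unit vector to e multiplies one coordinate of q^e by q, so p_1 and `scaleSum` are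
adjoint; `powPairing_scaleSum` is the same in the other argument. -/
theorem powPairing_psum_mul (q : K) (Q P : MvPolynomial (Fin N) K) :
    powPairing q Q ((∑ i, MvPolynomial.X i) * P) = powPairing q (scaleSum q Q) P := by
  induction P using MvPolynomial.induction_on' with
  | monomial e a =>
    rw [powPairing_monomial, eval_scaleSum, Finset.sum_mul, map_sum, Finset.mul_sum]
    refine Finset.sum_congr rfl fun i _ => ?_
    rw [MvPolynomial.X, MvPolynomial.monomial_mul, powPairing_monomial, one_mul]
    refine congrArg (fun y => a * MvPolynomial.eval y Q) (funext fun j => ?_)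
    rw [Finsupp.add_apply, Function.update_apply, pow_add]
    split_ifs with h
    · rw [h, Finsupp.single_eq_same, pow_one]
    · rw [Finsupp.single_eq_of_ne h, pow_zero, one_mul]
  | add p r hp hr => rw [mul_add, map_add, map_add, hp, hr]

theorem powPairing_scaleSum (q : K) (Q P : MvPolynomial (Fin N) K) :
    powPairing q Q (scaleSum q P) = powPairing q ((∑ i, MvPolynomial.X i) * Q) P := by
  induction P using MvPolynomial.induction_on' with
  | monomial e a =>
    rw [scaleSum_monomial, map_smul, powPairing_monomial, powPairing_monomial, map_mul, map_sum,
      smul_eq_mul]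
    simp only [MvPolynomial.eval_X]
    ring
  | add p r hp hr => rw [map_add, map_add, map_add, hp, hr]

/-- Alternating polynomials. -/
def IsAlternating (P : MvPolynomial (Fin N) K) : Prop :=
  ∀ (x : Fin N → K) (s : Equiv.Perm (Fin N)),
    MvPolynomial.eval (x ∘ s) P = ((Equiv.Perm.sign s : ℤ) : K) * MvPolynomial.eval x P

theorem alternant_comp_perm (x : Fin N → K) (a : Fin N → ℕ) (s : Equiv.Perm (Fin N)) :
    alternant (x ∘ s) a = ((Equiv.Perm.sign s : ℤ) : K) * alternant x a := by
  rw [alternant, alternant, ← Matrix.det_permute]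
  rfl

theorem isAlternating_altPoly (a : Fin N → ℕ) :
    IsAlternating (altPoly a : MvPolynomial (Fin N) K) := fun x s => by
  rw [eval_altPoly, eval_altPoly, alternant_comp_perm]

theorem IsAlternating.psum_mul {P : MvPolynomial (Fin N) K} (h : IsAlternating P) :
    IsAlternating ((∑ i, MvPolynomial.X i) * P) := fun x s => by
  rw [map_mul, map_mul, h x s, map_sum, map_sum]
  simp only [MvPolynomial.eval_X, Function.comp_apply]
  rw [Equiv.sum_comp s x]
  ring

theorem IsAlternating.smul {P : MvPolynomial (Fin N) K} (h : IsAlternating P) (c : K) :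
    IsAlternating (c • P) := fun x s => by
  rw [MvPolynomial.smul_eval, MvPolynomial.smul_eval, h x s, mul_left_comm]

theorem IsAlternating.scaleSum {P : MvPolynomial (Fin N) K} (h : IsAlternating P) (q : K) :
    IsAlternating (scaleSum q P) := fun x s => by
  rw [eval_scaleSum, eval_scaleSum, Finset.mul_sum]
  conv_rhs => rw [← Equiv.sum_comp s]
  refine Finset.sum_congr rfl fun i _ => ?_
  rw [← h _ s]
  congr 2
  ext j
  simp only [Function.comp_apply, Function.update_apply, s.injective.eq_iff]

/-- The sign of a permuted monomial cancels the sign of the alternating Q, so all N! terms are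
equal. -/
theorem powPairing_altPoly (q : K) {Q : MvPolynomial (Fin N) K} (hQ : IsAlternating Q)
    (a : Fin N → ℕ) :
    powPairing q Q (altPoly a) = (N.factorial : K) * MvPolynomial.eval (fun i => q ^ a i) Q := by
  have h : ∀ s : Equiv.Perm (Fin N), powPairing q Q
      (((Equiv.Perm.sign s : ℤ) : K) • mono (a ∘ s)) = MvPolynomial.eval (fun i => q ^ a i) Q := by
    intro s
    rw [map_smul, mono, powPairing_monomial, one_mul, smul_eq_mul]
    have := hQ (fun i => q ^ a i) s
    have e : (fun i => q ^ (Finsupp.equivFunOnFinite.symm (a ∘ s)) i) = (fun i => q ^ a i) ∘ s :=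
      rfl
    rw [e, this, ← mul_assoc]
    rcases Int.units_eq_one_or (Equiv.Perm.sign s) with h | h <;> simp [h]
  rw [altPoly_eq_sum, map_sum, Finset.sum_congr rfl fun s _ => h s, Finset.sum_const,
    Finset.card_univ, Fintype.card_perm, Fintype.card_fin, nsmul_eq_mul]

end Pairing

/-! ### The Hopf link with arbitrary insertions. -/

section HopfTrace

variable {K : Type*} [Field K] (u : K) (N : ℕ)

/-- The quantum trace of the Hopf link of an `n`-cable and an `m`-cable with insertions. -/
def hopfTrace (k n m : ℕ) (A B : FreeAlgebra K ℕ) : K :=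
  Matrix.trace (braidAct u N k 0 A * braidAct u N k n B *
    (cross (braidGen u N k) n m * cross (braidGen u N k) m n) * torus (quantumWeight u N) k)

variable {u}

theorem commute_braidAct_braidAct {k n m : ℕ} {A B : FreeAlgebra K ℕ}
    (hA : A ∈ braidAlgebra K n) (hB : B ∈ braidAlgebra K m) :
    Commute (braidAct u N k 0 A) (braidAct u N k n B) := by
  refine commute_braidAct u N (fun i hi => ?_) hA
  refine (commute_braidAct u N (fun j _ => ?_) hB).symm
  exact (commute_braidGen u N k (by omega)).symm

theorem braidAct_mul_cross (hu : u ≠ 0) {k n m : ℕ} (hk : n + m ≤ k) {A : FreeAlgebra K ℕ}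
    (hA : A ∈ braidAlgebra K n) : braidAct u N k 0 A * cross (braidGen u N k) n m =
      cross (braidGen u N k) n m * braidAct u N k m A := by
  refine braidAct_mul_eq u N (fun i hi => ?_) hA
  rw [zero_add, add_comm m i]
  exact (isBraided_braidGen N hu k).mul_cross_left hi hk

theorem braidAct_mul_cross' (hu : u ≠ 0) {k n m : ℕ} (hk : n + m ≤ k) {B : FreeAlgebra K ℕ}
    (hB : B ∈ braidAlgebra K m) : braidAct u N k n B * cross (braidGen u N k) n m =
      cross (braidGen u N k) n m * braidAct u N k 0 B := by
  refine braidAct_mul_eq u N (fun i hi => ?_) hB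
  rw [zero_add]
  exact (isBraided_braidGen N hu k).mul_cross_right hi hk

/-- Slide both insertions through the first crossing of the cables and move that crossing around the
trace; it commutes with the quantum weights. -/
theorem hopfTrace_comm (hu : u ≠ 0) {k n m : ℕ} (hk : n + m ≤ k) {A B : FreeAlgebra K ℕ}
    (hA : A ∈ braidAlgebra K n) (hB : B ∈ braidAlgebra K m) :
    hopfTrace u N k n m A B = hopfTrace u N k m n B A := by
  have h1 := braidAct_mul_cross N hu hk hA
  have h2 := braidAct_mul_cross' N hu hk hB
  have h3 : Commute (torus (quantumWeight u N) k) (cross (braidGen u N k) n m) :=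
    commute_cross fun i _ => commute_torus_braidGen u _ k i
  have h4 := commute_braidAct_braidAct (u := u) N (k := k) hB hA
  rw [hopfTrace, hopfTrace]
  set c := cross (braidGen u N k) n m
  set c' := cross (braidGen u N k) m n
  set D := torus (quantumWeight u N) k
  calc Matrix.trace (braidAct u N k 0 A * braidAct u N k n B * (c * c') * D)
      = Matrix.trace (braidAct u N k 0 A * (braidAct u N k n B * c) * c' * D) := by
        simp only [mul_assoc]
    _ = Matrix.trace ((braidAct u N k 0 A * c) * braidAct u N k 0 B * c' * D) := by
        rw [h2]; simp only [mul_assoc]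
    _ = Matrix.trace (c * (braidAct u N k m A * braidAct u N k 0 B * c' * D)) := by
        rw [h1]; simp only [mul_assoc]
    _ = Matrix.trace (braidAct u N k m A * braidAct u N k 0 B * c' * (D * c)) := by
        rw [Matrix.trace_mul_comm]; simp only [mul_assoc]
    _ = _ := by
        rw [h3.eq, ← h4.eq]; simp only [mul_assoc]

theorem extLast_cross {k n m : ℕ} (hk : n + m ≤ k) :
    extLast K N k (cross (braidGen u N k) n m) = cross (braidGen u N (k + 1)) n m := by
  induction m with
  | zero => exact map_one _
  | succ m ih =>
    rw [cross_succ, map_mul, ih (by omega), map_desc, cross_succ]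
    congr 1
    exact desc_congr fun i hi => extLast_braidGen u (by omega)

/-- A strand of the second cable that carries no insertion closes to a loop around the first cable.
Algebraically, its partial quantum trace is the trace of a Jucys-Murphy braid between the two
remaining crossings. -/
theorem hopfTrace_succ_right (hu : u ≠ 0) {k n m : ℕ} (hk : n + m = k) {A B : FreeAlgebra K ℕ}
    (hA : A ∈ braidAlgebra K n) (hB : B ∈ braidAlgebra K m) :
    hopfTrace u N (k + 1) n (m + 1) A B = hopfTrace u N k n m (A * encircle u N n) B := by
  have h1 : cross (braidGen u N (k + 1)) n (m + 1) * cross (braidGen u N (k + 1)) (m + 1) n =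
      extLast K N k (cross (braidGen u N k) n m) * murphy (braidGen u N (k + 1)) m n *
        extLast K N k (cross (braidGen u N k) m n) := by
    rw [cross_succ, (isBraided_braidGen N hu (k + 1)).cross_succ_left, extLast_cross N hk.le,
      extLast_cross N (by omega), murphy]
    simp only [mul_assoc]
  have h2 := braidAct_mul_cross N hu hk.le (encircle_mem u N n)
  have h3 := commute_braidAct_braidAct (u := u) N (k := k) (encircle_mem u N n) hB
  rw [hopfTrace, hopfTrace, h1, ← extLast_braidAct u N (by omega) hA,
    ← extLast_braidAct u N hk.le hB, ← trace_partialTrace]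
  congr 2
  have h4 : ∀ a b c d e : TensorEnd K N (k + 1), a * b * (c * d * e) = (a * b * c) * d * e := by
    intros
    simp only [mul_assoc]
  rw [h4, ← map_mul, ← map_mul, partialTrace_mul_extLast, partialTrace_extLast_mul,
    partialTrace_murphy_eq N hu (by omega), map_mul]
  rw [mul_assoc (braidAct u N k 0 A) (braidAct u N k 0 (encircle u N n)), h3.eq]
  rw [mul_assoc _ (cross (braidGen u N k) n m), ← h2]
  simp only [mul_assoc]

/-- The elements of the braid algebra on `n` strands for which the invariant of the Hopf link is the
pairing of the characters. -/
def IsPaired (u : K) (N n : ℕ) (A : FreeAlgebra K ℕ) : Prop :=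
  A ∈ braidAlgebra K n ∧ ∀ m, ∀ B ∈ braidAlgebra K m,
    IsAlternating (altCharacter m (braidAct u N m 0 B)) →
    (N.factorial : K) * alternant (fun i : Fin N => (u ^ 2) ^ shifted N ⊥ i) (shifted N ⊥) *
        hopfTrace u N (n + m) n m A B =
      (u ^ (1 - (N : ℤ))) ^ (n + m) * powPairing (u ^ 2) (altCharacter m (braidAct u N m 0 B))
        (altCharacter n (braidAct u N n 0 A))

theorem altCharacter_succ {n : ℕ} {A : FreeAlgebra K ℕ} (hA : A ∈ braidAlgebra K n) :
    altCharacter (n + 1) (braidAct u N (n + 1) 0 A) =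
      (∑ i, MvPolynomial.X i) * altCharacter n (braidAct u N n 0 A) := by
  rw [← extLast_braidAct u N (by omega) hA, altCharacter_extLast]

/-- With an empty first cable the invariant is the quantum trace of B, that is, its character at q^δ
up to normalization. Pairing with the Weyl denominator gives the same value times N!, and this is
where B has to have an alternating character. -/
theorem isPaired_one (hu : u ≠ 0) : IsPaired u N 0 1 := by
  refine ⟨one_mem _, fun m B hB hB' => ?_⟩
  have h1 : ∀ m k, cross (braidGen u N k) m 0 = 1 := fun _ _ => rfl
  have h0 : ∀ m k, cross (braidGen u N k) 0 m = 1 := fun m k => by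
    induction m with
    | zero => rfl
    | succ m ih => rw [cross_succ, ih, desc_zero, mul_one]
  rw [map_one, altCharacter_one_zero, powPairing_altPoly _ hB', eval_altCharacter, zero_add,
    hopfTrace, h1, h0, map_one, one_mul, one_mul, mul_one]
  have h2 : ∀ (M : TensorEnd K N m), Matrix.trace (M * torus (quantumWeight u N) m) =
      (u ^ (1 - (N : ℤ))) ^ m *
        Matrix.trace (M * torus (fun i : Fin N => (u ^ 2) ^ shifted N ⊥ i) m) := by
    intro M
    simp only [Matrix.trace, Matrix.diag_apply, torus, Matrix.mul_diagonal]
    rw [Finset.mul_sum]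
    refine Finset.sum_congr rfl fun f _ => ?_
    have h3 : ∀ i : Fin N, quantumWeight u N i = u ^ (1 - (N : ℤ)) * (u ^ 2) ^ shifted N ⊥ i := by
      intro i
      have hi := i.2
      rw [quantumWeight, ← pow_mul, ← zpow_natCast, ← zpow_add₀ hu, shifted_bot]
      congr 1
      push_cast [Nat.cast_sub (show (i : ℕ) ≤ N - 1 by omega), Nat.cast_sub (show 1 ≤ N by omega)]
      ring
    simp only [h3, Finset.prod_mul_distrib, Finset.prod_const, Finset.card_univ, Fintype.card_fin]
    ring
  rw [h2]
  ring

variable {N}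

theorem IsPaired.congr {n : ℕ} {A A' : FreeAlgebra K ℕ} (h : IsPaired u N n A)
    (hA' : A' ∈ braidAlgebra K n)
    (hAA' : ∀ k, n ≤ k → braidAct u N k 0 A = braidAct u N k 0 A') : IsPaired u N n A' := by
  refine ⟨hA', fun m B hB hB' => ?_⟩
  rw [hopfTrace, ← hAA' _ (by omega), ← hAA' _ le_rfl]
  exact h.2 m B hB hB'

theorem IsPaired.add {n : ℕ} {A A' : FreeAlgebra K ℕ} (h : IsPaired u N n A)
    (h' : IsPaired u N n A') : IsPaired u N n (A + A') := by
  refine ⟨add_mem h.1 h'.1, fun m B hB hB' => ?_⟩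
  have h1 := h.2 m B hB hB'
  have h2 := h'.2 m B hB hB'
  have h3 : hopfTrace u N (n + m) n m (A + A') B =
      hopfTrace u N (n + m) n m A B + hopfTrace u N (n + m) n m A' B := by
    simp only [hopfTrace, map_add, add_mul, Matrix.trace_add]
  rw [h3, mul_add, h1, h2, map_add, map_add, map_add, mul_add]

theorem IsPaired.smul {n : ℕ} {A : FreeAlgebra K ℕ} (h : IsPaired u N n A) (c : K) :
    IsPaired u N n (c • A) := by
  refine ⟨Subalgebra.smul_mem _ h.1 c, fun m B hB hB' => ?_⟩
  have h1 := h.2 m B hB hB'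
  have h3 : hopfTrace u N (n + m) n m (c • A) B = c * hopfTrace u N (n + m) n m A B := by
    simp only [hopfTrace, map_smul, Matrix.smul_mul, Matrix.trace_smul, smul_eq_mul]
  rw [h3, mul_left_comm, h1, map_smul, map_smul, map_smul, smul_eq_mul, mul_left_comm]

/-- A loop around the first cable is a new strand of the second one, which multiplies the character
of B by p_1; adjointness moves p_1 to the character of A. Here the quantification over all m is
used. -/
theorem IsPaired.mul_encircle [CharZero K] (hu : u ≠ 0) {n : ℕ} {A : FreeAlgebra K ℕ} (h : IsPaired u N n A) :
    IsPaired u N n (A * encircle u N n) := by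
  refine ⟨mul_mem h.1 (encircle_mem u N n), fun m B hB hB' => ?_⟩
  have h1 := h.2 (m + 1) B (braidAlgebra_mono (by omega) hB)
  rw [altCharacter_succ N hB] at h1
  have h2 := h1 hB'.psum_mul
  rw [← add_assoc, hopfTrace_succ_right N hu rfl h.1 hB] at h2
  rw [h2, altCharacter_mul_encircle hu, map_smul, powPairing_scaleSum, smul_eq_mul]
  ring

/-- The mirror argument: with the cables exchanged, the new strand of the first cable is a loop
around the second one, and the hypothesis is applied to B times that loop. -/
theorem IsPaired.succ [CharZero K] (hu : u ≠ 0) {n : ℕ} {A : FreeAlgebra K ℕ} (h : IsPaired u N n A) :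
    IsPaired u N (n + 1) A := by
  refine ⟨braidAlgebra_mono (by omega) h.1, fun m B hB hB' => ?_⟩
  have hBe : B * encircle u N m ∈ braidAlgebra K m := mul_mem hB (encircle_mem u N m)
  have h1 := h.2 m (B * encircle u N m) hBe
  rw [altCharacter_mul_encircle hu] at h1
  have h2 := h1 ((hB'.scaleSum _).smul _)
  rw [hopfTrace_comm N hu le_rfl h.1 hBe,
    ← hopfTrace_succ_right N hu (add_comm m n) hB h.1, hopfTrace_comm N hu (by omega) hB
    (braidAlgebra_mono (by omega) h.1), powPairing_smul_right] at h2
  have e : n + 1 + m = n + m + 1 := by omega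
  rw [e, h2, altCharacter_succ N h.1, powPairing_psum_mul]
  ring

theorem commute_braidAct_murphyElem (hu : u ≠ 0) {k n : ℕ} (hk : n < k) {A : FreeAlgebra K ℕ}
    (hA : A ∈ braidAlgebra K n) :
    Commute (braidAct u N k 0 A) (braidAct u N k 0 (murphyElem K n)) := by
  rw [braidAct_murphyElem]
  exact commute_braidAct u N (fun i hi =>
    (isBraided_braidGen N hu k).commute_murphy hi (by omega)) hA

/-- Loops around n + 1 and around n strands differ by a multiple of J_n, and J_n commutes with the
smaller loop. One more power of J_n is therefore available from operations that preserve `IsPaired`.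
-/
theorem braidAct_mul_murphyElem_pow_succ (hu : u ≠ 0) {k n : ℕ} (hk : n < k) (A : FreeAlgebra K ℕ)
    (j : ℕ) :
    braidAct u N k 0 (A * murphyElem K n ^ j * encircle u N (n + 1) +
        (-1 : K) • (A * encircle u N n * murphyElem K n ^ j)) =
      braidAct u N k 0 ((u ^ ((N : ℤ) - 1) * (u ^ 2 - 1)) • (A * murphyElem K n ^ (j + 1))) := by
  have h := ((commute_braidAct_murphyElem (N := N) hu hk (encircle_mem u N n)).pow_right j).eq
  rw [encircle_succ]
  simp only [map_add, map_smul, map_mul, map_pow, mul_add, pow_succ, mul_smul_comm, mul_assoc]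
  rw [h, neg_one_smul]
  abel

theorem IsPaired.mul_murphyElem_pow [CharZero K] (hu : u ≠ 0) (hq : u ^ 2 ≠ 1) {n : ℕ} {A : FreeAlgebra K ℕ}
    (h : IsPaired u N n A) (j : ℕ) : IsPaired u N (n + 1) (A * murphyElem K n ^ j) := by
  induction j generalizing A with
  | zero =>
    rw [pow_zero, mul_one]
    exact h.succ hu
  | succ j ih =>
    -- The induction generalizes A because the second term needs the hypothesis for A times the loop
    -- around n strands. The factor u^{N-1}(q - 1) is invertible as q ≠ 1.
    have h1 := ((ih h).mul_encircle hu).add ((ih (h.mul_encircle hu)).smul (-1))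
    have hc : u ^ ((N : ℤ) - 1) * (u ^ 2 - 1) ≠ 0 :=
      mul_ne_zero (zpow_ne_zero _ hu) (sub_ne_zero.2 hq)
    have hm : A * murphyElem K n ^ (j + 1) ∈ braidAlgebra K (n + 1) :=
      mul_mem (braidAlgebra_mono (by omega) h.1) (pow_mem (murphyElem_mem n) _)
    have h2 := h1.congr (Subalgebra.smul_mem _ hm _) fun k hk =>
      braidAct_mul_murphyElem_pow_succ hu hk A j
    have h3 := h2.smul (u ^ ((N : ℤ) - 1) * (u ^ 2 - 1))⁻¹
    rwa [smul_smul, inv_mul_cancel₀ hc, one_smul] at h3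

theorem IsPaired.mul_aeval_murphyElem [CharZero K] (hu : u ≠ 0) (hq : u ^ 2 ≠ 1) {n : ℕ} {A : FreeAlgebra K ℕ}
    (h : IsPaired u N n A) (f : K[X]) :
    IsPaired u N (n + 1) (A * Polynomial.aeval (murphyElem K n) f) := by
  induction f using Polynomial.induction_on' with
  | add p r hp hr =>
    rw [map_add, mul_add]
    exact hp.add hr
  | monomial j a =>
    rw [Polynomial.aeval_monomial, ← Algebra.smul_def, mul_smul_comm]
    exact (h.mul_murphyElem_pow hu hq j).smul a

end HopfTrace

/-! ### The characters of the Young idempotents -/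

section AltPoly

variable {K : Type*} [Field K] {N : ℕ}

theorem scaleSum_altPoly (q : K) (a : Fin N → ℕ) :
    scaleSum q (altPoly a) = (∑ i, q ^ a i) • altPoly a := by
  rw [altPoly_eq_sum, map_sum, Finset.smul_sum]
  refine Finset.sum_congr rfl fun s _ => ?_
  rw [map_smul, mono, scaleSum_monomial, smul_comm, Finsupp.coe_equivFunOnFinite_symm]
  congr 1
  exact Equiv.sum_comp s fun i => q ^ a i

theorem psum_mul_altPoly (a : Fin N → ℕ) : (∑ i, MvPolynomial.X i) * altPoly a =
    ∑ r, (altPoly (Function.update a r (a r + 1)) : MvPolynomial (Fin N) K) := by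
  simp only [altPoly_eq_sum]
  rw [Finset.sum_comm, Finset.mul_sum]
  refine Finset.sum_congr rfl fun s _ => ?_
  rw [← Finset.smul_sum, mul_smul_comm, Finset.sum_mul]
  congr 1
  conv_rhs => rw [← Equiv.sum_comp s]
  refine Finset.sum_congr rfl fun i _ => ?_
  rw [mono_eq_prod, mono_eq_prod, ← Finset.mul_prod_erase Finset.univ _ (Finset.mem_univ i),
    ← Finset.mul_prod_erase Finset.univ (fun j => MvPolynomial.X j ^
      (Function.update a (s i) (a (s i) + 1) ∘ s) j) (Finset.mem_univ i)]
  simp only [Function.comp_apply, Function.update_self]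
  rw [← mul_assoc, ← pow_succ']
  congr 1
  refine Finset.prod_congr rfl fun j hj => ?_
  rw [Function.update_of_ne fun h => Finset.ne_of_mem_erase hj (s.injective h)]

theorem altPoly_eq_zero {a : Fin N → ℕ} {i j : Fin N} (hij : i ≠ j) (h : a i = a j) :
    (altPoly a : MvPolynomial (Fin N) K) = 0 := by
  rw [altPoly, alternant]
  refine Matrix.det_zero_of_column_eq hij fun k => ?_
  simp only [Matrix.of_apply, h]

variable [CharZero K] {u : K}

/-- A new strand raises one exponent a_r. Alternants are eigenvectors of the loop with eigenvalue
u^{1-N} ∑ q^{a_i}, and the difference of the eigenvalues after and before the raise, divided by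
u^{N-1}(q - 1), is q^{a_r + 1 - N}, the power of q given by the content of the added box. -/
theorem altCharacter_mul_murphyElem_pow (hu : u ≠ 0) (hq : u ^ 2 ≠ 1) {n : ℕ} {A : FreeAlgebra K ℕ}
    (hA : A ∈ braidAlgebra K n) {c : K} {a : Fin N → ℕ}
    (h : altCharacter n (braidAct u N n 0 A) = c • altPoly a) (j : ℕ) :
    altCharacter (n + 1) (braidAct u N (n + 1) 0 (A * murphyElem K n ^ j)) =
      c • ∑ r, ((u ^ 2) ^ ((a r : ℤ) + 1 - N)) ^ j •
        (altPoly (Function.update a r (a r + 1)) : MvPolynomial (Fin N) K) := by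
  have hu2 : u ^ 2 ≠ 0 := pow_ne_zero 2 hu
  induction j generalizing A c with
  | zero =>
    simp only [pow_zero, mul_one, one_smul]
    rw [altCharacter_succ N hA, h, mul_smul_comm, psum_mul_altPoly]
  | succ j ih =>
    have hc : u ^ ((N : ℤ) - 1) * (u ^ 2 - 1) ≠ 0 :=
      mul_ne_zero (zpow_ne_zero _ hu) (sub_ne_zero.2 hq)
    have h1 := congrArg (altCharacter (n + 1))
      (braidAct_mul_murphyElem_pow_succ (N := N) hu (Nat.lt_succ_self n) A j)
    have h2 : altCharacter n (braidAct u N n 0 (A * encircle u N n)) =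
        (c * (u ^ (1 - (N : ℤ)) * ∑ i, (u ^ 2) ^ a i)) • altPoly a := by
      rw [altCharacter_mul_encircle hu, h, map_smul, scaleSum_altPoly, smul_smul, smul_smul]
      congr 1
      ring
    rw [map_add, map_add, map_smul, map_smul, map_smul, map_smul, altCharacter_mul_encircle hu,
      ih hA h, ih (mul_mem hA (encircle_mem u N n)) h2] at h1
    rw [← inv_smul_smul₀ hc (altCharacter (n + 1) _), ← h1, inv_smul_eq_iff₀ hc]
    simp only [map_smul, map_sum, Finset.smul_sum, scaleSum_altPoly, smul_smul]
    rw [← Finset.sum_add_distrib]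
    refine Finset.sum_congr rfl fun r _ => ?_
    rw [← add_smul]
    congr 1
    have h3 : ∑ i, (u ^ 2) ^ Function.update a r (a r + 1) i =
        (∑ i, (u ^ 2) ^ a i) + (u ^ 2) ^ a r * (u ^ 2 - 1) := by
      rw [← Finset.add_sum_erase Finset.univ _ (Finset.mem_univ r),
        ← Finset.add_sum_erase Finset.univ (fun i => (u ^ 2) ^ a i) (Finset.mem_univ r),
        Function.update_self, Finset.sum_congr rfl fun i hi => by
          rw [Function.update_of_ne (Finset.ne_of_mem_erase hi)], pow_succ]
      ring
    have h4 : u ^ ((N : ℤ) - 1) * (u ^ 2) ^ ((a r : ℤ) + 1 - N) =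
        u ^ (1 - (N : ℤ)) * (u ^ 2) ^ a r := by
      rw [← zpow_natCast (u ^ 2) (a r), ← zpow_natCast u 2, ← zpow_mul, ← zpow_mul, ← zpow_add₀ hu,
        ← zpow_add₀ hu]
      congr 1
      push_cast
      ring
    rw [h3, pow_succ ((u ^ 2) ^ ((a r : ℤ) + 1 - N)) j]
    linear_combination (-c * ((u ^ 2) ^ ((a r : ℤ) + 1 - N)) ^ j * (u ^ 2 - 1)) * h4

theorem altCharacter_mul_aeval_murphyElem (hu : u ≠ 0) (hq : u ^ 2 ≠ 1) {n : ℕ}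
    {A : FreeAlgebra K ℕ} (hA : A ∈ braidAlgebra K n) {c : K} {a : Fin N → ℕ}
    (h : altCharacter n (braidAct u N n 0 A) = c • altPoly a) (f : K[X]) :
    altCharacter (n + 1) (braidAct u N (n + 1) 0 (A * Polynomial.aeval (murphyElem K n) f)) =
      c • ∑ r, f.eval ((u ^ 2) ^ ((a r : ℤ) + 1 - N)) •
        (altPoly (Function.update a r (a r + 1)) : MvPolynomial (Fin N) K) := by
  induction f using Polynomial.induction_on' with
  | add p r hp hr =>
    rw [map_add, mul_add, map_add, map_add, hp, hr, ← smul_add, ← Finset.sum_add_distrib]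
    simp only [Polynomial.eval_add, add_smul]
  | monomial j b =>
    rw [Polynomial.aeval_monomial, ← Algebra.smul_def, mul_smul_comm, map_smul, map_smul,
      altCharacter_mul_murphyElem_pow hu hq hA h, smul_comm, Finset.smul_sum]
    simp only [Polynomial.eval_monomial, mul_smul]

end AltPoly

/-! ### Young idempotents and the evaluation of the Hopf invariant. -/

section YoungElem

variable {K : Type*} [Field K] (u : K)

/-- The product of Lagrange polynomials in Jucys-Murphy elements that belongs to a list of
contents. -/
def contentElem (cs : List ℤ) : FreeAlgebra K ℕ :=
  (cs.zipIdx.map fun ck => Polynomial.aeval (murphyElem K ck.2)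
    (Lagrange.basis (Finset.Icc (-(ck.2 : ℤ)) ck.2) (fun d : ℤ => (u ^ 2) ^ d) ck.1)).prod

theorem contentElem_append (cs : List ℤ) (c : ℤ) : contentElem u (cs ++ [c]) =
    contentElem u cs * Polynomial.aeval (murphyElem K cs.length)
      (Lagrange.basis (Finset.Icc (-(cs.length : ℤ)) cs.length) (fun d : ℤ => (u ^ 2) ^ d) c) := by
  rw [contentElem, List.zipIdx_append, List.map_append, List.prod_append, zero_add]
  simp [contentElem]

theorem contentElem_mem (cs : List ℤ) : contentElem u cs ∈ braidAlgebra K cs.length := by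
  induction cs using List.reverseRecOn with
  | nil => exact one_mem _
  | append_singleton cs c ih =>
    rw [contentElem_append, List.length_append, List.length_singleton]
    exact mul_mem (braidAlgebra_mono (by omega) ih)
      (Algebra.adjoin_le (Set.singleton_subset_iff.2 (murphyElem_mem _))
        (Polynomial.aeval_mem_adjoin_singleton K _))

theorem isPaired_contentElem [CharZero K] {u : K} (hu : u ≠ 0) (hq : u ^ 2 ≠ 1) (N : ℕ)
    (cs : List ℤ) : IsPaired u N cs.length (contentElem u cs) := by
  induction cs using List.reverseRecOn with
  | nil => exact isPaired_one N hu
  | append_singleton cs c ih =>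
    rw [contentElem_append, List.length_append, List.length_singleton]
    exact ih.mul_aeval_murphyElem hu hq _

theorem braidOp_append (N n : ℕ) (v w : List ℕ) :
    braidOp u N n (v ++ w) = braidOp u N n v * braidOp u N n w := by
  rw [braidOp, List.map_append, List.prod_append]; rfl

theorem braidOp_asc (N n a k : ℕ) :
    braidOp u N n ((List.range k).map (a + ·)) = asc (braidGen u N n) a k := by
  induction k with
  | zero => rfl
  | succ k ih =>
    rw [List.range_succ, List.map_append, braidOp_append, ih, asc_succ]
    simp [braidOp]

theorem braidOp_desc (N n a k : ℕ) :
    braidOp u N n ((List.range k).reverse.map (a + ·)) = desc (braidGen u N n) a k := by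
  induction k with
  | zero => rfl
  | succ k ih =>
    rw [List.range_succ, List.reverse_append, List.map_append, braidOp_append, ih, desc_succ]
    simp [braidOp]

theorem braidOp_murphyWord (N n a k : ℕ) :
    braidOp u N n (murphyWord a k) = murphy (braidGen u N n) a k := by
  rw [murphyWord, braidOp_append, braidOp_asc, braidOp_desc, murphy]

theorem braidOp_crossWord (N k n m : ℕ) :
    braidOp u N k (crossWord n m) = cross (braidGen u N k) n m := by
  induction m with
  | zero => rfl
  | succ m ih =>
    have h : crossWord n (m + 1) = crossWord n m ++ (List.range n).reverse.map (m + ·) := by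
      have hr : (List.range n).reverse = (List.range n).map fun i => n - 1 - i := by
        rw [List.range_eq_range', List.reverse_range', List.range_eq_range', zero_add]
      rw [crossWord, List.range_succ, List.flatMap_append, crossWord, hr, List.map_map]
      simp [Function.comp_def]
    rw [h, braidOp_append, ih, braidOp_desc, cross_succ]

theorem braidAct_contentElem (N n a : ℕ) (l : YoungDiagram) :
    braidAct u N n a (contentElem u (contents l)) = youngIdempotent u N n a l := by
  rw [contentElem, map_list_prod, List.map_map, youngIdempotent]
  congr 2
  ext1 ck
  rw [Function.comp_apply, ← Polynomial.aeval_algHom_apply, braidAct_murphyElem, braidOp_murphyWord]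

theorem hopfInvariant_eq (N : ℕ) (l m : YoungDiagram) : hopfInvariant u N l m =
    hopfTrace u N (l.card + m.card) l.card m.card (contentElem u (contents l))
      (contentElem u (contents m)) := by
  rw [hopfInvariant, hopfTrace, braidAct_contentElem, braidAct_contentElem, braidOp_append,
    braidOp_crossWord, braidOp_crossWord, pivotal_eq_torus]

/-- The contents of the first `i` rows and of the first `j` cells of the next row. -/
def partialContents (l : YoungDiagram) (i j : ℕ) : List ℤ :=
  ((List.range i).flatMap fun i => (List.range (l.rowLen i)).map fun j : ℕ => (j : ℤ) - i) ++
    (List.range j).map fun j : ℕ => (j : ℤ) - i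

theorem partialContents_succ_right (l : YoungDiagram) (i j : ℕ) :
    partialContents l i (j + 1) = partialContents l i j ++ [(j : ℤ) - i] := by
  rw [partialContents, List.range_succ, List.map_append, ← List.append_assoc]
  rfl

theorem partialContents_succ_left (l : YoungDiagram) (i : ℕ) :
    partialContents l (i + 1) 0 = partialContents l i (l.rowLen i) := by
  rw [partialContents, List.range_succ, List.flatMap_append, partialContents]
  simp

theorem partialContents_colLen (l : YoungDiagram) :
    partialContents l (l.colLen 0) 0 = contents l := by
  have h (L : List ℕ) : L.flatMap (fun a : ℕ => [(a : ℤ)]) = L.map fun a : ℕ => (a : ℤ) := by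
    induction L <;> simp_all
  rw [partialContents, contents]
  simp [h, Function.comp_def]

theorem length_partialContents (l : YoungDiagram) (i j : ℕ) :
    (partialContents l i j).length = ∑ r ∈ Finset.range i, l.rowLen r + j := by
  induction i generalizing j with
  | zero => simp [partialContents]
  | succ i ih =>
    have h : (partialContents l (i + 1) j).length = (partialContents l (i + 1) 0).length + j := by
      simp [partialContents]
    rw [h, partialContents_succ_left, ih, Finset.sum_range_succ]

theorem length_contents (l : YoungDiagram) : (contents l).length = l.card := by
  rw [← partialContents_colLen, length_partialContents, add_zero, card_eq_sum_rowLen l le_rfl]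

/-- The exponents that belong to the first `i` rows and to `j` cells of the next row. -/
def partialShifted (l : YoungDiagram) (N i j : ℕ) (r : Fin N) : ℕ :=
  (if (r : ℕ) < i then l.rowLen r else if (r : ℕ) = i then j else 0) + (N - 1 - r)

variable {u}

theorem zpow_injective_of_ne_one {q : K} (hq0 : q ≠ 0) (hq : ∀ n : ℕ, 0 < n → q ^ n ≠ 1) :
    Function.Injective fun d : ℤ => q ^ d := by
  have h : ∀ a b : ℤ, a < b → q ^ a ≠ q ^ b := by
    intro a b hab h
    obtain ⟨n, rfl⟩ : ∃ n : ℕ, b = a + n := ⟨(b - a).toNat, by omega⟩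
    rw [zpow_add₀ hq0, zpow_natCast] at h
    refine hq n (by omega) (mul_left_cancel₀ (zpow_ne_zero a hq0) ?_)
    rw [← h, mul_one]
  intro a b hab
  by_contra hne
  rcases lt_or_gt_of_ne hne with h1 | h1
  · exact h a b h1 hab
  · exact h b a h1 hab.symm

variable [CharZero K]

/-- The Lagrange polynomial in the next Jucys-Murphy element selects the box of content j - i among
all boxes that can be added. If row i does not fit into N variables, nothing is selected. -/
theorem altCharacter_contentElem_step (hu : u ≠ 0) (hq : ∀ n : ℕ, 0 < n → u ^ n ≠ 1)
    (l : YoungDiagram) (N : ℕ) {i j : ℕ} (hj : j < l.rowLen i) {c : K}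
    (h : altCharacter (partialContents l i j).length
      (braidAct u N _ 0 (contentElem u (partialContents l i j))) =
        c • altPoly (partialShifted l N i j)) :
    altCharacter (partialContents l i (j + 1)).length
      (braidAct u N _ 0 (contentElem u (partialContents l i (j + 1)))) =
        (if i < N then c else 0) • altPoly (partialShifted l N i (j + 1)) := by
  have hq2 := sq_pow_ne_one hq
  have hu2 : u ^ 2 ≠ 0 := pow_ne_zero 2 hu
  have hinj := zpow_injective_of_ne_one hu2 hq2
  have hk := length_partialContents l i j
  rw [partialContents_succ_right, contentElem_append, List.length_append, List.length_singleton]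
  rw [altCharacter_mul_aeval_murphyElem hu (by simpa using hq2 1 one_pos) (contentElem_mem u _) h]
  set k := (partialContents l i j).length
  have hrow : ∀ r ≤ i, 0 < l.rowLen r := fun r hr =>
    (Nat.zero_le j).trans_lt (hj.trans_le (l.rowLen_anti r i hr))
  have hik : i + j ≤ k := by
    rw [hk]
    have : ∑ r ∈ Finset.range i, 1 ≤ ∑ r ∈ Finset.range i, l.rowLen r :=
      Finset.sum_le_sum fun r hr => hrow r (Finset.mem_range.1 hr).le
    simp at this
    omega
  have hlk : ∀ r < i, l.rowLen r ≤ k := fun r hr => by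
    rw [hk]
    have := Finset.single_le_sum (f := fun r => l.rowLen r) (fun _ _ => Nat.zero_le _)
      (Finset.mem_range.2 hr)
    omega
  have hmem : (j : ℤ) - i ∈ Finset.Icc (-(k : ℤ)) k := by
    rw [Finset.mem_Icc]
    omega
  -- A row above i gives a larger content, and the row i + 1, when j > 0, a smaller one; both are
  -- other nodes of the Lagrange basis. Any other row below i cannot be extended, and its alternant
  -- has two equal exponents.
  have hzero : ∀ r : Fin N, (r : ℕ) ≠ i →
      (Lagrange.basis (Finset.Icc (-(k : ℤ)) k) (fun d : ℤ => (u ^ 2) ^ d) ((j : ℤ) - i)).eval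
        ((u ^ 2) ^ ((partialShifted l N i j r : ℤ) + 1 - N)) •
      (altPoly (Function.update (partialShifted l N i j) r (partialShifted l N i j r + 1)) :
        MvPolynomial (Fin N) K) = 0 := by
    intro r hr
    have hrN := r.2
    rcases Nat.lt_or_ge r i with hri | hri
    · have e : ((partialShifted l N i j r : ℤ) + 1 - N) = (l.rowLen r : ℤ) - (r : ℕ) := by
        rw [partialShifted, if_pos hri]
        omega
      have h1 := hlk r hri
      have h2 := l.rowLen_anti r i hri.le
      rw [e, Lagrange.eval_basis_of_ne (s := Finset.Icc (-(k : ℤ)) k) (v := fun d : ℤ => (u ^ 2) ^ d)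
        (i := (j : ℤ) - i) (j := (l.rowLen r : ℤ) - (r : ℕ)) (by omega)
        (by rw [Finset.mem_Icc]; omega), zero_smul]
    · have hir : i < r := by omega
      have e0 : partialShifted l N i j r = N - 1 - r := by
        rw [partialShifted, if_neg (by omega), if_neg (by omega), zero_add]
      by_cases hcase : (r : ℕ) = i + 1 ∧ 0 < j
      · have e : ((partialShifted l N i j r : ℤ) + 1 - N) = -((r : ℕ) : ℤ) := by
          rw [e0]
          omega
        rw [e, Lagrange.eval_basis_of_ne (s := Finset.Icc (-(k : ℤ)) k)
          (v := fun d : ℤ => (u ^ 2) ^ d) (i := (j : ℤ) - i) (j := -((r : ℕ) : ℤ)) (by omega)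
          (by rw [Finset.mem_Icc]; omega), zero_smul]
      · have hne : r ≠ ⟨r - 1, by omega⟩ := by
          intro h
          have := congrArg Fin.val h
          simp only at this
          omega
        rw [altPoly_eq_zero hne, smul_zero]
        rw [Function.update_self, Function.update_of_ne hne.symm, e0, partialShifted]
        simp only
        split_ifs <;> omega
  split_ifs with hiN
  · rw [Finset.sum_eq_single (⟨i, hiN⟩ : Fin N) (fun r _ hr => hzero r fun h => hr (Fin.ext h))
      fun h => absurd (Finset.mem_univ _) h]
    have e : ((partialShifted l N i j ⟨i, hiN⟩ : ℤ) + 1 - N) = (j : ℤ) - i := by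
      rw [partialShifted, if_neg (lt_irrefl i), if_pos rfl]
      simp only
      omega
    rw [e, Lagrange.eval_basis_self (s := Finset.Icc (-(k : ℤ)) k) (v := fun d : ℤ => (u ^ 2) ^ d)
      hinj.injOn hmem, one_smul]
    congr 2
    ext r
    by_cases hr : r = ⟨i, hiN⟩
    · subst hr
      rw [Function.update_self, partialShifted, partialShifted, if_neg (lt_irrefl i),
        if_neg (lt_irrefl i), if_pos rfl, if_pos rfl]
      omega
    · have hr' : (r : ℕ) ≠ i := fun h => hr (Fin.ext h)
      rw [Function.update_of_ne hr, partialShifted, partialShifted, if_neg hr', if_neg hr']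
  · rw [Finset.sum_eq_zero fun r _ => hzero r (by omega), smul_zero, zero_smul]

theorem altCharacter_partialContents (hu : u ≠ 0) (hq : ∀ n : ℕ, 0 < n → u ^ n ≠ 1)
    (l : YoungDiagram) (N i : ℕ) (hi : i ≤ l.colLen 0) :
    altCharacter (partialContents l i 0).length
      (braidAct u N _ 0 (contentElem u (partialContents l i 0))) =
        (if i ≤ N then 1 else 0 : K) • altPoly (partialShifted l N i 0) := by
  induction i with
  | zero =>
    have h : partialShifted l N 0 0 = shifted N ⊥ := by
      ext r
      rw [shifted_bot, partialShifted]
      simp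
    rw [if_pos (Nat.zero_le N), one_smul, h]
    have h2 : contentElem u (partialContents l 0 0) = 1 := rfl
    rw [h2, map_one]
    exact altCharacter_one_zero
  | succ i ih =>
    have hpos : 0 < l.rowLen i :=
      YoungDiagram.mem_iff_lt_rowLen.1 (YoungDiagram.mem_iff_lt_colLen.2 hi)
    -- The minimum records that the coefficient drops to 0 when the first box of a row with index at
    -- least N is added, not when that row is merely reached.
    have hrow : ∀ j, j ≤ l.rowLen i → altCharacter (partialContents l i j).length
      (braidAct u N _ 0 (contentElem u (partialContents l i j))) =
        (if i + min j 1 ≤ N then 1 else 0 : K) • altPoly (partialShifted l N i j) := by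
      intro j
      induction j with
      | zero =>
        intro _
        exact ih (by omega)
      | succ j ihj =>
        intro hj
        rw [altCharacter_contentElem_step hu hq l N hj (ihj (by omega))]
        congr 1
        split_ifs <;> first | rfl | omega
    have h1 := hrow (l.rowLen i) le_rfl
    rw [← partialContents_succ_left, min_eq_right hpos] at h1
    rw [h1]
    congr 2
    ext r
    rw [partialShifted, partialShifted]
    congr 1
    rcases lt_trichotomy (r : ℕ) i with h | h | h
    · rw [if_pos h, if_pos (by omega)]
    · rw [if_neg (by omega), if_pos h, if_pos (by omega), h]
    · rw [if_neg (by omega), if_neg (by omega), if_neg (by omega)]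
      split_ifs <;> rfl

/-- The character of the Young idempotent. -/
theorem altCharacter_contents (hu : u ≠ 0) (hq : ∀ n : ℕ, 0 < n → u ^ n ≠ 1)
    (l : YoungDiagram) (N : ℕ) :
    altCharacter l.card (braidAct u N l.card 0 (contentElem u (contents l))) =
      schurMv l * altPoly (shifted N ⊥) := by
  have h := altCharacter_partialContents hu hq l N _ le_rfl
  rw [partialContents_colLen, length_contents] at h
  rw [h]
  split_ifs with hN
  · rw [one_smul, schurMv_mul_altPoly l hN]
    congr 1
    ext r
    rw [partialShifted, shifted]
    congr 1
    split_ifs with h1 h2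
    · rfl
    · rw [rowLen_eq_zero (by omega)]
    · rw [rowLen_eq_zero (by omega)]
  · rw [zero_smul, schurMv_eq_zero l (by omega), zero_mul]

/-- The colored invariant of the Hopf link in terms of Schur polynomials. -/
theorem hopfInvariant_eq_schurPoly (hu : u ≠ 0) (hq : ∀ n : ℕ, 0 < n → u ^ n ≠ 1)
    (l m : YoungDiagram) (N : ℕ) : hopfInvariant u N l m =
      (u ^ (1 - (N : ℤ))) ^ (l.card + m.card) *
        (schurPoly m (fun i : Fin N => (u ^ 2) ^ shifted N l i) *
          schurPoly l (fun i : Fin N => (u ^ 2) ^ shifted N ⊥ i)) := by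
  have hu2 : u ^ 2 ≠ 0 := pow_ne_zero 2 hu
  have hD : alternant (fun i : Fin N => (u ^ 2) ^ shifted N ⊥ i) (shifted N ⊥) ≠ 0 :=
    alternant_bot_ne_zero fun i j hij =>
      (shifted_strictAnti N ⊥).injective (pow_injective_of_ne_one hu2 (sq_pow_ne_one hq) hij)
  have hN : (N.factorial : K) ≠ 0 := Nat.cast_ne_zero.2 (Nat.factorial_ne_zero N)
  have hl := isPaired_contentElem hu (by simpa using sq_pow_ne_one hq 1 one_pos) N (contents l)
  have hm := contentElem_mem u (contents m)
  rw [length_contents] at hl hm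
  have hpair := hl.2 m.card _ hm
  rw [altCharacter_contents hu hq, altCharacter_contents hu hq, ← hopfInvariant_eq] at hpair
  apply mul_left_cancel₀ (mul_ne_zero hN hD)
  -- If m has too many rows its character is 0, which is trivially alternating, and both sides
  -- vanish. Otherwise the character is an alternant, so the pairing applies.
  rcases Nat.lt_or_ge N (m.colLen 0) with hmN | hmN
  · rw [schurMv_eq_zero m hmN, zero_mul] at hpair
    rw [hpair fun x s => by simp, powPairing_zero_right, schurPoly_eq_zero m hmN]
    ring
  rw [schurMv_mul_altPoly m hmN] at hpair
  rw [hpair (isAlternating_altPoly _)]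
  rcases Nat.lt_or_ge N (l.colLen 0) with hlN | hlN
  · rw [schurMv_eq_zero l hlN, zero_mul, map_zero, schurPoly_eq_zero l hlN]
    ring
  rw [schurMv_mul_altPoly l hlN, powPairing_altPoly _ (isAlternating_altPoly _), eval_altPoly,
    ← schurPoly_mul_alternant m hmN, alternant_pow_symm, ← schurPoly_mul_alternant l hlN]
  ring

end YoungElem

end HopfGIKV
end

/-! ### The proposition. -/

theorem proposition4p4 (lam mu : YoungDiagram) :
    ∃ P : ℕ → ℕ[X], ∀ (K : Type*) [Field K] [CharZero K] (u : K),
      u ≠ 0 → (∀ n : ℕ, 0 < n → u ^ n ≠ 1) →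
      ∃ F : K[X], (F : K⟦X⟧) = HopfGIKV.Zinst (u ^ 2) u lam mu ∧
        ∀ N : ℕ,
          (-1) ^ (lam.card + mu.card) * F.eval ((u ^ 2) ^ N) =
            (-1) ^ (lam.card + mu.card) *
              HopfGIKV.framing (u ^ 2) lam * HopfGIKV.framing (u ^ 2) mu *
              HopfGIKV.schurPoly mu
                (fun i : Fin N => u ^ (2 * ((lam.rowLen i : ℤ) + N - i) - 1)) *
              HopfGIKV.schurPoly lam (fun i : Fin N => u ^ (2 * (i : ℕ) + 1)) ∧
          (-1) ^ (lam.card + mu.card) * F.eval ((u ^ 2) ^ N) =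
            u ^ (lam.card + mu.card) * Polynomial.aeval (u ^ 2) (P N) ∧
          (N < max (lam.colLen 0) (mu.colLen 0) → F.eval ((u ^ 2) ^ N) = 0) ∧
          F.eval ((u ^ 2) ^ N) =
            HopfGIKV.framing (u ^ 2) lam * HopfGIKV.framing (u ^ 2) mu *
              u ^ (N * (lam.card + mu.card)) * HopfGIKV.hopfInvariant u N lam mu := by
  -- The polynomials are fixed before the field and u, so they depend only on the partitions and N.
  choose P hP using fun N => HopfGIKV.exists_nat_polynomial lam mu N
  refine ⟨P, fun K _ _ u hu hq => ?_⟩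
  obtain ⟨c, hc⟩ := HopfGIKV.exists_schur_mul_schur (K := K) lam mu
  obtain ⟨F, hF, hFN⟩ := HopfGIKV.exists_Zinst_eq hu hq lam mu c hc
  have hval : ∀ N : ℕ, F.eval ((u ^ 2) ^ N) =
      HopfGIKV.framing (u ^ 2) lam * HopfGIKV.framing (u ^ 2) mu *
        HopfGIKV.schurPoly mu (fun i : Fin N => u ^ (2 * ((lam.rowLen i : ℤ) + N - i) - 1)) *
        HopfGIKV.schurPoly lam (fun i : Fin N => u ^ (2 * (i : ℕ) + 1)) := fun N => by
    rw [hFN, HopfGIKV.sum_framing_mul_schurPoly hu hq lam mu c hc N]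
  refine ⟨F, hF, fun N => ⟨?_, ?_, fun hN => ?_, ?_⟩⟩
  · rw [hval]
    ring
  · rw [hval, hP N K u hu]
  · rw [hval]
    rcases lt_max_iff.1 hN with h | h
    · rw [HopfGIKV.schurPoly_eq_zero lam h, mul_zero]
    · rw [HopfGIKV.schurPoly_eq_zero mu h, mul_zero, zero_mul]
  · rw [hval, HopfGIKV.schurPoly_odd_powers hu, HopfGIKV.schurPoly_shifted hu,
      HopfGIKV.hopfInvariant_eq_schurPoly hu hq]
    -- Each strand contributes u^N · u^{1-N} = u, which is the factor between q^{l+δ} and the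
    -- half-integral powers in the Schur polynomials.
    have h : u ^ (N * (lam.card + mu.card)) * (u ^ (1 - (N : ℤ))) ^ (lam.card + mu.card) =
        u ^ (lam.card + mu.card) := by
      rw [pow_mul, ← mul_pow, ← zpow_natCast u N, ← zpow_add₀ hu, add_sub_cancel, zpow_one]
    rw [pow_add] at h
    linear_combination (-(HopfGIKV.framing (u ^ 2) lam * HopfGIKV.framing (u ^ 2) mu *
      (HopfGIKV.schurPoly mu (fun i : Fin N => (u ^ 2) ^ HopfGIKV.shifted N lam i) *
        HopfGIKV.schurPoly lam (fun i : Fin N => (u ^ 2) ^ HopfGIKV.shifted N ⊥ i)))) * h
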